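/- **Setup.** Let $k$ be a field and let $X$ be a variety over $k$ (a reduced separated $k$-scheme of finite type). Let $K_0(\mathrm{Var}_k)$ be the Grothendieck ring of varieties: it is generated as an abelian group by the isomorphism classes $[Y]$ of $k$-schemes of finite type, with relations $[Y]=[U]+[Z]$ for $Z\subset Y$ a closed subscheme with open complement $U$, and with product $[Y][Y']=[Y\times_k Y']$. Let $\varphi: K_0(\mathrm{Var}_k)\to R$ be a homomorphism to a commutative ring. If $k$ has characteristic $0$, $\varphi$ is arbitrary (for example the identity); if $k$ has positive characteristic, assume that $\varphi([Y])=\varphi([Y'])$ whenever there is a universal homeomorphism $Y\to Y'$ over $k$. **Configuration spaces.** Let $\mathrm{Sym}^nX=X^n/\mathfrak S_n$. For a partition $\lambda$ of $n$, let $w_\lambda\subset \mathrm{Sym}^nX$ be the locus of the unordered $n$-tuples in which the distinct geometric points occur with multiplicities exactly $\lambda$. The class $[E/\mathfrak S_n]$ of the image in $\mathrm{Sym}^nX$ of an $\mathfrak S_n$-stable subset $E\subset X^n$ means $\sum_i[T_i/\mathfrak S_n]$, for a finite partition of $E$ into $\mathfrak S_n$-stable locally closed subschemes $T_i$ of $X^n$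 whose quotients $T_i/\mathfrak S_n$ are $k$-schemes of finite type. This defines $[\mathrm{Sym}^nX]$ (take $E=X^n$) and $[w_\lambda]$ (take $E$ to be the preimage of $w_\lambda$), also when $\mathrm{Sym}^nX$ is not a scheme. Part of the assertion is that such partitions exist in these two cases, and that $\varphi$ of the resulting class does not depend on their choice. For partitions $\lambda,\mu$ of the same integer write $\lambda\le\mu$ if $\mu$ arises from $\lambda$ by repeatedly replacing two parts by their sum, and put $[\overline w_\lambda]=\sum_{\mu\ge\lambda}[w_\mu]$. Applying $\varphi$ to all coefficients, define in $R[[t]]$ $$\mathbf Z_X(t)=\sum_{n\ge0}[\mathrm{Sym}^nX]\,t^n,\qquad K_{(<a)}(t)=\sum_{j\ge0}\ \Big(\sum_{\mu\vdash j,\ \text{all parts of }\mu\ <a}[w_\mu]\Big)t^j,\qquad \overline K_{1^\bullet(a)}(t)=\sum_{j\ge0}[\overline w_{1^ja}]\,t^j,$$ where $1^ja$ is the partition of $j+a$ with $j$ parts equal to $1$ and one further part equal to $a$. **Proposition.** For every integer $a>1$ the series $\mathbf Z_X(t^a)$ is invertible in $R[[t]]$, and (a) $K_{(<a)}(t)=\mathbf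 Z_X(t)/\mathbf Z_X(t^a)$; (b) $\overline K_{1^\bullet(a)}(t)=t^{-a}\,\mathbf Z_X(t)\,\bigl(1-1/\mathbf Z_X(t^a)\bigr)$. In particular, for $a=2$, $\ \sum_{j\ge0}[w_{1^j}]\,t^j=\mathbf Z_X(t)/\mathbf Z_X(t^2)$, where $1^j$ is the partition of $j$ with all parts equal to $1$. -/

import Mathlib

open CategoryTheory CategoryTheory.Limits AlgebraicGeometry
open scoped PowerSeries

universe u v

noncomputable section

namespace MotivicConf

/-! ### The Grothendieck ring of varieties -/

/-- Schemes of finite type over the field `k` (with structure morphism `obj.hom`).  Morphisms of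
`k`-schemes are the morphisms of the category `Over (Spec k)`. -/
structure FTScheme (k : Type u) [Field k] where
  obj : Over (Spec (CommRingCat.of k))
  locallyOfFiniteType : LocallyOfFiniteType obj.hom
  quasiCompact : QuasiCompact obj.hom

/-- A variety over `k`: a finite type `k`-scheme which is reduced and separated over `k`. -/
structure FTScheme.IsVariety {k : Type u} [Field k] (X : FTScheme k) : Prop where
  reduced : IsReduced X.obj.left
  separated : IsSeparated X.obj.hom

/-- The relations between the symbols `[X]`, for `X` a finite type `k`-scheme, that define the
Grothendieck ring of varieties: isomorphism, cut-and-paste along a closed subscheme and its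
open complement, `[X ×ₖ Y] = [X] [Y]` and `[Spec k] = 1`. -/
inductive K0Rel (k : Type u) [Field k] :
    FreeCommRing (FTScheme k) → FreeCommRing (FTScheme k) → Prop
  | iso (X Y : FTScheme k) (e : X.obj ≅ Y.obj) :
      K0Rel k (FreeCommRing.of X) (FreeCommRing.of Y)
  | cut (X Y U : FTScheme k) (i : Y.obj ⟶ X.obj) (j : U.obj ⟶ X.obj)
      (hi : IsClosedImmersion i.left) (hj : IsOpenImmersion j.left)
      (hc : Set.range j.left = (Set.range i.left)ᶜ) :
      K0Rel k (FreeCommRing.of X) (FreeCommRing.of U + FreeCommRing.of Y)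
  | prod (X Y P : FTScheme k) (p : P.obj ⟶ X.obj) (q : P.obj ⟶ Y.obj)
      (hP : IsPullback p.left q.left X.obj.hom Y.obj.hom) :
      K0Rel k (FreeCommRing.of P) (FreeCommRing.of X * FreeCommRing.of Y)
  | point (P : FTScheme k) (hP : IsIso P.obj.hom) :
      K0Rel k (FreeCommRing.of P) 1

/-- The Grothendieck ring of varieties `K₀(Var_k)`.  Since a product of two symbols `[X]` is again
a symbol, this commutative ring, presented by the symbols and the relations `K0Rel`, is
the abelian group generated by the symbols modulo isomorphism and cut-and-paste, with the product
induced by the fibre product over `k`. -/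
abbrev K0Var (k : Type u) [Field k] : Type (u + 1) :=
  RingQuot (K0Rel k)

/-- The class `[X]` in `K₀(Var_k)`. -/
def cls {k : Type u} [Field k] (X : FTScheme k) : K0Var k :=
  RingQuot.mkRingHom (K0Rel k) (FreeCommRing.of X)

/-- A universal homeomorphism: every base change is a homeomorphism of topological spaces. -/
def IsUnivHomeo {X Y : Scheme.{u}} (f : X ⟶ Y) : Prop :=
  ∀ ⦃X₁ Y₁ : Scheme.{u}⦄ (g₁ : X₁ ⟶ X) (f₁ : X₁ ⟶ Y₁) (g : Y₁ ⟶ Y),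
    IsPullback g₁ f₁ f g → IsHomeomorph f₁

/-- The motivic measure `φ` takes the same value on the source and the target of every universal
homeomorphism. -/
def InvariantUnderUnivHomeo {k : Type u} [Field k] {R : Type v} [CommRing R]
    (φ : K0Var k →+* R) : Prop :=
  ∀ (X Y : FTScheme k) (f : X.obj ⟶ Y.obj), IsUnivHomeo f.left → φ (cls X) = φ (cls Y)

/-! ### Quotients by finite groups -/

/-- `π : V ⟶ Q` is the (geometric) quotient of the scheme `V` by the automorphisms
`act g`, `g ∈ G`. -/
structure IsGeomQuotient {G : Type} {V Q : Scheme.{u}} (act : G → (V ⟶ V)) (π : V ⟶ Q) :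
    Prop where
  invariant : ∀ g, act g ≫ π = π
  isQuotientMap : Topology.IsQuotientMap π
  /-- the geometric fibres of `π` are orbits -/
  orbits : ∀ (K : Type u) [Field K] [IsAlgClosed K] (x y : Spec (CommRingCat.of K) ⟶ V),
    x ≫ π = y ≫ π → ∃ g, y = x ≫ act g
  /-- `O_Q` is the sheaf of invariants of `π_* O_V` -/
  sections : ∀ (U : Q.Opens) (s : Γ(V, π ⁻¹ᵁ U)),
    (∀ (g : G) (h : π ⁻¹ᵁ U ≤ act g ⁻¹ᵁ π ⁻¹ᵁ U), (act g).appLE (π ⁻¹ᵁ U) (π ⁻¹ᵁ U) h s = s) →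
      ∃! t : Γ(Q, U), π.app U t = s

/-- The `n`-fold product `X ×ₖ ⋯ ×ₖ X` (it is `Spec k` for `n = 0`). -/
abbrev power {k : Type u} [Field k] (X : FTScheme k) (n : ℕ) : Over (Spec (CommRingCat.of k)) :=
  ∏ᶜ fun _ : Fin n => X.obj

/-- The `i`-th projection `Xⁿ ⟶ X`. -/
def coord {k : Type u} [Field k] (X : FTScheme k) (n : ℕ) (i : Fin n) : power X n ⟶ X.obj :=
  Pi.π (fun _ : Fin n => X.obj) i

/-- The permutation of the factors of `Xⁿ` by `σ`. -/
def permute {k : Type u} [Field k] (X : FTScheme k) (n : ℕ) (σ : Equiv.Perm (Fin n)) :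
    power X n ⟶ power X n :=
  Pi.lift fun i => coord X n (σ i)

/-- Let `E` be a subset of `Xⁿ` stable under the symmetric group `S_n`.  A stratified quotient
`E / S_n` is a finite partition of `E` into `S_n`-stable locally closed subschemes `T i` of `Xⁿ`,
together with a finite type `k`-scheme `Q i` which is the quotient of `T i` by `S_n`, for
each `i`. -/
structure StratifiedQuotient {k : Type u} [Field k] (X : FTScheme k) (n : ℕ)
    (E : Set (power X n).left) where
  size : ℕ
  T : Fin size → Over (Spec (CommRingCat.of k))
  emb : ∀ i, T i ⟶ power X n
  isImmersion : ∀ i, IsImmersion (emb i).left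
  disjoint : Pairwise fun i j =>
    Disjoint (Set.range (emb i).left) (Set.range (emb j).left)
  cover : ⋃ i, Set.range (emb i).left = E
  act : ∀ i, Equiv.Perm (Fin n) → (T i ⟶ T i)
  act_emb : ∀ i σ, act i σ ≫ emb i = emb i ≫ permute X n σ
  Q : Fin size → FTScheme k
  proj : ∀ i, T i ⟶ (Q i).obj
  isGeomQuotient : ∀ i, IsGeomQuotient (fun σ => (act i σ).left) (proj i).left

/-- `c = ∑ [Q i]` for some stratified quotient of `E` by `S_n`.  Thus `c` is the class of the
image of `E` in `Symⁿ X = Xⁿ / S_n`.  If `E` is (the underlying set of) a locally closed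
subscheme of `Xⁿ` whose quotient `E / S_n` is a scheme, `c = [E / S_n]` is allowed: take
a single stratum. -/
def IsImageClass {k : Type u} [Field k] (X : FTScheme k) (n : ℕ) (E : Set (power X n).left)
    (c : K0Var k) : Prop :=
  ∃ s : StratifiedQuotient X n E, c = ∑ i, cls (s.Q i)

/-- A chosen class in `K₀(Var_k)` of the image of `E` in `Symⁿ X`. -/
def imageClass {k : Type u} [Field k] (X : FTScheme k) (n : ℕ) (E : Set (power X n).left) :
    K0Var k :=
  Classical.epsilon (IsImageClass X n E)

/-! ### Symmetric powers and configuration spaces -/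

/-- The class of the symmetric power, `[Symⁿ X]`. -/
def symClass {k : Type u} [Field k] (X : FTScheme k) (n : ℕ) : K0Var k :=
  imageClass X n Set.univ

/-- The `i`-th and the `j`-th coordinate of the point `x` of `Xⁿ` are the same geometric point
of `X`. -/
def SameCoord {k : Type u} [Field k] (X : FTScheme k) (n : ℕ) (x : (power X n).left)
    (i j : Fin n) : Prop :=
  (power X n).left.fromSpecResidueField x ≫ (coord X n i).left =
    (power X n).left.fromSpecResidueField x ≫ (coord X n j).left

open Classical in
/-- The multiset of the multiplicities with which geometric points of `X` occur among the `n`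
coordinates of the point `x` of `Xⁿ`: the sizes of the classes of `SameCoord`. -/
def multiplicities {k : Type u} [Field k] (X : FTScheme k) (n : ℕ) (x : (power X n).left) :
    Multiset ℕ :=
  (Finset.univ.image fun i : Fin n =>
    Finset.univ.filter fun j : Fin n => SameCoord X n x i j).val.map Finset.card

/-- The preimage in `Xⁿ`, `n = ∑ lam`, of the locus `w_lam(X)` in `Symⁿ X` of points
occurring with multiplicities precisely `lam`. -/
def confLocus {k : Type u} [Field k] (X : FTScheme k) (lam : Multiset ℕ) :
    Set (power X lam.sum).left :=
  {x | multiplicities X lam.sum x = lam}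

/-- The class `[w_lam(X)]`, for a partition given by the multiset `lam` of its parts. -/
def wClass {k : Type u} [Field k] (X : FTScheme k) (lam : Multiset ℕ) : K0Var k :=
  imageClass X lam.sum (confLocus X lam)

/-- `mu` is obtained from `lam` by replacing two parts by their sum. -/
def ElementaryMerge (lam mu : Multiset ℕ) : Prop :=
  ∃ (x y : ℕ) (s : Multiset ℕ), lam = x ::ₘ y ::ₘ s ∧ mu = (x + y) ::ₘ s

/-- The refinement ordering `lam ≤ mu` on partitions, generated by elementary merges. -/
def Refines (lam mu : Multiset ℕ) : Prop :=
  Relation.ReflTransGen ElementaryMerge lam mu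

open Classical in
/-- `[w̄_lam(X)] = ∑_{lam ≤ mu} [w_mu(X)]`. -/
def wbarClass {k : Type u} [Field k] (X : FTScheme k) (lam : Multiset ℕ) : K0Var k :=
  ∑ mu : Nat.Partition lam.sum with Refines lam mu.parts, wClass X mu.parts

/-- The sum of the classes `[w_{mu nu}(X)]` over the partitions `mu` of `j` with all parts
less than `a`. -/
def wLtClass {k : Type u} [Field k] (X : FTScheme k) (a j : ℕ) (nu : Multiset ℕ) : K0Var k :=
  ∑ mu : Nat.Partition j with ∀ i ∈ mu.parts, i < a, wClass X (mu.parts + nu)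

/-! ### Generating series -/

/-- The motivic zeta function `Z_X(t) = ∑ [Symⁿ X] tⁿ`. -/
def zetaSeries {k : Type u} [Field k] (X : FTScheme k) : (K0Var k)⟦X⟧ :=
  PowerSeries.mk fun n => symClass X n

/-- `K_{1^• nu}(t) = ∑_j [w_{1^j nu}(X)] t^j`. -/
def KOne {k : Type u} [Field k] (X : FTScheme k) (nu : Multiset ℕ) : (K0Var k)⟦X⟧ :=
  PowerSeries.mk fun j => wClass X (Multiset.replicate j 1 + nu)

/-- `K̄_{1^• nu}(t) = ∑_j [w̄_{1^j nu}(X)] t^j`. -/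
def KOneBar {k : Type u} [Field k] (X : FTScheme k) (nu : Multiset ℕ) : (K0Var k)⟦X⟧ :=
  PowerSeries.mk fun j => wbarClass X (Multiset.replicate j 1 + nu)

/-- `K_{(<a) nu}(t) = ∑_j [w_{(<a ⊢ j) nu}(X)] t^j`. -/
def KLt {k : Type u} [Field k] (X : FTScheme k) (a : ℕ) (nu : Multiset ℕ) : (K0Var k)⟦X⟧ :=
  PowerSeries.mk fun j => wLtClass X a j nu

end MotivicConf

end

/-!
The measure `φ` sees a scheme only through its geometric points.  If `f : Y ⟶ Z` is surjective and
universally injective, then `φ [Y] = φ [Z]` (`map_cls_eq`): over a dense open subset of `Z` the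
reduced schemes are affine and integral with purely inseparable function field extension, so `f`
is an isomorphism there in characteristic zero and a finite universal homeomorphism in general,
and Noetherian induction takes care of the rest.  If two surjections `T ⟶ Q` and `T ⟶ Q'`
only have the same geometric fibres, the image of `T` in `Q × Q'` is constructible by Chevalley's
theorem, and a stratification of it projects to `Q` and `Q'` by bijections on geometric points,
so again `φ [Q] = φ [Q']` (`map_cls_eq_of_forall_iff`).

Consequently `φ [Q]` depends only on the functor of effective zero-cycles on `X` which the geometric
points of `Q` parametrise.  This is made precise by `CycleQuotient`; the uniqueness statement is
`CycleQuotient.map_cls_eq`.  A stratified quotient of a stable subset `E` of `Xⁿ` parametrises the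
cycles `x₁ + ⋯ + xₙ`, for `(x₁, …, xₙ)` a geometric point of `E`, whatever the stratification
(`StratifiedQuotient.nonempty_cycleQuotient`), so that its class has a well-defined measure.

Stratified quotients exist when `E` is constructible and `X` is separated: a stable closed subset of
`Xⁿ` has a dense open stable subset which meets `E` in an affine scheme (a finite intersection of
affine open subschemes of a separated scheme is affine), and the quotient of an affine scheme of
finite type by a finite group is the spectrum of the ring of invariants
(`isGeomQuotient_of_isAffine`).  The locus of tuples with given multiplicities is constructible,
as the coincidence of two coordinates is a closed condition.

In terms of cycles, the formulas are elementary.  Division with remainder by `a` of all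
multiplicities writes a cycle uniquely as `M + a N`, where all multiplicities in `M` are less
than `a`.  Hence `K_{(<a)}(t) Z_X(tᵃ) = Z_X(t)` (`map_symClass_eq_sum`).  The partitions `μ ≥ 1ʲ a`
are exactly those with a part at least `a` (`refines_replicate_one_iff`), so that
`tᵃ K̄_{1^•(a)}(t) = Z_X(t) - K_{(<a)}(t)` (`map_wbarClass_eq`).
-/

noncomputable section

namespace MotivicConf

/-! ### Finite type schemes and their classes -/

section Classes

variable {k : Type u} [Field k]

instance (X : FTScheme k) : LocallyOfFiniteType X.obj.hom := X.locallyOfFiniteType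

instance (X : FTScheme k) : QuasiCompact X.obj.hom := X.quasiCompact

instance (X : FTScheme k) : IsNoetherian X.obj.left where
  toIsLocallyNoetherian := LocallyOfFiniteType.isLocallyNoetherian X.obj.hom
  toCompactSpace := QuasiCompact.compactSpace_of_compactSpace X.obj.hom

instance (X Y : FTScheme k) (f : X.obj ⟶ Y.obj) : LocallyOfFiniteType f.left := by
  have : LocallyOfFiniteType (f.left ≫ Y.obj.hom) := by rw [Over.w f]; infer_instance
  exact locallyOfFiniteType_of_comp f.left Y.obj.hom

/-- The finite type `k`-scheme defined by a morphism of finite type to a finite type `k`-scheme. -/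
def FTScheme.over (X : FTScheme k) {Y : Scheme.{u}} (g : Y ⟶ X.obj.left)
    [LocallyOfFiniteType g] [QuasiCompact g] : FTScheme k where
  obj := Over.mk (g ≫ X.obj.hom)
  locallyOfFiniteType := by dsimp; infer_instance
  quasiCompact := by dsimp; infer_instance

/-- The morphism `g`, as a morphism over `k`. -/
def FTScheme.overHom (X : FTScheme k) {Y : Scheme.{u}} (g : Y ⟶ X.obj.left)
    [LocallyOfFiniteType g] [QuasiCompact g] : (X.over g).obj ⟶ X.obj :=
  Over.homMk g rfl

@[simp]
lemma FTScheme.over_left (X : FTScheme k) {Y : Scheme.{u}} (g : Y ⟶ X.obj.left)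
    [LocallyOfFiniteType g] [QuasiCompact g] : (X.over g).obj.left = Y := rfl

lemma cls_iso (X Y : FTScheme k) (e : X.obj ≅ Y.obj) : cls X = cls Y :=
  RingQuot.mkRingHom_rel (K0Rel.iso X Y e)

lemma cls_cut (X Y U : FTScheme k) (i : Y.obj ⟶ X.obj) (j : U.obj ⟶ X.obj)
    [hi : IsClosedImmersion i.left] [hj : IsOpenImmersion j.left]
    (hc : Set.range j.left = (Set.range i.left)ᶜ) : cls X = cls U + cls Y :=
  (RingQuot.mkRingHom_rel (K0Rel.cut X Y U i j hi hj hc)).trans (map_add _ _ _)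

lemma cls_prod (X Y P : FTScheme k) (p : P.obj ⟶ X.obj) (q : P.obj ⟶ Y.obj)
    (hP : IsPullback p.left q.left X.obj.hom Y.obj.hom) : cls P = cls X * cls Y :=
  (RingQuot.mkRingHom_rel (K0Rel.prod X Y P p q hP)).trans (map_mul _ _ _)

lemma cls_point (P : FTScheme k) [IsIso P.obj.hom] : cls P = 1 :=
  (RingQuot.mkRingHom_rel (K0Rel.point P ‹_›)).trans (map_one _)

lemma cls_of_isEmpty (X : FTScheme k) [IsEmpty X.obj.left] : cls X = 0 := by
  have h := cls_cut X X X (𝟙 _) (𝟙 _) (Subsingleton.elim _ _)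
  simpa using h

/-- A surjective closed immersion, for instance that of the underlying reduced subscheme,
does not change the class. -/
lemma cls_eq_of_isClosedImmersion {X Y : FTScheme k} (i : Y.obj ⟶ X.obj)
    [IsClosedImmersion i.left] [Surjective i.left] : cls X = cls Y := by
  let e : (∅ : Scheme.{u}) ⟶ X.obj.left := Scheme.emptyTo _
  have : IsOpenImmersion (X.overHom e).left := inferInstanceAs (IsOpenImmersion e)
  have h := cls_cut X Y (X.over e) i (X.overHom e) (by
    rw [i.left.surjective.range_eq, Set.compl_univ, Set.range_eq_empty_iff]
    dsimp; infer_instance)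
  have : IsEmpty (X.over e).obj.left := by dsimp; infer_instance
  rw [h, cls_of_isEmpty (X.over e), zero_add]

/-- Open subschemes with the same underlying set have the same class. -/
lemma cls_eq_of_range_eq {X U V : FTScheme k} (i : U.obj ⟶ X.obj) (j : V.obj ⟶ X.obj)
    [IsOpenImmersion i.left] [IsOpenImmersion j.left]
    (h : Set.range i.left = Set.range j.left) : cls U = cls V := by
  refine cls_iso _ _ (Over.isoMk (IsOpenImmersion.isoOfRangeEq i.left j.left h) ?_)
  rw [← Over.w j, ← Category.assoc, IsOpenImmersion.isoOfRangeEq_hom_fac, Over.w i]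

end Classes

/-! ### Reduced subschemes and lifts of geometric points -/

section Lifts

/-- The closed subscheme of `X` with the reduced structure on the closed set `Z`. -/
abbrev redSub (X : Scheme.{u}) (Z : TopologicalSpace.Closeds X) : Scheme.{u} :=
  (Scheme.IdealSheafData.vanishingIdeal Z).subscheme

/-- The inclusion of the reduced closed subscheme on `Z`. -/
abbrev redSubι (X : Scheme.{u}) (Z : TopologicalSpace.Closeds X) : redSub X Z ⟶ X :=
  (Scheme.IdealSheafData.vanishingIdeal Z).subschemeι

lemma support_vanishingIdeal (X : Scheme.{u}) (Z : TopologicalSpace.Closeds X) :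
    (Scheme.IdealSheafData.vanishingIdeal Z).support = Z := rfl

lemma range_redSubι (X : Scheme.{u}) (Z : TopologicalSpace.Closeds X) :
    Set.range (redSubι X Z) = Z := by
  rw [Scheme.IdealSheafData.range_subschemeι, support_vanishingIdeal]

instance (X : Scheme.{u}) (Z : TopologicalSpace.Closeds X) : IsReduced (redSub X Z) := by
  let 𝒰 := (Scheme.IdealSheafData.subschemeCover
    (Scheme.IdealSheafData.vanishingIdeal Z)).openCover
  have (U : 𝒰.I₀) : IsReduced (𝒰.X U) := by
    have : _root_.IsReduced (Γ(X, U.1) ⧸ (Scheme.IdealSheafData.vanishingIdeal Z).ideal U) := by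
      rw [← Ideal.isRadical_iff_quotient_reduced]
      exact PrimeSpectrum.isRadical_vanishingIdeal _
    exact inferInstanceAs (IsReduced (Spec (.of _)))
  exact IsReduced.of_openCover _ 𝒰

/-- A morphism from a reduced scheme whose image lies in that of an immersion factors through
the immersion. -/
lemma exists_lift_of_isImmersion {T S X : Scheme.{u}} [IsReduced T] (g : T ⟶ X) (i : S ⟶ X)
    [IsImmersion i] (h : Set.range g ⊆ Set.range i) : ∃ l : T ⟶ S, l ≫ i = g := by
  have hs : Function.Surjective (pullback.fst g i) := by
    rw [← Set.range_eq_univ, Scheme.Pullback.range_fst]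
    exact Set.eq_univ_of_forall fun t => h ⟨t, rfl⟩
  have : Surjective (pullback.fst g i) := ⟨hs⟩
  have : IsClosedImmersion (pullback.fst g i) := .of_isPreimmersion _ (by
    rw [Set.range_eq_univ.mpr hs]; exact isClosed_univ)
  have := isIso_of_isClosedImmersion_of_surjective (pullback.fst g i)
  exact ⟨inv (pullback.fst g i) ≫ pullback.snd g i, by
    rw [Category.assoc, ← pullback.condition, IsIso.inv_hom_id_assoc]⟩

/-- Nullstellensatz: a geometric point of `S` in the image of a morphism locally of finite type
lifts. -/
lemma exists_lift_of_mem_range {K : Type u} [Field K] [IsAlgClosed K] {T S : Scheme.{u}}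
    (f : T ⟶ S) [LocallyOfFiniteType f] (x : Spec (.of K) ⟶ S)
    (h : x (IsLocalRing.closedPoint K) ∈ Set.range f) : ∃ y : Spec (.of K) ⟶ T, y ≫ f = x := by
  obtain ⟨t, ht⟩ := h
  obtain ⟨z, -⟩ := Scheme.Pullback.exists_preimage_pullback (f := f) (g := x) t _ ht
  have : JacobsonSpace (pullback f x : Scheme.{u}) :=
    LocallyOfFiniteType.jacobsonSpace (pullback.snd f x)
  obtain ⟨c, -, hc⟩ : ((Set.univ : Set (pullback f x : Scheme.{u})) ∩ closedPoints _).Nonempty := by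
    rw [← closure_nonempty_iff, JacobsonSpace.closure_inter_closedPoints_eq_closure
      isOpen_univ.isLocallyClosed, closure_nonempty_iff]
    exact ⟨z, trivial⟩
  have hc' : IsClosed {c} := hc
  refine ⟨pointOfClosedPoint (pullback.snd f x) c hc' ≫ pullback.fst f x, ?_⟩
  rw [Category.assoc, pullback.condition, ← Category.assoc, pointOfClosedPoint_comp,
    Category.id_comp]

lemma epi_SpecMap_of_field {K L : Type u} [Field K] [Field L] (f : K →+* L) :
    Epi (Spec.map (CommRingCat.ofHom f)) := by
  let _ := f.toAlgebra
  obtain ⟨_, _⟩ := (flat_and_surjective_SpecMap_iff (CommRingCat.ofHom f)).mpr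
    (show (algebraMap K L).FaithfullyFlat by
      rw [RingHom.faithfullyFlat_algebraMap_iff]; infer_instance)
  exact Flat.epi_of_flat_of_surjective _

/-- Universal injectivity may be tested on geometric points. -/
lemma universallyInjective_of_isAlgClosed {X Y : Scheme.{u}} (f : X ⟶ Y)
    (h : ∀ (K : Type u) [Field K] [IsAlgClosed K] (g₁ g₂ : Spec (.of K) ⟶ X),
      g₁ ≫ f = g₂ ≫ f → g₁ = g₂) : UniversallyInjective f := by
  have H : ∀ (K : Type u) [Field K],
      Function.Injective (fun g : Spec (.of K) ⟶ X ↦ g ≫ f) := by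
    intro K _ g₁ g₂ e
    have := epi_SpecMap_of_field (algebraMap K (AlgebraicClosure K))
    rw [← cancel_epi (Spec.map (CommRingCat.ofHom (algebraMap K (AlgebraicClosure K))))]
    refine h _ _ _ ?_
    rw [Category.assoc, Category.assoc]
    exact congr(_ ≫ $e)
  exact ((tfae_universallyInjective f).out 0 1).mpr H

lemma point_injective {X Y : Scheme.{u}} (f : X ⟶ Y) [hf : UniversallyInjective f] {K : Type u}
    [Field K] {g₁ g₂ : Spec (.of K) ⟶ X} (e : g₁ ≫ f = g₂ ≫ f) : g₁ = g₂ := by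
  have H : ∀ (K : Type u) [Field K],
      Function.Injective (fun g : Spec (.of K) ⟶ X ↦ g ≫ f) :=
    ((tfae_universallyInjective f).out 0 1).mp hf
  exact H K e

end Lifts

/-! ### Spreading out purely inseparable extensions -/

section SpreadingOut

variable {A B : Type u} [CommRing A] [CommRing B] [IsDomain A] [IsDomain B] [Algebra A B]

/-- If geometric points of `Spec B` are determined by their images in `Spec A`, the extension of
fraction fields is purely inseparable: a power of each element of `B` becomes, up to
a denominator, an element of `A`. -/
lemma exists_pow_expChar_mem [FaithfulSMul A B]
    (h : ∀ (K : Type u) [Field K] (g₁ g₂ : B →+* K),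
      g₁.comp (algebraMap A B) = g₂.comp (algebraMap A B) → g₁ = g₂) (b : B) :
    ∃ s : A, s ≠ 0 ∧ ∃ (n : ℕ) (a : A),
      algebraMap A B s * b ^ (ringExpChar A) ^ n = algebraMap A B a := by
  let F := FractionRing A
  let L := FractionRing B
  have hAL : Function.Injective (algebraMap A L) := by
    rw [IsScalarTower.algebraMap_eq A B L]
    exact (IsFractionRing.injective B L).comp (FaithfulSMul.algebraMap_injective A B)
  let _ : Algebra F L := (IsFractionRing.lift hAL).toAlgebra
  have : IsScalarTower A F L := IsScalarTower.of_algebraMap_eq fun x =>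
    (IsFractionRing.lift_algebraMap hAL x).symm
  have : IsPurelyInseparable F L := by
    rw [isPurelyInseparable_iff_subsingleton_emb, subsingleton_iff]
    intro σ τ
    have e := h (AlgebraicClosure L) ((σ : L →+* AlgebraicClosure L).comp (algebraMap B L))
      ((τ : L →+* AlgebraicClosure L).comp (algebraMap B L)) (by
        ext x
        simp only [RingHom.comp_apply, ← IsScalarTower.algebraMap_apply A B L]
        rw [IsScalarTower.algebraMap_apply A F L]
        simp)
    have := IsLocalization.ringHom_ext (nonZeroDivisors B) e
    exact AlgHom.coe_ringHom_injective this
  have hq : ringExpChar A = ringExpChar F := by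
    have : ExpChar F (ringExpChar A) :=
      expChar_of_injective_algebraMap (IsFractionRing.injective A F) _
    exact (ringExpChar.eq F (ringExpChar A)).symm
  obtain ⟨n, c, hc⟩ := IsPurelyInseparable.pow_mem F (ringExpChar F) (algebraMap B L b)
  obtain ⟨a, s, rfl⟩ := IsLocalization.exists_mk'_eq (nonZeroDivisors A) c
  refine ⟨s, nonZeroDivisors.ne_zero s.2, n, a, IsFractionRing.injective B L ?_⟩
  rw [hq, map_mul, map_pow, ← hc, ← IsScalarTower.algebraMap_apply A B L,
    ← IsScalarTower.algebraMap_apply A B L, IsScalarTower.algebraMap_apply A F L,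
    IsScalarTower.algebraMap_apply A F L, ← map_mul, IsLocalization.mk'_spec']

omit [IsDomain B] in
/-- If `r` is a common denominator for the powers of the generators `S` of `B`, then `B` becomes
finite over `A`, and a quotient of `A` in characteristic zero, after inverting `r`. -/
lemma finite_of_isLocalization_away {A' B' : Type u} [CommRing A'] [CommRing B']
    [Algebra A A'] [Algebra B B'] [Algebra A' B'] [Algebra A B'] [IsScalarTower A A' B']
    [IsScalarTower A B B'] {S : Finset B} (hS : Algebra.adjoin A (S : Set B) = ⊤)
    {s a : B → A} {n : B → ℕ}
    (hsa : ∀ b, algebraMap A B (s b) * b ^ (ringExpChar A) ^ n b = algebraMap A B (a b)) {r : A}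
    (hr : ∀ b ∈ S, s b ∣ r) [IsLocalization.Away r A'] [IsLocalization.Away (algebraMap A B r) B'] :
    (algebraMap A' B').Finite ∧ (CharZero A → Function.Surjective (algebraMap A' B')) := by
  have key : ∀ b ∈ S, ∃ c : A', algebraMap B B' b ^ ringExpChar A ^ n b = algebraMap A' B' c := by
    intro b hb
    have hu : IsUnit (algebraMap A A' (s b)) :=
      isUnit_of_dvd_unit (map_dvd _ (hr b hb))
        (IsLocalization.Away.algebraMap_isUnit r)
    obtain ⟨u, hu⟩ := hu
    refine ⟨↑u⁻¹ * algebraMap A A' (a b), ?_⟩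
    have e := congrArg (algebraMap B B') (hsa b)
    rw [map_mul, map_pow, ← IsScalarTower.algebraMap_apply A B B',
      ← IsScalarTower.algebraMap_apply A B B', IsScalarTower.algebraMap_apply A A' B',
      IsScalarTower.algebraMap_apply A A' B', ← hu] at e
    rw [map_mul, ← e, ← mul_assoc, ← map_mul, Units.inv_mul, map_one, one_mul]
  have htop : ∀ C : Subalgebra A' B', (∀ b ∈ S, algebraMap B B' b ∈ C) → C = ⊤ := by
    intro C hC
    have hB : ∀ b : B, algebraMap B B' b ∈ C := by
      intro b
      have hb : b ∈ Algebra.adjoin A (S : Set B) := hS ▸ Algebra.mem_top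
      induction hb using Algebra.adjoin_induction with
      | mem x hx => exact hC x hx
      | algebraMap x =>
        rw [← IsScalarTower.algebraMap_apply A B B', IsScalarTower.algebraMap_apply A A' B']
        exact C.algebraMap_mem _
      | add x y _ _ hx hy => rw [map_add]; exact add_mem hx hy
      | mul x y _ _ hx hy => rw [map_mul]; exact mul_mem hx hy
    refine eq_top_iff.mpr fun x _ => ?_
    obtain ⟨m, b, e⟩ := IsLocalization.Away.surj (algebraMap A B r) x
    have hinv : algebraMap A' B' (IsLocalization.Away.invSelf r) *
        (algebraMap B B' (algebraMap A B r)) = 1 := by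
      rw [← IsScalarTower.algebraMap_apply A B B', IsScalarTower.algebraMap_apply A A' B',
        ← map_mul, mul_comm, IsLocalization.Away.mul_invSelf, map_one]
    have : x = (algebraMap A' B' (IsLocalization.Away.invSelf r)) ^ m * (algebraMap B B' b) := by
      rw [← e, mul_left_comm, ← mul_pow, hinv, one_pow, mul_one]
    rw [this]
    exact mul_mem (pow_mem (C.algebraMap_mem _) m) (hB b)
  refine ⟨?_, ?_⟩
  · have hint : integralClosure A' B' = ⊤ := htop _ fun b hb => by
      obtain ⟨c, hc⟩ := key b hb
      refine IsIntegral.of_pow (n := ringExpChar A ^ n b)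
        (pow_pos (expChar_pos A (ringExpChar A)) _) ?_
      rw [hc]
      exact isIntegral_algebraMap
    have hft : Algebra.FiniteType A' B' := by
      classical
      refine ⟨⟨S.image (algebraMap B B'), ?_⟩⟩
      exact htop _ fun b hb => Algebra.subset_adjoin (by
        simpa using ⟨b, hb, rfl⟩)
    rw [RingHom.finite_iff_isIntegral_and_finiteType]
    exact ⟨fun x => (hint ▸ Algebra.mem_top : x ∈ integralClosure A' B'),
      (RingHom.finiteType_algebraMap).mpr hft⟩
  · intro h0
    -- in characteristic zero no powers are needed, and the generators themselves lie in `A'`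
    have hq : ringExpChar A = 1 := ringExpChar.eq A 1
    have : (⊥ : Subalgebra A' B') = ⊤ := htop _ fun b hb => by
      obtain ⟨c, hc⟩ := key b hb
      rw [hq, one_pow, pow_one] at hc
      rw [hc]
      exact Subalgebra.algebraMap_mem _ _
    exact Algebra.surjective_algebraMap_iff.mpr this.symm

/-- Spreading out: after inverting one element, an extension of finite type of domains that
is universally injective on spectra becomes finite, and an isomorphism in characteristic zero. -/
lemma exists_away_finite [Algebra.FiniteType A B] [FaithfulSMul A B]
    (h : ∀ (K : Type u) [Field K] (g₁ g₂ : B →+* K),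
      g₁.comp (algebraMap A B) = g₂.comp (algebraMap A B) → g₁ = g₂) {t : A} (ht : t ≠ 0) :
    ∃ r : A, r ≠ 0 ∧ t ∣ r ∧ (Localization.awayMap (algebraMap A B) r).Finite ∧
      (CharZero A → Function.Bijective (Localization.awayMap (algebraMap A B) r)) := by
  obtain ⟨S, hS⟩ := Algebra.FiniteType.out (R := A) (A := B)
  choose s hs n a hsa using exists_pow_expChar_mem h
  let r := t * ∏ b ∈ S, s b
  have hr : r ≠ 0 := mul_ne_zero ht (Finset.prod_ne_zero_iff.mpr fun b _ => hs b)
  have hrB : algebraMap A B r ≠ 0 := by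
    simpa using hr
  let A' := Localization.Away r
  let B' := Localization.Away (algebraMap A B r)
  let φ := Localization.awayMap (algebraMap A B) r
  let _ : Algebra A' B' := φ.toAlgebra
  have : IsScalarTower A A' B' := IsScalarTower.of_algebraMap_eq fun x => by
    rw [RingHom.algebraMap_toAlgebra]
    simp [φ, IsLocalization.Away.map, IsLocalization.map_eq, B',
      IsScalarTower.algebraMap_apply A B B']
  obtain ⟨h₁, h₂⟩ := finite_of_isLocalization_away (A' := A') (B' := B') hS hsa (r := r)
    fun b hb => (Finset.dvd_prod_of_mem s hb).mul_left t
  refine ⟨r, hr, dvd_mul_right _ _, h₁, fun h0 => ⟨?_, h₂ h0⟩⟩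
  refine IsLocalization.map_injective_of_injective' (f := algebraMap A B) (.powers r) B B'
    (N := .powers (algebraMap A B r)) _ ?_ (FaithfulSMul.algebraMap_injective A B)
  rintro ⟨m, hm⟩
  exact pow_ne_zero m hrB hm

end SpreadingOut

/-! ### Generic behaviour of universally injective surjections -/

/-- Finite, universally injective and surjective morphisms are closed, injective and surjective
after every base change. -/
lemma isUnivHomeo_of_isFinite {X Y : Scheme.{u}} (f : X ⟶ Y) [IsFinite f]
    [UniversallyInjective f] [Surjective f] : IsUnivHomeo f := by
  intro X₁ Y₁ g₁ f₁ g h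
  have h₁ : IsFinite f₁ := MorphismProperty.of_isPullback h ‹_›
  have h₂ : UniversallyInjective f₁ := MorphismProperty.of_isPullback h ‹_›
  have h₃ : Surjective f₁ := MorphismProperty.of_isPullback h ‹_›
  rw [isHomeomorph_iff_continuous_isClosedMap_bijective]
  exact ⟨f₁.continuous, f₁.isClosedMap, f₁.injective, f₁.surjective⟩

lemma charZero_section {k : Type u} [Field k] (Z : FTScheme k) [CharZero k] (U : Z.obj.left.Opens)
    [Nontrivial Γ(Z.obj.left, U)] : CharZero Γ(Z.obj.left, U) :=
  charZero_of_injective_ringHom (f := ((Scheme.ΓSpecIso (.of k)).inv ≫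
    Z.obj.hom.appLE ⊤ U le_top).hom) (RingHom.injective _)

/-- Surjectivity and universal injectivity are inherited by the restriction of a morphism to
a subscheme of the target and its preimage. -/
lemma restrict_bijective {V U Y Z : Scheme.{u}} (θ : V ⟶ U) (i : U ⟶ Z) (j : V ⟶ Y) (f : Y ⟶ Z)
    [IsPreimmersion i] [Mono j] [UniversallyInjective f] [Surjective f] (sq : θ ≫ i = j ≫ f)
    (h : Set.range j = f ⁻¹' Set.range i) : UniversallyInjective θ ∧ Surjective θ := by
  constructor
  · refine universallyInjective_of_isAlgClosed _ fun K _ _ g₁ g₂ e => ?_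
    rw [← cancel_mono j]
    apply point_injective f
    rw [Category.assoc, Category.assoc, ← sq]
    simpa using congr($e ≫ i)
  · refine ⟨fun u => ?_⟩
    obtain ⟨y, hy⟩ := f.surjective (i u)
    obtain ⟨v, rfl⟩ : y ∈ Set.range j := by
      rw [h, Set.mem_preimage, hy]; exact ⟨u, rfl⟩
    refine ⟨v, i.isEmbedding.injective ?_⟩
    rw [← hy, ← Scheme.Hom.comp_apply, ← Scheme.Hom.comp_apply, ← sq]

/-- Shrinking an affine open subset `U` of the target: if `f` maps the affine open subset `W`
dominantly to `U`, and `W` contains the preimage of some nonempty basic open subset of `U`,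
there is a nonempty open subset of the target with the same measure as its preimage. -/
lemma exists_open_eq_of_affine {k : Type u} [Field k] {R : Type v} [CommRing R]
    {φ : K0Var k →+* R} (hφ : CharZero k ∨ InvariantUnderUnivHomeo φ)
    {Y Z : FTScheme k} (f : Y.obj ⟶ Z.obj) [hf : UniversallyInjective f.left]
    [hs : Surjective f.left]
    {U : Z.obj.left.Opens} (hU : IsAffineOpen U) {W : Y.obj.left.Opens} (hW : IsAffineOpen W)
    (e : W ≤ f.left ⁻¹ᵁ U) [IsDomain Γ(Z.obj.left, U)] [IsDomain Γ(Y.obj.left, W)]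
    (hinj : Function.Injective (f.left.appLE U W e).hom)
    {t : Γ(Z.obj.left, U)} (ht : t ≠ 0) (hN : f.left ⁻¹ᵁ (Z.obj.left.basicOpen t) ≤ W) :
    ∃ (U' V' : FTScheme k) (j : U'.obj ⟶ Z.obj) (j' : V'.obj ⟶ Y.obj),
      IsOpenImmersion j.left ∧ IsOpenImmersion j'.left ∧ Nonempty U'.obj.left ∧
      Set.range j'.left = f.left ⁻¹' Set.range j.left ∧ φ (cls V') = φ (cls U') := by
  let A := Γ(Z.obj.left, U)
  let B := Γ(Y.obj.left, W)
  let ψ := f.left.appLE U W e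
  let _ : Algebra A B := ψ.hom.toAlgebra
  have hψ : algebraMap A B = ψ.hom := rfl
  have hsq : Spec.map ψ ≫ hU.fromSpec = hW.fromSpec ≫ f.left :=
    IsAffineOpen.SpecMap_appLE_fromSpec f.left hU hW e
  have : FaithfulSMul A B := (faithfulSMul_iff_algebraMap_injective A B).mpr hinj
  have : Algebra.FiniteType A B := f.left.finiteType_appLE hU hW e
  obtain ⟨r, hr, htr, hfin, hbij⟩ := exists_away_finite (A := A) (B := B) (fun K _ g₁ g₂ h => by
    have h' : Spec.map (CommRingCat.ofHom g₁) = Spec.map (CommRingCat.ofHom g₂) := by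
      rw [← cancel_mono hW.fromSpec]
      apply point_injective f.left
      rw [Category.assoc, Category.assoc, ← hsq, ← Spec.map_comp_assoc, ← Spec.map_comp_assoc]
      congr 2
      ext x
      exact congr($h x)
    exact congrArg CommRingCat.Hom.hom (Spec.map_injective h')) ht
  let A' := Localization.Away r
  let B' := Localization.Away (algebraMap A B r)
  let θ : CommRingCat.of A' ⟶ .of B' := CommRingCat.ofHom (Localization.awayMap (algebraMap A B) r)
  let a : A ⟶ CommRingCat.of A' := CommRingCat.ofHom (algebraMap A A')
  let b : B ⟶ CommRingCat.of B' := CommRingCat.ofHom (algebraMap B B')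
  have : IsOpenImmersion (Spec.map a) := Scheme.isOpenImmersion_SpecMap_localizationAway r
  have : IsOpenImmersion (Spec.map b) :=
    Scheme.isOpenImmersion_SpecMap_localizationAway (algebraMap A B r)
  have hab : a ≫ θ = ψ ≫ b := by
    ext x
    simp [a, b, θ, IsLocalization.Away.map, B', hψ]
  let jA : Spec (.of A') ⟶ Z.obj.left := Spec.map a ≫ hU.fromSpec
  let jB : Spec (.of B') ⟶ Y.obj.left := Spec.map b ≫ hW.fromSpec
  have hsq2 : Spec.map θ ≫ jA = jB ≫ f.left := by
    simp only [jA, jB, Category.assoc, ← hsq, ← Spec.map_comp_assoc, hab]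
  have hrA : Set.range jA = (Z.obj.left.basicOpen r : Set Z.obj.left) := by
    rw [← hU.fromSpec_image_basicOpen]
    have := PrimeSpectrum.localization_away_comap_range A' r
    simp only [jA, Scheme.Hom.comp_base, TopCat.hom_comp, ContinuousMap.coe_comp, Set.range_comp]
    exact congrArg _ this
  have hrB : Set.range jB = (Y.obj.left.basicOpen (ψ r) : Set Y.obj.left) := by
    rw [← hW.fromSpec_image_basicOpen]
    have := PrimeSpectrum.localization_away_comap_range B' (algebraMap A B r)
    simp only [jB, Scheme.Hom.comp_base, TopCat.hom_comp, ContinuousMap.coe_comp, Set.range_comp]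
    exact congrArg _ this
  have hrAB : Set.range jB = f.left ⁻¹' Set.range jA := by
    rw [hrA, hrB, Scheme.basicOpen_appLE]
    refine Set.inter_eq_right.mpr fun y hy => hN ?_
    obtain ⟨c, rfl⟩ := htr
    rw [Scheme.basicOpen_mul] at hy
    exact hy.1
  let U' := Z.over jA
  let V' := Y.over jB
  have hjA : IsOpenImmersion jA := inferInstance
  have hjB : IsOpenImmersion jB := inferInstance
  let h : V'.obj ⟶ U'.obj := Over.homMk (Spec.map θ) (by
    change Spec.map θ ≫ jA ≫ Z.obj.hom = jB ≫ Y.obj.hom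
    rw [← Over.w f, ← Category.assoc, hsq2, Category.assoc])
  refine ⟨U', V', Z.overHom jA, Y.overHom jB, hjA, hjB, ?_, hrAB, ?_⟩
  · have : Nontrivial A' := (IsLocalization.injective A'
      (powers_le_nonZeroDivisors_of_noZeroDivisors hr)).nontrivial
    exact inferInstanceAs (Nonempty (PrimeSpectrum A'))
  obtain ⟨hUI, hS⟩ : UniversallyInjective h.left ∧ Surjective h.left :=
    restrict_bijective (Spec.map θ) jA jB f.left hsq2 hrAB
  have hF : IsFinite h.left := (IsFinite.SpecMap_iff θ).mpr hfin
  rcases hφ with h0 | h0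
  · have : Nontrivial Γ(Z.obj.left, U) := inferInstance
    have hb := hbij (charZero_section Z U)
    have : IsIso θ := by
      rw [ConcreteCategory.isIso_iff_bijective]
      exact hb
    have : IsIso h.left := inferInstanceAs (IsIso (Spec.map θ))
    have : IsIso h := (isIso_iff_of_reflects_iso h (Over.forget _)).mp this
    rw [cls_iso V' U' (asIso h)]
  · exact h0 V' U' h (isUnivHomeo_of_isFinite h.left)

section Topology

open TopologicalSpace

variable {S : Type*} [TopologicalSpace S] [T0Space S] [QuasiSober S] [NoetherianSpace S]

omit [T0Space S] [NoetherianSpace S] in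
lemma closure_mem_irreducibleComponents {y : S} (hy : ∀ y', y' ⤳ y → y' = y) :
    closure {y} ∈ irreducibleComponents S := by
  refine ⟨isIrreducible_singleton.closure, fun t ht hyt => ?_⟩
  have hg := ht.isGenericPoint_genericPoint_closure
  have : ht.genericPoint = y :=
    hy _ (hg.specializes (subset_closure (hyt (subset_closure rfl))))
  rw [this] at hg
  exact subset_closure.trans hg.def.ge

omit [T0Space S] in
/-- A point without proper generizations has an open neighbourhood all of whose points are
specializations of it. -/
lemma exists_isOpen_subset_closure {y : S} (hy : ∀ y', y' ⤳ y → y' = y) :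
    ∃ o : Set S, IsOpen o ∧ y ∈ o ∧ o ⊆ closure {y} := by
  obtain ⟨o, ho, ⟨z, hz⟩, hoy⟩ :=
    NoetherianSpace.exists_isOpen_nonempty_subset_irreducibleComponent _
      (closure_mem_irreducibleComponents hy)
  exact ⟨o, ho, (specializes_iff_mem_closure.mpr (hoy hz)).mem_open ho hz, hoy⟩

/-- A nonempty Noetherian sober space has a point without proper generizations. -/
lemma exists_generic (S : Type*) [TopologicalSpace S] [T0Space S] [QuasiSober S]
    [NoetherianSpace S] [Nonempty S] :
    ∃ η : S, (∀ z, z ⤳ η → z = η) ∧ ∃ o : Set S, IsOpen o ∧ η ∈ o ∧ o ⊆ closure {η} := by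
  obtain ⟨x⟩ := ‹Nonempty S›
  have hC := irreducibleComponent_mem_irreducibleComponents x
  obtain ⟨o, ho, ⟨z, hz⟩, hoy⟩ :=
    NoetherianSpace.exists_isOpen_nonempty_subset_irreducibleComponent _ hC
  have h := isIrreducible_irreducibleComponent (x := x)
  have hη := h.closure_genericPoint isClosed_irreducibleComponent
  rw [← hη] at hoy
  have hηo := (specializes_iff_mem_closure.mpr (hoy hz)).mem_open ho hz
  refine ⟨h.genericPoint, fun z hz => ?_, o, ho, hηo, hoy⟩
  exact (hz.antisymm (specializes_iff_mem_closure.mpr (hoy (hz.mem_open ho hηo)))).eq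

omit [T0Space S] in
/-- A point `η` without proper generizations outside the image of a closed set `K` has an open
neighbourhood whose preimage avoids `K`: the generic points of the components of `K` do not map to generizations
of `η`. -/
lemma exists_isOpen_disjoint_image {T : Type*} [TopologicalSpace T] {f : S → T}
    (hf : Continuous f) {K : Set S} (hK : IsClosed K) {η : T} (hη : ∀ z, z ⤳ η → z = η)
    (h : η ∉ f '' K) : ∃ N : Set T, IsOpen N ∧ η ∈ N ∧ f ⁻¹' N ⊆ Kᶜ := by
  obtain ⟨F, hF, hFc, hFi, rfl⟩ := NoetherianSpace.exists_finite_set_isClosed_irreducible hK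
  refine ⟨⋂ t ∈ F, (closure (f '' t))ᶜ,
    hF.isOpen_biInter fun t _ => isClosed_closure.isOpen_compl, ?_, ?_⟩
  · simp only [Set.mem_iInter, Set.mem_compl_iff]
    intro t ht hηt
    have hg := (hFi t ht).isGenericPoint_genericPoint (hFc t ht)
    refine h ⟨_, ⟨t, ht, hg.mem⟩, hη _ ?_⟩
    rw [specializes_iff_mem_closure]
    have := (hg.image hf).def
    rwa [this]
  · rintro x hx ⟨t, ht, hxt⟩
    simp only [Set.mem_preimage, Set.mem_iInter] at hx
    exact hx t ht (subset_closure ⟨x, hxt, rfl⟩)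

end Topology

/-- Sections over an open set with a generic point form a domain, on a reduced scheme. -/
lemma isDomain_section {X : Scheme.{u}} [IsReduced X] {U : X.Opens} {η : X} (hη : η ∈ U)
    (h : (U : Set X) ⊆ closure {η}) : IsDomain Γ(X, U) := by
  have : Nonempty U := ⟨⟨η, hη⟩⟩
  have hirr : IsIrreducible (U : Set X) := by
    refine ⟨⟨η, hη⟩, ?_⟩
    rintro V W hV hW ⟨x, hxU, hxV⟩ ⟨y, hyU, hyW⟩
    exact ⟨η, hη, (specializes_iff_mem_closure.mpr (h hxU)).mem_open hV hxV,
      (specializes_iff_mem_closure.mpr (h hyU)).mem_open hW hyW⟩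
  have : IrreducibleSpace U :=
    isIrreducible_iff_irreducibleSpace.mp hirr
  have : IsIntegral U := isIntegral_of_irreducibleSpace_of_isReduced _
  exact U.topIso.commRingCatIsoToRingEquiv.symm.toMulEquiv.isDomain _

/-- Pullback of functions along a morphism which hits the generic point of `U` is injective. -/
lemma injective_appLE {X Y : Scheme.{u}} [IsReduced Y] (f : X ⟶ Y) {U : Y.Opens}
    {W : X.Opens} (e : W ≤ f ⁻¹ᵁ U) {y : X} (hy : y ∈ W)
    (h : (U : Set Y) ⊆ closure {f y}) : Function.Injective (f.appLE U W e).hom := by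
  rw [injective_iff_map_eq_zero]
  intro s hs
  apply AlgebraicGeometry.eq_zero_of_basicOpen_eq_bot
  by_contra hne
  obtain ⟨z, hz⟩ : (Y.basicOpen s : Set Y).Nonempty := by
    by_contra h0
    exact hne (SetLike.coe_injective (Set.not_nonempty_iff_eq_empty.mp h0))
  have hzU := Y.basicOpen_le s hz
  have : f y ∈ Y.basicOpen s :=
    (specializes_iff_mem_closure.mpr (h hzU)).mem_open (Y.basicOpen s).isOpen hz
  have hb := Scheme.basicOpen_appLE f W U e s
  have : y ∈ X.basicOpen (f.appLE U W e s) := by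
    rw [hb]; exact ⟨hy, this⟩
  have h0 : f.appLE U W e s = 0 := hs
  rw [h0, Scheme.basicOpen_zero] at this
  exact this

/-- A nonempty target of a universally injective surjection has a nonempty open subset with the same
measure as its preimage. -/
lemma exists_open_eq {k : Type u} [Field k] {R : Type v} [CommRing R] {φ : K0Var k →+* R}
    (hφ : CharZero k ∨ InvariantUnderUnivHomeo φ)
    {Y Z : FTScheme k} (f : Y.obj ⟶ Z.obj) [hf : UniversallyInjective f.left]
    [hs : Surjective f.left] [IsReduced Y.obj.left] [IsReduced Z.obj.left] [Nonempty Z.obj.left] :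
    ∃ (U' V' : FTScheme k) (j : U'.obj ⟶ Z.obj) (j' : V'.obj ⟶ Y.obj),
      IsOpenImmersion j.left ∧ IsOpenImmersion j'.left ∧ Nonempty U'.obj.left ∧
      Set.range j'.left = f.left ⁻¹' Set.range j.left ∧ φ (cls V') = φ (cls U') := by
  obtain ⟨η, hη, o, ho, hηo, hoη⟩ := exists_generic Z.obj.left
  obtain ⟨y, hy⟩ := f.left.surjective η
  have hy' : ∀ y', y' ⤳ y → y' = y := fun y' h => f.left.injective <| by
    rw [hy]; exact hη _ (hy ▸ h.map f.left.continuous)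
  obtain ⟨p, hp, hyp, hpy⟩ := exists_isOpen_subset_closure hy'
  obtain ⟨_, ⟨U, hU, rfl⟩, hηU, hUo⟩ :=
    Z.obj.left.isBasis_affineOpens.exists_subset_of_mem_open hηo ho
  obtain ⟨_, ⟨W, hW, rfl⟩, hyW, hWp⟩ :=
    Y.obj.left.isBasis_affineOpens.exists_subset_of_mem_open (a := y)
      (show y ∈ p ∩ f.left ⁻¹ᵁ U from ⟨hyp, by change f.left y ∈ U; rw [hy]; exact hηU⟩)
      (hp.inter (f.left ⁻¹ᵁ U).isOpen)
  have e : W ≤ f.left ⁻¹ᵁ U := fun z hz => (hWp hz).2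
  obtain ⟨N, hN, hηN, hNW⟩ := exists_isOpen_disjoint_image f.left.continuous
    W.isOpen.isClosed_compl hη (by
      rintro ⟨z, hz, hzη⟩
      exact hz (by rwa [f.left.injective (hzη.trans hy.symm)]))
  obtain ⟨t, htN, hηt⟩ := hU.exists_basicOpen_le (V := ⟨N, hN⟩) ⟨η, hηN⟩ hηU
  have := isDomain_section hηU (hUo.trans hoη)
  have := isDomain_section hyW (fun z hz => hpy (hWp hz).1)
  refine exists_open_eq_of_affine hφ f hU hW e
    (injective_appLE f.left e hyW (by rw [hy]; exact hUo.trans hoη)) (t := t) ?_ ?_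
  · rintro rfl
    rw [Scheme.basicOpen_zero] at hηt
    exact hηt
  · intro z hz
    have := hNW (htN hz)
    rwa [compl_compl] at this

/-! ### Invariance under universally injective surjections -/

section UniversallyInjective

variable {k : Type u} [Field k] {R : Type v} [CommRing R] {φ : K0Var k →+* R}

/-- The restriction of a universally injective surjective morphism to the reduced closed
subschemes on a closed set and on its preimage. -/
lemma exists_restrict_closed {Y Z : FTScheme k} (f : Y.obj ⟶ Z.obj) [UniversallyInjective f.left]
    [Surjective f.left] (C : TopologicalSpace.Closeds Z.obj.left) :
    ∃ (Y₁ Z₁ : FTScheme k) (i : Z₁.obj ⟶ Z.obj) (j : Y₁.obj ⟶ Y.obj) (h : Y₁.obj ⟶ Z₁.obj),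
      IsClosedImmersion i.left ∧ IsClosedImmersion j.left ∧ Set.range i.left = C ∧
      Set.range j.left = f.left ⁻¹' C ∧ IsReduced Y₁.obj.left ∧ IsReduced Z₁.obj.left ∧
      UniversallyInjective h.left ∧ Surjective h.left := by
  let D : TopologicalSpace.Closeds Y.obj.left := C.preimage f.left.continuous
  let i := redSubι Z.obj.left C
  let j := redSubι Y.obj.left D
  have hi : Set.range i = C := range_redSubι _ _
  have hj : Set.range j = f.left ⁻¹' C := range_redSubι _ _
  obtain ⟨h, hh⟩ := exists_lift_of_isImmersion (j ≫ f.left) i (by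
    rintro _ ⟨x, rfl⟩
    rw [hi, Scheme.Hom.comp_apply]
    exact hj.le ⟨x, rfl⟩)
  obtain ⟨h₁, h₂⟩ := restrict_bijective h i j f.left hh (by rw [hi, hj])
  refine ⟨Y.over j, Z.over i, Z.overHom i, Y.overHom j, Over.homMk h ?_, inferInstanceAs
    (IsClosedImmersion i), inferInstanceAs (IsClosedImmersion j), hi, hj, inferInstanceAs
    (IsReduced (redSub _ _)), inferInstanceAs (IsReduced (redSub _ _)), h₁, h₂⟩
  change h ≫ i ≫ Z.obj.hom = j ≫ Y.obj.hom
  rw [← Over.w f, ← Category.assoc, hh, Category.assoc]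

/-- Noetherian induction over the closed subsets `C` of an ambient scheme `Z₀`, in which all the
targets `Z` are embedded. -/
lemma map_cls_eq_of_isReduced (hφ : CharZero k ∨ InvariantUnderUnivHomeo φ) (Z₀ : FTScheme k)
    (C : TopologicalSpace.Closeds Z₀.obj.left) :
    ∀ {Y Z : FTScheme k} (f : Y.obj ⟶ Z.obj) (i : Z.obj ⟶ Z₀.obj) [UniversallyInjective f.left]
      [Surjective f.left] [IsReduced Y.obj.left] [IsReduced Z.obj.left] [IsClosedImmersion i.left]
      (_ : Set.range i.left = C), φ (cls Y) = φ (cls Z) := by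
  induction C using WellFoundedLT.induction with
  | ind C ih =>
  intro Y Z f i _ _ _ _ _ hC
  rcases isEmpty_or_nonempty Z.obj.left with hZ | hZ
  · have : IsEmpty Y.obj.left := Function.isEmpty f.left
    rw [cls_of_isEmpty, cls_of_isEmpty]
  obtain ⟨U, V, j, j', hj, hj', hU, hr, he⟩ := exists_open_eq hφ f
  obtain ⟨Y₁, Z₁, a, b, h, ha, hb, har, hbr, _, _, _, _⟩ := exists_restrict_closed f
    ⟨(Set.range j.left)ᶜ, j.left.isOpenEmbedding.isOpen_range.isClosed_compl⟩
  rw [TopologicalSpace.Closeds.coe_mk] at har hbr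
  rw [cls_cut Z Z₁ U a j (by rw [har, compl_compl]),
    cls_cut Y Y₁ V b j' (by rw [hbr, hr, Set.preimage_compl, compl_compl]), map_add, map_add, he]
  congr 1
  have hcl : IsClosedImmersion (a ≫ i).left := inferInstanceAs (IsClosedImmersion (a.left ≫ i.left))
  refine ih ⟨Set.range (a ≫ i).left, (a ≫ i).left.isClosedEmbedding.isClosed_range⟩ ?_ h (a ≫ i) rfl
  have hrange : Set.range (a ≫ i).left = i.left '' (Set.range j.left)ᶜ := by
    rw [← har, ← Set.range_comp]; rfl
  rw [← SetLike.coe_ssubset_coe, TopologicalSpace.Closeds.coe_mk, hrange, ← hC,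
    show Set.range i.left = i.left '' Set.univ from Set.image_univ.symm]
  refine i.left.isClosedEmbedding.injective.image_strictMono (Set.ssubset_univ_iff.mpr ?_)
  intro h0
  obtain ⟨u⟩ := hU
  have : j.left u ∈ (Set.range j.left)ᶜ := h0 ▸ Set.mem_univ _
  exact this ⟨u, rfl⟩

/-- A motivic measure as in the theorem does not distinguish the source and the target of
a universally injective surjective morphism of finite type schemes. -/
theorem map_cls_eq (hφ : CharZero k ∨ InvariantUnderUnivHomeo φ) {Y Z : FTScheme k}
    (f : Y.obj ⟶ Z.obj) [UniversallyInjective f.left] [Surjective f.left] :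
    φ (cls Y) = φ (cls Z) := by
  obtain ⟨Y₁, Z₁, a, b, h, ha, hb, har, hbr, _, _, _, _⟩ := exists_restrict_closed f ⊤
  have : Surjective a.left := ⟨Set.range_eq_univ.mp har⟩
  have : Surjective b.left := ⟨Set.range_eq_univ.mp hbr⟩
  rw [cls_eq_of_isClosedImmersion a, cls_eq_of_isClosedImmersion b]
  exact map_cls_eq_of_isReduced hφ Z ⊤ h a har

end UniversallyInjective

/-! ### Finite disjoint unions -/

section Additivity

variable {k : Type u} [Field k] {ι : Type} [Fintype ι] (X : FTScheme k) (F : ι → FTScheme k)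
  (j : ∀ i, (F i).obj ⟶ X.obj) [∀ i, IsOpenImmersion (j i).left]

include j in
/-- Additivity for a partition into finitely many open subschemes. -/
lemma cls_eq_sum (hd : Pairwise fun i i' => Disjoint (Set.range (j i).left) (Set.range (j i').left))
    (hc : ⋃ i, Set.range (j i).left = Set.univ) : cls X = ∑ i, cls (F i) := by
  classical
  let V (s : Finset ι) : X.obj.left.Opens :=
    ⟨⋃ i ∈ s, Set.range (j i).left,
      isOpen_biUnion fun i _ => (j i).left.isOpenEmbedding.isOpen_range⟩
  have key : ∀ s : Finset ι, cls (X.over (V s).ι) = ∑ i ∈ s, cls (F i) := by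
    intro s
    induction s using Finset.induction_on with
    | empty =>
      have : IsEmpty (X.over (V ∅).ι).obj.left := by
        refine ⟨fun x => ?_⟩
        have h : (V ∅).ι x ∈ V ∅ := by
          rw [← SetLike.mem_coe, ← Scheme.Opens.range_ι]; exact ⟨x, rfl⟩
        rw [← SetLike.mem_coe, TopologicalSpace.Opens.coe_mk] at h
        simp at h
      rw [cls_of_isEmpty, Finset.sum_empty]
    | insert a s ha ih =>
      have hle : V s ≤ V (insert a s) := fun x hx => by
        obtain ⟨i, hi, hx⟩ := Set.mem_iUnion₂.mp hx
        exact Set.mem_iUnion₂.mpr ⟨i, Finset.mem_insert_of_mem hi, hx⟩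
      have hra : Set.range (j a).left ⊆ Set.range (V (insert a s)).ι := by
        rw [Scheme.Opens.range_ι]
        exact fun x hx => Set.mem_iUnion₂.mpr ⟨a, Finset.mem_insert_self _ _, hx⟩
      let l := IsOpenImmersion.lift (V (insert a s)).ι (j a).left hra
      have hl : l ≫ (V (insert a s)).ι = (j a).left := IsOpenImmersion.lift_fac _ _ _
      have hlo : IsOpenImmersion l := by
        have : IsOpenImmersion (l ≫ (V (insert a s)).ι) := hl ▸ inferInstance
        exact IsOpenImmersion.of_comp l (V (insert a s)).ι
      have hinj := (V (insert a s)).ι.isOpenEmbedding.injective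
      have hcompl : Set.range (X.obj.left.homOfLE hle) = (Set.range l)ᶜ := by
        apply hinj.image_injective
        rw [Set.image_compl_eq_range_sdiff_image hinj, ← Set.range_comp, ← Set.range_comp,
          ← TopCat.coe_comp, ← TopCat.coe_comp, ← Scheme.Hom.comp_base, ← Scheme.Hom.comp_base, hl,
          Scheme.homOfLE_ι, Scheme.Opens.range_ι, Scheme.Opens.range_ι]
        ext x
        have hx : x ∈ V s → x ∉ Set.range (j a).left := by
          intro hx hxa
          obtain ⟨i, hi, hxi⟩ := Set.mem_iUnion₂.mp hx
          exact Set.disjoint_left.mp (hd (show i ≠ a from fun h => ha (h ▸ hi))) hxi hxa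
        have hx' : x ∈ (V (insert a s) : Set X.obj.left) ↔ x ∈ Set.range (j a).left ∨ x ∈ V s := by
          simp only [V, TopologicalSpace.Opens.coe_mk, ← SetLike.mem_coe]
          simp
        rw [Set.mem_sdiff, hx', SetLike.mem_coe]
        tauto
      have hcl : IsClosedImmersion l := .of_isPreimmersion _ (by
        rw [← isOpen_compl_iff, ← hcompl]
        exact (X.obj.left.homOfLE hle).isOpenEmbedding.isOpen_range)
      let a' : (F a).obj ⟶ (X.over (V (insert a s)).ι).obj := Over.homMk l (by
        change l ≫ (V (insert a s)).ι ≫ X.obj.hom = _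
        rw [← Category.assoc, hl, Over.w])
      let b' : (X.over (V s).ι).obj ⟶ (X.over (V (insert a s)).ι).obj :=
        Over.homMk (X.obj.left.homOfLE hle) (by
          change _ ≫ (V (insert a s)).ι ≫ X.obj.hom = (V s).ι ≫ X.obj.hom
          rw [← Category.assoc, Scheme.homOfLE_ι])
      have : IsClosedImmersion a'.left := hcl
      have : IsOpenImmersion b'.left := inferInstanceAs (IsOpenImmersion (X.obj.left.homOfLE hle))
      rw [cls_cut _ (F a) (X.over (V s).ι) a' b' hcompl, ih, Finset.sum_insert ha, add_comm]
  have hu : IsOpenImmersion (X.overHom (V Finset.univ).ι).left :=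
    inferInstanceAs (IsOpenImmersion (V Finset.univ).ι)
  have hid : IsOpenImmersion (𝟙 X.obj : X.obj ⟶ X.obj).left :=
    inferInstanceAs (IsOpenImmersion (𝟙 X.obj.left))
  rw [← key Finset.univ]
  refine cls_eq_of_range_eq (𝟙 X.obj) (X.overHom (V Finset.univ).ι) ?_
  refine .trans ?_ (V Finset.univ).range_ι.symm
  simp [V, hc]

end Additivity

section Coproduct

variable {k : Type u} [Field k] {ι : Type} [Finite ι] (F : ι → FTScheme k)

/-- The disjoint union of finitely many finite type schemes. -/
def FTScheme.sum : FTScheme k where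
  obj := Over.mk (Sigma.desc fun i => (F i).obj.hom)
  locallyOfFiniteType :=
    have : IsZariskiLocalAtSource @LocallyOfFiniteType.{u} :=
      HasRingHomProperty.instIsZariskiLocalAtSource
    IsZariskiLocalAtSource.sigmaDesc (P := @LocallyOfFiniteType)
      fun i => (F i).locallyOfFiniteType
  quasiCompact := by
    have : CompactSpace (∐ fun i => (F i).obj.left : Scheme.{u}) := by
      have h : ⋃ i, Set.range (Sigma.ι (fun i => (F i).obj.left) i) = Set.univ :=
        (sigmaOpenCover fun i => (F i).obj.left).iUnion_range
      rw [← isCompact_univ_iff, ← h]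
      exact isCompact_iUnion fun i =>
        isCompact_range (Sigma.ι (fun i => (F i).obj.left) i).continuous
    exact (quasiCompact_iff_compactSpace _).mpr this

/-- The inclusion of a summand. -/
def FTScheme.sumι (i : ι) : (F i).obj ⟶ (FTScheme.sum F).obj :=
  Over.homMk (Sigma.ι (fun i => (F i).obj.left) i) (Sigma.ι_desc _ _)

instance (i : ι) : IsOpenImmersion (FTScheme.sumι F i).left :=
  inferInstanceAs (IsOpenImmersion (Sigma.ι (fun i => (F i).obj.left) i))

/-- The morphism out of a disjoint union given by its restrictions to the summands. -/
def FTScheme.sumDesc {Y : Over (Spec (.of k))} (f : ∀ i, (F i).obj ⟶ Y) :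
    (FTScheme.sum F).obj ⟶ Y :=
  Over.homMk (Sigma.desc fun i => (f i).left) (by
    apply Sigma.hom_ext
    intro i
    simp [FTScheme.sum])

@[simp]
lemma FTScheme.sumι_sumDesc {Y : Over (Spec (.of k))} (f : ∀ i, (F i).obj ⟶ Y) (i : ι) :
    FTScheme.sumι F i ≫ FTScheme.sumDesc F f = f i := by
  ext1
  exact Sigma.ι_desc _ _

lemma disjoint_range_sumι {i j : ι} (h : i ≠ j) :
    Disjoint (Set.range (FTScheme.sumι F i).left) (Set.range (FTScheme.sumι F j).left) := by
  rw [Set.disjoint_left]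
  rintro _ ⟨x, rfl⟩ ⟨y, hy⟩
  exact h (congrArg Sigma.fst ((sigmaι_eq_iff (fun i => (F i).obj.left) _ _ _ _).mp hy)).symm

lemma iUnion_range_sumι : ⋃ i, Set.range (FTScheme.sumι F i).left = Set.univ :=
  (sigmaOpenCover fun i => (F i).obj.left).iUnion_range

lemma cls_sum {ι : Type} [Fintype ι] (F : ι → FTScheme k) :
    cls (FTScheme.sum F) = ∑ i, cls (F i) :=
  cls_eq_sum _ F (FTScheme.sumι F) (fun _ _ h => disjoint_range_sumι F h) (iUnion_range_sumι F)

end Coproduct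

/-! ### Constructible sets and geometric fibres -/

section Constructible

open Topology TopologicalSpace

/-- A constructible set either contains a nonempty open subset of a given nonempty open set or
is disjoint from one. -/
lemma exists_isOpen_subset_or_disjoint {S : Type*} [TopologicalSpace S] {C : Set S}
    (hC : IsConstructible C) : ∀ V : Set S, IsOpen V → V.Nonempty →
      ∃ V', IsOpen V' ∧ V'.Nonempty ∧ V' ⊆ V ∧ (V' ⊆ C ∨ Disjoint V' C) := by
  induction hC using IsConstructible.empty_union_induction with
  | open_retrocompact U hU _ =>
    intro V hV hne
    by_cases h : (V ∩ U).Nonempty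
    · exact ⟨V ∩ U, hV.inter hU, h, Set.inter_subset_left, .inl Set.inter_subset_right⟩
    · exact ⟨V, hV, hne, subset_rfl, .inr (Set.disjoint_iff_inter_eq_empty.mpr
        (Set.not_nonempty_iff_eq_empty.mp h))⟩
  | union s _ t _ hs ht =>
    intro V hV hne
    obtain ⟨V₁, h₁, h₁', h₁V, h | h⟩ := hs V hV hne
    · exact ⟨V₁, h₁, h₁', h₁V, .inl (h.trans Set.subset_union_left)⟩
    obtain ⟨V₂, h₂, h₂', h₂V, h' | h'⟩ := ht V₁ h₁ h₁'
    · exact ⟨V₂, h₂, h₂', h₂V.trans h₁V, .inl (h'.trans Set.subset_union_right)⟩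
    · exact ⟨V₂, h₂, h₂', h₂V.trans h₁V, .inr ((h.mono_left h₂V).union_right h')⟩
  | compl s _ hs =>
    intro V hV hne
    obtain ⟨V₁, h₁, h₁', h₁V, h | h⟩ := hs V hV hne
    · exact ⟨V₁, h₁, h₁', h₁V, .inr (Set.disjoint_compl_right_iff_subset.mpr h)⟩
    · exact ⟨V₁, h₁, h₁', h₁V, .inl (Set.subset_compl_iff_disjoint_right.mpr h)⟩

lemma isConstructible_of_isClosed {S : Type*} [TopologicalSpace S] [NoetherianSpace S] {Z : Set S}
    (hZ : IsClosed Z) : IsConstructible Z :=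
  isConstructible_compl.mp <| (show IsRetrocompact Zᶜ from fun _ _ _ =>
    NoetherianSpace.isCompact _).isConstructible hZ.isOpen_compl

lemma isConstructible_preimage {S T : Type*} [TopologicalSpace S] [NoetherianSpace S]
    [TopologicalSpace T] {f : S → T} (hf : Continuous f) {C : Set T} (hC : IsConstructible C) :
    IsConstructible (f ⁻¹' C) :=
  hC.preimage hf fun _ _ _ => fun _ _ _ => NoetherianSpace.isCompact _

end Constructible

section Points

variable {k : Type u} [Field k]

/-- A geometric point of a disjoint union lies on one of the summands. -/
lemma exists_comp_sumι {ι : Type} [Finite ι] (F : ι → FTScheme k) {K : Type u} [Field K]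
    [IsAlgClosed K] (x : Spec (.of K) ⟶ (FTScheme.sum F).obj.left) :
    ∃ (i : ι) (y : Spec (.of K) ⟶ (F i).obj.left), y ≫ (FTScheme.sumι F i).left = x := by
  have : x (IsLocalRing.closedPoint K) ∈ ⋃ i, Set.range (FTScheme.sumι F i).left := by
    rw [iUnion_range_sumι]; trivial
  obtain ⟨i, hi⟩ := Set.mem_iUnion.mp this
  exact ⟨i, exists_lift_of_mem_range _ x hi⟩

/-- The empty scheme. -/
def FTScheme.empty (k : Type u) [Field k] : FTScheme k := .sum fun i : Empty => i.elim

lemma range_sumDesc {ι : Type} [Finite ι] (F : ι → FTScheme k) {Y : Over (Spec (.of k))}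
    (f : ∀ i, (F i).obj ⟶ Y) :
    Set.range (FTScheme.sumDesc F f).left = ⋃ i, Set.range (f i).left := by
  rw [← Set.image_univ, ← iUnion_range_sumι, Set.image_iUnion]
  congr! 2 with i
  rw [← Set.range_comp]
  conv_rhs => rw [← FTScheme.sumι_sumDesc F f i]
  rfl

/-- Universally injective morphisms with disjoint images remain so on the disjoint union. -/
lemma universallyInjective_sumDesc {ι : Type} [Finite ι] (F : ι → FTScheme k) {Y : FTScheme k}
    (f : ∀ i, (F i).obj ⟶ Y.obj) (hf : ∀ i, UniversallyInjective (f i).left)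
    (hd : Pairwise fun i j => Disjoint (Set.range (f i).left) (Set.range (f j).left)) :
    UniversallyInjective (FTScheme.sumDesc F f).left := by
  apply universallyInjective_of_isAlgClosed
  intro K _ _ g₁ g₂ h
  obtain ⟨i, y, rfl⟩ := exists_comp_sumι F g₁
  obtain ⟨j, z, rfl⟩ := exists_comp_sumι F g₂
  have hi : ∀ i, (FTScheme.sumι F i).left ≫ (FTScheme.sumDesc F f).left = (f i).left := fun i => by
    rw [← Over.comp_left, FTScheme.sumι_sumDesc]
  rw [Category.assoc, Category.assoc, hi, hi] at h
  obtain rfl : i = j := by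
    by_contra hij
    refine Set.disjoint_left.mp (hd hij) ⟨y (IsLocalRing.closedPoint K), rfl⟩
      ⟨z (IsLocalRing.closedPoint K), ?_⟩
    exact congr($h (IsLocalRing.closedPoint K)).symm
  rw [point_injective (f i).left h]

/-- A constructible set is the image of a universally injective morphism of finite type: stratify
it by locally closed subschemes. -/
lemma exists_universallyInjective_of_isConstructible (S : FTScheme k) {C : Set S.obj.left}
    (hC : Topology.IsConstructible C) (Z : TopologicalSpace.Closeds S.obj.left) :
    ∃ (Γ : FTScheme k) (g : Γ.obj ⟶ S.obj), UniversallyInjective g.left ∧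
      Set.range g.left = C ∩ Z := by
  induction Z using WellFoundedLT.induction with
  | ind Z ih =>
  rcases (Z : Set S.obj.left).eq_empty_or_nonempty with hZ | ⟨z, hz⟩
  · refine ⟨.empty k, FTScheme.sumDesc _ fun i => i.elim, ?_, ?_⟩
    · exact universallyInjective_sumDesc _ _ (fun i => i.elim) fun i => i.elim
    · exact (range_sumDesc _ _).trans (by simp [hZ])
  let i := redSubι S.obj.left Z
  have : IsNoetherian (redSub S.obj.left Z) := inferInstanceAs (IsNoetherian (S.over i).obj.left)
  have hi : Set.range i = Z := range_redSubι _ _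
  have hinj : Function.Injective i := i.isClosedEmbedding.injective
  obtain ⟨z', -⟩ : z ∈ Set.range i := hi ▸ hz
  obtain ⟨V, hV, ⟨v, hv⟩, -, h⟩ := exists_isOpen_subset_or_disjoint
    (isConstructible_preimage i.continuous hC) Set.univ isOpen_univ ⟨z', trivial⟩
  let Z' : TopologicalSpace.Closeds S.obj.left :=
    ⟨i '' Vᶜ, i.isClosedEmbedding.isClosedMap _ hV.isClosed_compl⟩
  have hZ' : (Z : Set S.obj.left) = i '' V ∪ Z' := by
    change _ = i '' V ∪ i '' Vᶜ
    rw [← Set.image_union, Set.union_compl_self, Set.image_univ, hi]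
  obtain ⟨Γ, g, hg, hgr⟩ := ih Z' <| by
    refine lt_of_le_of_ne ?_ fun h0 => ?_
    · rw [← SetLike.coe_subset_coe, hZ']; exact Set.subset_union_right
    · obtain ⟨w, hw, hwv⟩ := (SetLike.ext_iff.mp h0 (i v)).mpr (hi.le ⟨v, rfl⟩)
      exact hw (hinj hwv ▸ hv)
  rcases h with h | h
  · let j' := Scheme.Opens.ι ⟨V, hV⟩ ≫ i
    let j := S.overHom j'
    have hjr : Set.range j.left = i '' V := by
      change Set.range j' = _
      rw [Scheme.Hom.comp_base, TopCat.coe_comp, Set.range_comp, Scheme.Opens.range_ι]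
      rfl
    let F : Bool → FTScheme k := fun b => bif b then Γ else S.over j'
    let f : ∀ b, (F b).obj ⟶ S.obj := fun b => match b with | true => g | false => j
    have hd : Disjoint (Set.range g.left) (Set.range j.left) := by
      rw [hgr, hjr, Set.disjoint_left]
      rintro _ ⟨-, x, hx, rfl⟩ ⟨y, hy, hyx⟩
      exact hx (hinj hyx ▸ hy)
    refine ⟨.sum F, FTScheme.sumDesc F f, universallyInjective_sumDesc F f ?_ ?_, ?_⟩
    · rintro (_ | _)
      · change UniversallyInjective j'
        infer_instance
      · exact hg
    · rintro (_ | _) (_ | _) hne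
      exacts [absurd rfl hne, hd.symm, hd, absurd rfl hne]
    · have hf : ⋃ b, Set.range (f b).left = Set.range g.left ∪ Set.range j.left :=
        (iSup_bool_eq (f := fun b => Set.range (f b).left))
      rw [range_sumDesc, hf, hgr, hjr, hZ', Set.inter_union_distrib_left, Set.union_comm,
        Set.inter_eq_self_of_subset_right (Set.image_subset_iff.mpr h)]
  · refine ⟨Γ, g, hg, ?_⟩
    rw [hgr, hZ', Set.inter_union_distrib_left]
    refine (Set.union_eq_right.mpr ?_).symm
    rintro _ ⟨hx, x, hxV, rfl⟩
    exact (Set.disjoint_left.mp h hxV hx).elim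

/-- The product over `k`. -/
def FTScheme.prod (X Y : FTScheme k) : FTScheme k :=
  X.over (pullback.fst X.obj.hom Y.obj.hom)

/-- The first projection. -/
def FTScheme.fst (X Y : FTScheme k) : (X.prod Y).obj ⟶ X.obj :=
  X.overHom (pullback.fst X.obj.hom Y.obj.hom)

/-- The second projection. -/
def FTScheme.snd (X Y : FTScheme k) : (X.prod Y).obj ⟶ Y.obj :=
  Over.homMk (pullback.snd X.obj.hom Y.obj.hom) pullback.condition.symm

lemma isPullback_fst_snd (X Y : FTScheme k) :
    IsPullback (X.fst Y).left (X.snd Y).left X.obj.hom Y.obj.hom :=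
  IsPullback.of_hasPullback _ _

lemma cls_prod_eq (X Y : FTScheme k) : cls (X.prod Y) = cls X * cls Y :=
  cls_prod X Y _ _ _ (isPullback_fst_snd X Y)

/-- The morphism to a product with given components. -/
def FTScheme.lift {X Y : FTScheme k} {T : Over (Spec (.of k))} (f : T ⟶ X.obj) (g : T ⟶ Y.obj) :
    T ⟶ (X.prod Y).obj :=
  Over.homMk (pullback.lift f.left g.left (by rw [Over.w, Over.w]))
    ((pullback.lift_fst_assoc _ _ _ _).trans (Over.w f))

@[simp]
lemma FTScheme.lift_fst {X Y : FTScheme k} {T : Over (Spec (.of k))} (f : T ⟶ X.obj)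
    (g : T ⟶ Y.obj) : FTScheme.lift f g ≫ X.fst Y = f := by
  ext1; exact pullback.lift_fst _ _ _

@[simp]
lemma FTScheme.lift_snd {X Y : FTScheme k} {T : Over (Spec (.of k))} (f : T ⟶ X.obj)
    (g : T ⟶ Y.obj) : FTScheme.lift f g ≫ X.snd Y = g := by
  ext1; exact pullback.lift_snd _ _ _

lemma FTScheme.lift_fst_assoc {X Y : FTScheme k} {T Z : Over (Spec (.of k))} (f : T ⟶ X.obj)
    (g : T ⟶ Y.obj) (h : X.obj ⟶ Z) : FTScheme.lift f g ≫ X.fst Y ≫ h = f ≫ h := by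
  rw [← Category.assoc, FTScheme.lift_fst]

lemma FTScheme.lift_snd_assoc {X Y : FTScheme k} {T Z : Over (Spec (.of k))} (f : T ⟶ X.obj)
    (g : T ⟶ Y.obj) (h : Y.obj ⟶ Z) : FTScheme.lift f g ≫ X.snd Y ≫ h = g ≫ h := by
  rw [← Category.assoc, FTScheme.lift_snd]

lemma FTScheme.hom_ext {X Y : FTScheme k} {T : Over (Spec (.of k))} {f g : T ⟶ (X.prod Y).obj}
    (h₁ : f ≫ X.fst Y = g ≫ X.fst Y) (h₂ : f ≫ X.snd Y = g ≫ X.snd Y) : f = g := by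
  ext1
  exact (isPullback_fst_snd X Y).hom_ext congr(Over.Hom.left $h₁) congr(Over.Hom.left $h₂)

instance {X Y : FTScheme k} (f : X.obj ⟶ Y.obj) : LocallyOfFinitePresentation f.left where
  finitePresentation_appLE {U} hU {V} hV e := by
    have := IsLocallyNoetherian.component_noetherian ⟨U, hU⟩
    exact RingHom.FinitePresentation.of_finiteType.mp (f.left.finiteType_appLE hU hV e)

variable {R : Type v} [CommRing R] {φ : K0Var k →+* R}

/-- Two surjective morphisms `T ⟶ Q` and `T ⟶ Q'` which identify the same geometric points have
targets with the same motivic measure: the image of `T` in `Q × Q'` is constructible, and each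
projection is a bijection from its geometric points to those of `Q` and `Q'`. -/
theorem map_cls_eq_of_forall_iff (hφ : CharZero k ∨ InvariantUnderUnivHomeo φ)
    {T Q Q' : FTScheme k} (p : T.obj ⟶ Q.obj) (p' : T.obj ⟶ Q'.obj) [Surjective p.left]
    [Surjective p'.left] (h : ∀ (K : Type u) [Field K] [IsAlgClosed K]
      (t t' : Spec (.of K) ⟶ T.obj.left), t ≫ p.left = t' ≫ p.left ↔ t ≫ p'.left = t' ≫ p'.left) :
    φ (cls Q) = φ (cls Q') := by
  let g := FTScheme.lift p p'
  -- Chevalley's theorem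
  have hC : Topology.IsConstructible (Set.range g.left) := by
    rw [← Set.image_univ]
    exact g.left.isConstructible_image .univ
  obtain ⟨Γ, γ, hγ, hγr⟩ := exists_universallyInjective_of_isConstructible (Q.prod Q') hC ⊤
  rw [TopologicalSpace.Closeds.coe_top, Set.inter_univ] at hγr
  have key (Q'' : FTScheme k) (q : (Q.prod Q').obj ⟶ Q''.obj) [hs : Surjective (g ≫ q).left]
      (hq : ∀ (K : Type u) [Field K] [IsAlgClosed K] (t t' : Spec (.of K) ⟶ T.obj.left),
        t ≫ (g ≫ q).left = t' ≫ (g ≫ q).left → t ≫ g.left = t' ≫ g.left) :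
      φ (cls Γ) = φ (cls Q'') := by
    have : Surjective (γ ≫ q).left := by
      constructor
      rw [← Set.range_eq_univ, Over.comp_left, Scheme.Hom.comp_base, TopCat.coe_comp,
        Set.range_comp, hγr, ← Set.range_comp, ← TopCat.coe_comp, ← Scheme.Hom.comp_base,
        ← Over.comp_left]
      exact hs.surj.range_eq
    have : UniversallyInjective (γ ≫ q).left := by
      apply universallyInjective_of_isAlgClosed
      intro K _ _ x₁ x₂ hx
      obtain ⟨t₁, ht₁⟩ := exists_lift_of_mem_range g.left (x₁ ≫ γ.left) (hγr.le ⟨_, rfl⟩)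
      obtain ⟨t₂, ht₂⟩ := exists_lift_of_mem_range g.left (x₂ ≫ γ.left) (hγr.le ⟨_, rfl⟩)
      refine point_injective γ.left ?_
      rw [← ht₁, ← ht₂]
      apply hq
      rw [Over.comp_left, ← Category.assoc, ← Category.assoc, ht₁, ht₂]
      simpa using hx
    exact map_cls_eq hφ (γ ≫ q)
  have hgp : g ≫ Q.fst Q' = p := FTScheme.lift_fst _ _
  have hgp' : g ≫ Q.snd Q' = p' := FTScheme.lift_snd _ _
  have hg {K : Type u} [Field K] [IsAlgClosed K] {t t' : Spec (.of K) ⟶ T.obj.left}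
      (h₁ : t ≫ p.left = t' ≫ p.left) (h₂ : t ≫ p'.left = t' ≫ p'.left) :
      t ≫ g.left = t' ≫ g.left := by
    refine (isPullback_fst_snd Q Q').hom_ext ?_ ?_
    · rwa [Category.assoc, Category.assoc, ← Over.comp_left, hgp]
    · rwa [Category.assoc, Category.assoc, ← Over.comp_left, hgp']
  have h₁ : Surjective (g ≫ Q.fst Q').left := hgp ▸ ‹Surjective p.left›
  have h₂ : Surjective (g ≫ Q.snd Q').left := hgp' ▸ ‹Surjective p'.left›
  rw [← key Q (Q.fst Q') fun K _ _ t t' e => ?_, key Q' (Q.snd Q') fun K _ _ t t' e => ?_]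
  · rw [hgp'] at e
    exact hg ((h K t t').mpr e) e
  · rw [hgp] at e
    exact hg e ((h K t t').mp e)

end Points

/-! ### Multisets of values, and morphisms over the base from geometric points -/

/-- Two tuples have the same multiset of members if and only if they agree up to a bijection of
the index sets. -/
lemma map_univ_eq_map_univ_iff {ι ι' α : Type*} [Fintype ι] [Fintype ι'] {f : ι → α} {g : ι' → α} :
    Finset.univ.val.map f = Finset.univ.val.map g ↔ ∃ e : ι ≃ ι', ∀ i, g (e i) = f i := by
  classical
  constructor
  · intro h
    have hcard (a : α) : Nonempty ({i // f i = a} ≃ {j // g j = a}) := by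
      rw [← Fintype.card_eq, Fintype.card_subtype, Fintype.card_subtype]
      have := congr(Multiset.count a $h)
      rw [Multiset.count_map, Multiset.count_map] at this
      simpa [Finset.card, eq_comm] using this
    let e := fun a => (hcard a).some
    refine ⟨(Equiv.sigmaFiberEquiv f).symm.trans
      ((Equiv.sigmaCongrRight e).trans (Equiv.sigmaFiberEquiv g)), fun i => ?_⟩
    exact (e (f i) ⟨i, rfl⟩).2
  · rintro ⟨e, he⟩
    rw [← Multiset.map_univ_val_equiv e, Multiset.map_map]
    exact Multiset.map_congr rfl fun i _ => (he i).symm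

lemma map_snd_product {α β γ : Type*} (f : β → γ) (s : Multiset α) (t : Multiset β) :
    (s ×ˢ t).map (fun p => f p.2) = s.card • t.map f := by
  induction s using Multiset.induction_on with
  | empty => simp
  | cons a s ih => simp [ih, add_smul, add_comm]

section Points

variable {k : Type u} [Field k] {K : Type u} [Field K] [IsAlgClosed K]
  {s : Spec (.of K) ⟶ Spec (.of k)}

lemma exists_comp_eq_of_mem_range {T S : Over (Spec (.of k))} (f : T ⟶ S)
    [LocallyOfFiniteType f.left] (x : Over.mk s ⟶ S)
    (h : x.left (IsLocalRing.closedPoint K) ∈ Set.range f.left) :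
    ∃ y : Over.mk s ⟶ T, y ≫ f = x := by
  obtain ⟨y, hy⟩ := exists_lift_of_mem_range f.left x.left h
  refine ⟨Over.homMk y ?_, Over.OverMorphism.ext hy⟩
  rw [← Over.w f, ← Category.assoc, hy]
  exact Over.w x

lemma exists_comp_eq_of_surjective {T S : FTScheme k} (f : T.obj ⟶ S.obj) [Surjective f.left]
    (x : Over.mk s ⟶ S.obj) : ∃ y : Over.mk s ⟶ T.obj, y ≫ f = x :=
  exists_comp_eq_of_mem_range f x (f.left.surjective _)

lemma exists_comp_sumι_over {ι : Type} [Finite ι] (F : ι → FTScheme k)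
    (x : Over.mk s ⟶ (FTScheme.sum F).obj) :
    ∃ (i : ι) (y : Over.mk s ⟶ (F i).obj), y ≫ FTScheme.sumι F i = x := by
  obtain ⟨i, y, hy⟩ := exists_comp_sumι F x.left
  exact ⟨i, exists_comp_eq_of_mem_range _ x ⟨_, congr($hy (IsLocalRing.closedPoint K))⟩⟩

omit [IsAlgClosed K] in
lemma sumι_cancel {ι : Type} [Finite ι] (F : ι → FTScheme k) {i j : ι}
    {x : Over.mk s ⟶ (F i).obj} {y : Over.mk s ⟶ (F j).obj}
    (h : x ≫ FTScheme.sumι F i = y ≫ FTScheme.sumι F j) :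
    ∃ e : i = j, x = y ≫ eqToHom (congrArg (fun i => (F i).obj) e.symm) := by
  obtain rfl : i = j := by
    by_contra hij
    exact Set.disjoint_left.mp (disjoint_range_sumι F hij)
      ⟨x.left (IsLocalRing.closedPoint K), rfl⟩ ⟨y.left (IsLocalRing.closedPoint K),
        congr(Over.Hom.left $h (IsLocalRing.closedPoint K)).symm⟩
  refine ⟨rfl, Over.OverMorphism.ext ?_⟩
  rw [eqToHom_refl, Category.comp_id]
  exact (cancel_mono (FTScheme.sumι F i).left).mp congr(Over.Hom.left $h)

/-- Every point underlies a geometric point. -/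
lemma exists_geometric_point {Y : Over (Spec (.of k))} (y : Y.left) :
    ∃ (K : Type u) (_ : Field K) (_ : IsAlgClosed K) (s : Spec (.of K) ⟶ Spec (.of k))
      (q : Over.mk s ⟶ Y), q.left (IsLocalRing.closedPoint K) = y := by
  let κ := Y.left.residueField y
  let K := AlgebraicClosure κ
  let q : Spec (.of K) ⟶ Y.left :=
    Spec.map (CommRingCat.ofHom (algebraMap κ K)) ≫ Y.left.fromSpecResidueField y
  refine ⟨K, inferInstance, inferInstance, q ≫ Y.hom, Over.homMk q rfl, ?_⟩
  exact Scheme.fromSpecResidueField_apply (X := Y.left) y _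

lemma surjective_of_forall_exists {T S : Over (Spec (.of k))} (f : T ⟶ S)
    (h : ∀ (K : Type u) [Field K] [IsAlgClosed K] (s : Spec (.of K) ⟶ Spec (.of k))
      (x : Over.mk s ⟶ S), ∃ y, y ≫ f = x) : Surjective f.left := by
  refine ⟨fun z => ?_⟩
  obtain ⟨K, _, _, s, q, rfl⟩ := exists_geometric_point z
  obtain ⟨y, rfl⟩ := h K s q
  exact ⟨y.left (IsLocalRing.closedPoint K), rfl⟩

end Points

/-! ### Schemes parametrising zero-cycles -/

section CycleQuotient

/-- The effective zero-cycle `∑ᵢ xᵢ(t)` defined by the tuple `x` at the point `t`. -/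
def cycle {C : Type*} [Category C] {ι : Type} [Fintype ι] {T Y S : C} (x : ι → (T ⟶ Y))
    (t : S ⟶ T) : Multiset (S ⟶ Y) :=
  Finset.univ.val.map fun i => t ≫ x i

variable {k : Type u} [Field k]

/-- A set of effective zero-cycles of geometric points of `X`, for every geometric point
`s` of `Spec k`. -/
abbrev CycleFamily (X : FTScheme k) :=
  ∀ (K : Type u) [Field K] [IsAlgClosed K] (s : Spec (.of K) ⟶ Spec (.of k)),
    Set (Multiset (Over.mk s ⟶ X.obj))

/-- A scheme `Q` of finite type whose geometric points are naturally in bijection with the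
zero-cycles in `E`: the cycles in `E` are parametrised by tuples `x` of morphisms from
an auxiliary scheme `T` to `X`, and two points of `T` have the same image in `Q` if and only if
they give the same cycle. -/
structure CycleQuotient {X : FTScheme k} (ι : Type) [Fintype ι] (E : CycleFamily X)
    (Q : FTScheme k) where
  T : FTScheme k
  x : ι → (T.obj ⟶ X.obj)
  p : T.obj ⟶ Q.obj
  exists_comp_eq : ∀ (K : Type u) [Field K] [IsAlgClosed K] (s : Spec (.of K) ⟶ Spec (.of k))
    (q : Over.mk s ⟶ Q.obj), ∃ t, t ≫ p = q
  cycle_mem : ∀ (K : Type u) [Field K] [IsAlgClosed K] (s : Spec (.of K) ⟶ Spec (.of k))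
    (t : Over.mk s ⟶ T.obj), cycle x t ∈ E K s
  exists_cycle_eq : ∀ (K : Type u) [Field K] [IsAlgClosed K] (s : Spec (.of K) ⟶ Spec (.of k)),
    ∀ M ∈ E K s, ∃ t, cycle x t = M
  comp_eq_iff : ∀ (K : Type u) [Field K] [IsAlgClosed K] (s : Spec (.of K) ⟶ Spec (.of k))
    (t t' : Over.mk s ⟶ T.obj), t ≫ p = t' ≫ p ↔ cycle x t = cycle x t'

variable {X : FTScheme k}

/-- Relabelling of the members of the tuple. -/
def CycleQuotient.reindex {ι ι' : Type} [Fintype ι] [Fintype ι'] {E : CycleFamily X}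
    {Q : FTScheme k} (P : CycleQuotient ι E Q) (e : ι' ≃ ι) : CycleQuotient ι' E Q :=
  have h {K : Type u} [Field K] [IsAlgClosed K] {s : Spec (.of K) ⟶ Spec (.of k)}
      (t : Over.mk s ⟶ P.T.obj) : cycle (fun i => P.x (e i)) t = cycle P.x t :=
    map_univ_eq_map_univ_iff.mpr ⟨e, fun _ => rfl⟩
  { T := P.T
    x := fun i => P.x (e i)
    p := P.p
    exists_comp_eq := P.exists_comp_eq
    cycle_mem := fun K _ _ s t => h t ▸ P.cycle_mem K s t
    exists_cycle_eq := fun K _ _ s M hM => by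
      obtain ⟨t, ht⟩ := P.exists_cycle_eq K s M hM
      exact ⟨t, (h t).trans ht⟩
    comp_eq_iff := fun K _ _ s t t' => by rw [P.comp_eq_iff, h, h] }

lemma cycle_sumDesc {ι κ : Type} [Fintype ι] [Fintype κ] {F : κ → FTScheme k}
    {Y : Over (Spec (.of k))} (x : ∀ j, ι → ((F j).obj ⟶ Y)) {S : Over (Spec (.of k))} (j : κ)
    (t : S ⟶ (F j).obj) :
    cycle (fun i => FTScheme.sumDesc F fun j => x j i) (t ≫ FTScheme.sumι F j) = cycle (x j) t := by
  simp [cycle, Category.assoc]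

/-- The geometric points of a disjoint union of sets of cycles are those of the disjoint union of
the quotients. -/
def CycleQuotient.sum {ι κ : Type} [Fintype ι] [Fintype κ] {E : κ → CycleFamily X}
    {Q : κ → FTScheme k} (P : ∀ j, CycleQuotient ι (E j) (Q j)) (E' : CycleFamily X)
    (hE : ∀ (K : Type u) [Field K] [IsAlgClosed K] (s : Spec (.of K) ⟶ Spec (.of k))
      (M : Multiset (Over.mk s ⟶ X.obj)), M ∈ E' K s ↔ ∃ j, M ∈ E j K s)
    (hd : ∀ (K : Type u) [Field K] [IsAlgClosed K] (s : Spec (.of K) ⟶ Spec (.of k))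
      (M : Multiset (Over.mk s ⟶ X.obj)) (i j : κ), M ∈ E i K s → M ∈ E j K s → i = j) :
    CycleQuotient ι E' (FTScheme.sum Q) where
  T := FTScheme.sum fun j => (P j).T
  x i := FTScheme.sumDesc _ fun j => (P j).x i
  p := FTScheme.sumDesc _ fun j => (P j).p ≫ FTScheme.sumι Q j
  exists_comp_eq K _ _ s q := by
    obtain ⟨j, y, rfl⟩ := exists_comp_sumι_over Q q
    obtain ⟨t, rfl⟩ := (P j).exists_comp_eq K s y
    exact ⟨t ≫ FTScheme.sumι (fun j => (P j).T) j, by simp [Category.assoc]⟩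
  cycle_mem K _ _ s t := by
    obtain ⟨j, t, rfl⟩ := exists_comp_sumι_over _ t
    rw [cycle_sumDesc, hE]
    exact ⟨j, (P j).cycle_mem K s t⟩
  exists_cycle_eq K _ _ s M hM := by
    obtain ⟨j, hj⟩ := (hE K s M).mp hM
    obtain ⟨t, rfl⟩ := (P j).exists_cycle_eq K s M hj
    exact ⟨_, cycle_sumDesc (fun j => (P j).x) j t⟩
  comp_eq_iff K _ _ s t t' := by
    obtain ⟨i, t, rfl⟩ := exists_comp_sumι_over _ t
    obtain ⟨j, t', rfl⟩ := exists_comp_sumι_over _ t'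
    rw [cycle_sumDesc, cycle_sumDesc, Category.assoc, Category.assoc, FTScheme.sumι_sumDesc,
      FTScheme.sumι_sumDesc]
    constructor
    · intro h
      rw [← Category.assoc, ← Category.assoc] at h
      obtain ⟨rfl, h⟩ := sumι_cancel _ h
      rw [eqToHom_refl, Category.comp_id] at h
      exact ((P i).comp_eq_iff K s t t').mp h
    · intro h
      obtain rfl := hd K s _ i j ((P i).cycle_mem K s t) (h ▸ (P j).cycle_mem K s t')
      rw [← Category.assoc, ← Category.assoc, ((P i).comp_eq_iff K s t t').mpr h]

/-- The cycles `M + a N`, for `M ∈ E` and `N ∈ E'`. -/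
def CycleFamily.addSMul (E E' : CycleFamily X) (a : ℕ) : CycleFamily X :=
  fun K _ _ s => {L | ∃ M ∈ E K s, ∃ N ∈ E' K s, L = M + a • N}

lemma cycle_prod {ι ι' : Type} [Fintype ι] [Fintype ι'] {T T' : FTScheme k}
    (x : ι → (T.obj ⟶ X.obj)) (x' : ι' → (T'.obj ⟶ X.obj)) (a : ℕ) {S : Over (Spec (.of k))}
    (t : S ⟶ (T.prod T').obj) :
    cycle (Sum.elim (fun i => T.fst T' ≫ x i) fun i : Fin a × ι' => T.snd T' ≫ x' i.2) t =
      cycle x (t ≫ T.fst T') + a • cycle x' (t ≫ T.snd T') := by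
  have h : (Finset.univ : Finset (Fin a × ι')).val.map (fun i => (t ≫ T.snd T') ≫ x' i.2) =
      a • Finset.univ.val.map fun i => (t ≫ T.snd T') ≫ x' i := by
    rw [← Finset.univ_product_univ, Finset.product_val,
      map_snd_product fun i => (t ≫ T.snd T') ≫ x' i]
    simp
  rw [cycle, ← Finset.univ_disjSum_univ, Finset.val_disjSum, Multiset.disjSum, Multiset.map_add,
    Multiset.map_map, Multiset.map_map]
  simpa [cycle, Function.comp_def] using h

/-- If the cycles `M + a N`, for `M ∈ E` and `N ∈ E'`, determine `M` and `N`, they are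
parametrised by the product of the quotients. -/
def CycleQuotient.prod {ι ι' : Type} [Fintype ι] [Fintype ι'] {E E' : CycleFamily X}
    {Q Q' : FTScheme k} (P : CycleQuotient ι E Q) (P' : CycleQuotient ι' E' Q') (a : ℕ)
    (h : ∀ (K : Type u) [Field K] [IsAlgClosed K] (s : Spec (.of K) ⟶ Spec (.of k)),
      ∀ M ∈ E K s, ∀ N ∈ E' K s, ∀ M' ∈ E K s, ∀ N' ∈ E' K s,
        M + a • N = M' + a • N' → M = M' ∧ N = N') :
    CycleQuotient (ι ⊕ (Fin a × ι')) (E.addSMul E' a) (Q.prod Q') where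
  T := P.T.prod P'.T
  x := Sum.elim (fun i => P.T.fst P'.T ≫ P.x i) fun i => P.T.snd P'.T ≫ P'.x i.2
  p := FTScheme.lift (P.T.fst P'.T ≫ P.p) (P.T.snd P'.T ≫ P'.p)
  exists_comp_eq K _ _ s q := by
    obtain ⟨t, ht⟩ := P.exists_comp_eq K s (q ≫ Q.fst Q')
    obtain ⟨t', ht'⟩ := P'.exists_comp_eq K s (q ≫ Q.snd Q')
    refine ⟨FTScheme.lift t t', FTScheme.hom_ext ?_ ?_⟩
    · simp only [Category.assoc, FTScheme.lift_fst, FTScheme.lift_fst_assoc, ht]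
    · simp only [Category.assoc, FTScheme.lift_snd, FTScheme.lift_snd_assoc, ht']
  cycle_mem K _ _ s t := by
    rw [cycle_prod]
    exact ⟨_, P.cycle_mem K s _, _, P'.cycle_mem K s _, rfl⟩
  exists_cycle_eq K _ _ s M hM := by
    obtain ⟨M, hM, N, hN, rfl⟩ := hM
    obtain ⟨t, rfl⟩ := P.exists_cycle_eq K s M hM
    obtain ⟨t', rfl⟩ := P'.exists_cycle_eq K s N hN
    exact ⟨FTScheme.lift t t', by rw [cycle_prod, FTScheme.lift_fst, FTScheme.lift_snd]⟩
  comp_eq_iff K _ _ s t t' := by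
    have e₁ := P.comp_eq_iff K s (t ≫ P.T.fst P'.T) (t' ≫ P.T.fst P'.T)
    have e₂ := P'.comp_eq_iff K s (t ≫ P.T.snd P'.T) (t' ≫ P.T.snd P'.T)
    rw [cycle_prod, cycle_prod]
    constructor
    · intro e
      rw [← e₁.mp, ← e₂.mp]
      · simpa only [Category.assoc, FTScheme.lift_snd] using congr($e ≫ Q.snd Q')
      · simpa only [Category.assoc, FTScheme.lift_fst] using congr($e ≫ Q.fst Q')
    · intro e
      obtain ⟨h₁, h₂⟩ := h K s _ (P.cycle_mem K s _) _ (P'.cycle_mem K s _)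
        _ (P.cycle_mem K s _) _ (P'.cycle_mem K s _) e
      refine FTScheme.hom_ext ?_ ?_
      · simpa only [Category.assoc, FTScheme.lift_fst] using e₁.mpr h₁
      · simpa only [Category.assoc, FTScheme.lift_snd] using e₂.mpr h₂

/-- The scheme of pairs of points of `T` and `T'` at which the tuples `x` and `x'` agree. -/
lemma exists_coincidence {ι : Type} [Finite ι] {T T' : FTScheme k} (x : ι → (T.obj ⟶ X.obj))
    (x' : ι → (T'.obj ⟶ X.obj)) :
    ∃ (W : FTScheme k) (a : W.obj ⟶ T.obj) (b : W.obj ⟶ T'.obj),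
      (∀ i, a ≫ x i = b ≫ x' i) ∧ ∀ (S : Over (Spec (.of k))) (t : S ⟶ T.obj) (t' : S ⟶ T'.obj),
        (∀ i, t ≫ x i = t' ≫ x' i) → ∃ w : S ⟶ W.obj, w ≫ a = t ∧ w ≫ b = t' := by
  let f : T.obj ⟶ ∏ᶜ fun _ : ι => X.obj := Pi.lift x
  let g : T'.obj ⟶ ∏ᶜ fun _ : ι => X.obj := Pi.lift x'
  have : LocallyOfFiniteType g.left := by
    have : LocallyOfFiniteType (g.left ≫ (∏ᶜ fun _ : ι => X.obj).hom) := by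
      rw [Over.w g]; infer_instance
    exact locallyOfFiniteType_of_comp g.left (∏ᶜ fun _ : ι => X.obj).hom
  have : QuasiCompact g.left := inferInstance
  let b : (T.over (pullback.fst f.left g.left)).obj ⟶ T'.obj :=
    Over.homMk (pullback.snd f.left g.left) (by
      change _ = pullback.fst f.left g.left ≫ T.obj.hom
      rw [← Over.w g, ← Over.w f, pullback.condition_assoc]
      rfl)
  have hb : T.overHom (pullback.fst f.left g.left) ≫ f = b ≫ g :=
    Over.OverMorphism.ext pullback.condition
  refine ⟨T.over (pullback.fst f.left g.left), T.overHom _, b, fun i => ?_, fun S t t' h => ?_⟩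
  · have := congr($hb ≫ Pi.π (fun _ : ι => X.obj) i)
    simpa [f, g] using this
  · have e : t ≫ f = t' ≫ g := Pi.hom_ext _ _ fun i => by simpa [f, g] using h i
    refine ⟨Over.homMk (pullback.lift t.left t'.left congr(Over.Hom.left $e)) ?_, ?_, ?_⟩
    · exact (pullback.lift_fst_assoc _ _ _ _).trans (Over.w t)
    · exact Over.OverMorphism.ext (pullback.lift_fst _ _ _)
    · exact Over.OverMorphism.ext (pullback.lift_snd _ _ _)

variable {R : Type v} [CommRing R] {φ : K0Var k →+* R}

/-- The measure of a scheme whose geometric points are the cycles in `E` depends only on `E`.  Two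
parametrisations of the same cycles are compared on the disjoint union of the schemes of pairs
of tuples which agree up to a given bijection `e` of the index sets. -/
theorem CycleQuotient.map_cls_eq (hφ : CharZero k ∨ InvariantUnderUnivHomeo φ) {ι ι' : Type}
    [Fintype ι] [Fintype ι'] {E : CycleFamily X} {Q Q' : FTScheme k} (P : CycleQuotient ι E Q)
    (P' : CycleQuotient ι' E Q') : φ (cls Q) = φ (cls Q') := by
  classical
  choose W a b hab hW using fun e : ι ≃ ι' => exists_coincidence P.x fun i => P'.x (e i)
  let p := FTScheme.sumDesc W fun e => a e ≫ P.p
  let p' := FTScheme.sumDesc W fun e => b e ≫ P'.p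
  have hex {K : Type u} [Field K] [IsAlgClosed K] {s : Spec (.of K) ⟶ Spec (.of k)}
      (t : Over.mk s ⟶ P.T.obj) (t' : Over.mk s ⟶ P'.T.obj) (h : cycle P.x t = cycle P'.x t') :
      ∃ w : Over.mk s ⟶ (FTScheme.sum W).obj, w ≫ p = t ≫ P.p ∧ w ≫ p' = t' ≫ P'.p := by
    obtain ⟨e, he⟩ := map_univ_eq_map_univ_iff.mp h
    obtain ⟨w, hw, hw'⟩ := hW e _ t t' fun i => (he i).symm
    refine ⟨w ≫ FTScheme.sumι W e, ?_, ?_⟩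
    · simp only [p, Category.assoc, FTScheme.sumι_sumDesc]
      rw [← hw, Category.assoc]
    · simp only [p', Category.assoc, FTScheme.sumι_sumDesc]
      rw [← hw', Category.assoc]
  have hp : Surjective p.left := surjective_of_forall_exists p fun K _ _ s q => by
    obtain ⟨t, rfl⟩ := P.exists_comp_eq K s q
    obtain ⟨t', ht'⟩ := P'.exists_cycle_eq K s _ (P.cycle_mem K s t)
    obtain ⟨w, hw, -⟩ := hex t t' ht'.symm
    exact ⟨w, hw⟩
  have hp' : Surjective p'.left := surjective_of_forall_exists p' fun K _ _ s q => by
    obtain ⟨t', rfl⟩ := P'.exists_comp_eq K s q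
    obtain ⟨t, ht⟩ := P.exists_cycle_eq K s _ (P'.cycle_mem K s t')
    obtain ⟨w, -, hw⟩ := hex t t' ht
    exact ⟨w, hw⟩
  have key {K : Type u} [Field K] [IsAlgClosed K] {s : Spec (.of K) ⟶ Spec (.of k)}
      (w w' : Over.mk s ⟶ (FTScheme.sum W).obj) : w ≫ p = w' ≫ p ↔ w ≫ p' = w' ≫ p' := by
    obtain ⟨e, w, rfl⟩ := exists_comp_sumι_over W w
    obtain ⟨e', w', rfl⟩ := exists_comp_sumι_over W w'
    have hc (e : ι ≃ ι') (w : Over.mk s ⟶ (W e).obj) :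
        cycle P.x (w ≫ a e) = cycle P'.x (w ≫ b e) :=
      map_univ_eq_map_univ_iff.mpr ⟨e, fun i => by rw [Category.assoc, Category.assoc, hab]⟩
    simp only [p, p', Category.assoc, FTScheme.sumι_sumDesc]
    rw [← Category.assoc, ← Category.assoc, ← Category.assoc, ← Category.assoc, P.comp_eq_iff,
      P'.comp_eq_iff, hc, hc]
  refine map_cls_eq_of_forall_iff hφ p p' fun K _ _ t t' => ?_
  have hs (Q : FTScheme k) (q : (FTScheme.sum W).obj ⟶ Q.obj) (h : t ≫ q.left = t' ≫ q.left) :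
      t' ≫ (FTScheme.sum W).obj.hom = t ≫ (FTScheme.sum W).obj.hom := by
    rw [← Over.w q, ← Category.assoc, ← Category.assoc, h]
  constructor
  · intro h
    exact congr(Over.Hom.left $((key (Over.homMk t rfl) (Over.homMk t' (hs _ p h))).mp
      (Over.OverMorphism.ext h)))
  · intro h
    exact congr(Over.Hom.left $((key (Over.homMk t rfl) (Over.homMk t' (hs _ p' h))).mpr
      (Over.OverMorphism.ext h)))

end CycleQuotient

/-! ### Stratified quotients of powers parametrise zero-cycles -/

section Power

variable {k : Type u} [Field k] (X : FTScheme k) (n : ℕ)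

/-- Finite powers of a finite type scheme are of finite type, by induction on the exponent. -/
lemma exists_isLimit_fan : ∃ (W : FTScheme k) (π : Fin n → (W.obj ⟶ X.obj)),
    Nonempty (IsLimit (Fan.mk W.obj π)) ∧ (IsSeparated X.obj.hom → IsSeparated W.obj.hom) := by
  induction n with
  | zero =>
    let W : FTScheme k := ⟨Over.mk (𝟙 _), by dsimp; infer_instance, by dsimp; infer_instance⟩
    refine ⟨W, fun i => i.elim0, ⟨Fan.IsLimit.mk _ (fun s => Over.mkIdTerminal.from _)
      (fun s i => i.elim0) fun s m _ => Over.mkIdTerminal.hom_ext _ _⟩, fun _ => ?_⟩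
    dsimp [W]; infer_instance
  | succ n ih =>
    obtain ⟨W, π, ⟨hW⟩, hs⟩ := ih
    have hb : IsLimit (BinaryFan.mk (X.fst W) (X.snd W)) :=
      BinaryFan.IsLimit.mk _ FTScheme.lift FTScheme.lift_fst FTScheme.lift_snd
        fun f g m h₁ h₂ => FTScheme.hom_ext (h₁.trans (FTScheme.lift_fst f g).symm)
          (h₂.trans (FTScheme.lift_snd f g).symm)
    let c := extendFan (f := fun _ : Fin (n + 1) => X.obj) (Fan.mk W.obj π)
      (BinaryFan.mk (X.fst W) (X.snd W))
    refine ⟨X.prod W, c.proj, ⟨?_⟩, fun h => ?_⟩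
    · exact (extendFanIsLimit (fun _ : Fin (n + 1) => X.obj) hW hb).ofIsoLimit
        (Cone.ext (Iso.refl _) fun j => (Category.id_comp _).symm)
    · have := hs h
      change IsSeparated (pullback.fst X.obj.hom W.obj.hom ≫ X.obj.hom)
      infer_instance

lemma exists_iso_power : ∃ (W : FTScheme k) (e : power X n ⟶ W.obj), IsIso e.left ∧
    (IsSeparated X.obj.hom → IsSeparated W.obj.hom) := by
  obtain ⟨W, π, ⟨h⟩, hs⟩ := exists_isLimit_fan X n
  let e : power X n ≅ W.obj := (productIsProduct _).conePointUniqueUpToIso h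
  exact ⟨W, e.hom, inferInstanceAs (IsIso ((Over.forget _).map e.hom)), hs⟩

instance : LocallyOfFiniteType (power X n).hom := by
  obtain ⟨W, e, _, -⟩ := exists_iso_power X n
  rw [← Over.w e]
  infer_instance

instance : QuasiCompact (power X n).hom := by
  obtain ⟨W, e, _, -⟩ := exists_iso_power X n
  rw [← Over.w e]
  infer_instance

instance [IsSeparated X.obj.hom] : IsSeparated (power X n).hom := by
  obtain ⟨W, e, _, h⟩ := exists_iso_power X n
  have := h ‹_›
  rw [← Over.w e]
  infer_instance

/-- The power `Xⁿ`, as a finite type scheme. -/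
@[simps]
def FTScheme.power : FTScheme k := ⟨MotivicConf.power X n, inferInstance, inferInstance⟩

instance : IsNoetherian (power X n).left := inferInstanceAs (IsNoetherian (X.power n).obj.left)

@[simp]
lemma permute_coord (σ : Equiv.Perm (Fin n)) (i : Fin n) :
    permute X n σ ≫ coord X n i = coord X n (σ i) :=
  Pi.lift_π _ _

variable {X n}

lemma power_hom_ext {S : Over (Spec (.of k))} {t t' : S ⟶ power X n}
    (h : ∀ i, t ≫ coord X n i = t' ≫ coord X n i) : t = t' :=
  Pi.hom_ext _ _ h

/-- Points of `Xⁿ` define the same cycle if and only if they are in the same orbit. -/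
lemma cycle_coord_eq_iff {S : Over (Spec (.of k))} (t t' : S ⟶ power X n) :
    cycle (coord X n) t = cycle (coord X n) t' ↔ ∃ σ, t = t' ≫ permute X n σ := by
  rw [cycle, cycle, map_univ_eq_map_univ_iff]
  refine exists_congr fun σ => ⟨fun h => power_hom_ext fun i => ?_, ?_⟩
  · rw [Category.assoc, permute_coord, h]
  · rintro rfl i
    rw [Category.assoc, permute_coord]

/-- The cycles defined by the geometric points of `E`. -/
def pointFamily (E : Set (power X n).left) : CycleFamily X := fun K _ _ s =>
  {M | ∃ t : Over.mk s ⟶ power X n, t.left (IsLocalRing.closedPoint K) ∈ E ∧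
    cycle (coord X n) t = M}

/-- The geometric points of the disjoint union of the quotients of the strata are the cycles defined
by the geometric points of `E`. -/
lemma StratifiedQuotient.nonempty_cycleQuotient {E : Set (power X n).left}
    (S : StratifiedQuotient X n E) :
    Nonempty (CycleQuotient (Fin n) (pointFamily E) (FTScheme.sum S.Q)) := by
  have := S.isImmersion
  have hT (i : Fin S.size) : LocallyOfFiniteType (S.T i).hom := by
    rw [← Over.w (S.emb i)]; infer_instance
  have hT' (i : Fin S.size) : QuasiCompact (S.T i).hom := by
    have := (S.emb i).left.isEmbedding.isInducing.noetherianSpace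
    exact (quasiCompact_iff_compactSpace _).mpr inferInstance
  let T (i : Fin S.size) : FTScheme k := ⟨S.T i, hT i, hT' i⟩
  let x (j : Fin n) : (FTScheme.sum T).obj ⟶ X.obj :=
    FTScheme.sumDesc T fun i => S.emb i ≫ coord X n j
  have hx {S' : Over (Spec (.of k))} (i : Fin S.size) (t : S' ⟶ (T i).obj) :
      cycle x (t ≫ FTScheme.sumι T i) = cycle (coord X n) (t ≫ S.emb i) := by
    simp [cycle, x, Category.assoc, T]
  have hE {i : Fin S.size} (z : (S.T i).left) : (S.emb i).left z ∈ E :=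
    S.cover.le (Set.mem_iUnion.mpr ⟨i, z, rfl⟩)
  refine ⟨FTScheme.sum T, x, FTScheme.sumDesc T fun i => S.proj i ≫ FTScheme.sumι S.Q i,
    fun K _ _ s q => ?_, fun K _ _ s t => ?_, fun K _ _ s M hM => ?_, fun K _ _ s t t' => ?_⟩
  · obtain ⟨i, q, rfl⟩ := exists_comp_sumι_over _ q
    have : Surjective (S.proj i).left := ⟨(S.isGeomQuotient i).isQuotientMap.surjective⟩
    obtain ⟨t, ht⟩ := exists_comp_eq_of_surjective (T := T i) (S.proj i) q
    refine ⟨t ≫ FTScheme.sumι T i, ?_⟩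
    rw [Category.assoc, FTScheme.sumι_sumDesc, ← ht, Category.assoc]
  · obtain ⟨i, t, rfl⟩ := exists_comp_sumι_over _ t
    exact ⟨t ≫ S.emb i, hE _, (hx i t).symm⟩
  · obtain ⟨t, ht, rfl⟩ := hM
    obtain ⟨i, hi⟩ := Set.mem_iUnion.mp (S.cover.ge ht)
    obtain ⟨y, rfl⟩ := exists_comp_eq_of_mem_range (S.emb i) t hi
    exact ⟨y ≫ FTScheme.sumι T i, hx i y⟩
  · obtain ⟨i, t, rfl⟩ := exists_comp_sumι_over _ t
    obtain ⟨j, t', rfl⟩ := exists_comp_sumι_over _ t'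
    rw [Category.assoc, Category.assoc, FTScheme.sumι_sumDesc, FTScheme.sumι_sumDesc, hx, hx]
    constructor
    · intro h
      rw [← Category.assoc, ← Category.assoc] at h
      obtain ⟨rfl, h⟩ := sumι_cancel _ h
      rw [eqToHom_refl, Category.comp_id] at h
      obtain ⟨σ, hσ⟩ := (S.isGeomQuotient i).orbits K t'.left t.left congr(Over.Hom.left $h).symm
      have hσ' : t = t' ≫ S.act i σ := Over.OverMorphism.ext hσ
      exact (cycle_coord_eq_iff _ _).mpr ⟨σ, by rw [hσ', Category.assoc, S.act_emb, Category.assoc]⟩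
    · intro h
      obtain ⟨σ, hσ⟩ := (cycle_coord_eq_iff _ _).mp h
      have hσ' : t ≫ S.emb i = t' ≫ S.act j σ ≫ S.emb j := by
        rw [hσ, Category.assoc, S.act_emb]
      obtain rfl : i = j := by
        by_contra hij
        refine Set.disjoint_left.mp (S.disjoint hij) ⟨t.left (IsLocalRing.closedPoint K), rfl⟩
          ⟨(t' ≫ S.act j σ).left (IsLocalRing.closedPoint K), ?_⟩
        rw [← Category.assoc] at hσ'
        exact congr(Over.Hom.left $hσ' (IsLocalRing.closedPoint K)).symm
      have : t = t' ≫ S.act i σ := Over.OverMorphism.ext <| (cancel_mono (S.emb i).left).mp <| by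
        rw [← Category.assoc] at hσ'
        exact congr(Over.Hom.left $hσ')
      have hinv : S.act i σ ≫ S.proj i = S.proj i :=
        Over.OverMorphism.ext ((S.isGeomQuotient i).invariant σ)
      rw [this, Category.assoc, reassoc_of% hinv]

end Power

/-! ### Rings of invariants of finite groups -/

section Invariants

open Polynomial in
/-- Ring homomorphisms to a domain which agree on the invariants of a finite group differ by the
action of a group element.  Otherwise some `p ∈ A[X]` satisfies `ψ p ≠ χ (g p)` for all `g`,
although `ψ p` is a root of `∏ (T - ψ (g p)) = ∏ (T - χ (g p))`. -/
lemma exists_forall_eq_smul {G A K : Type*} [Group G] [Finite G] [CommRing A]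
    [MulSemiringAction G A] [CommRing K] [IsDomain K] (χ ψ : A →+* K)
    (h : ∀ a : A, (∀ g : G, g • a = a) → χ a = ψ a) : ∃ g : G, ∀ a, ψ a = χ (g • a) := by
  cases nonempty_fintype G
  by_contra! hne
  choose a ha using hne
  -- a polynomial whose coefficients separate `ψ` from all `χ ∘ g` at once
  let e := Fintype.equivFin G
  let p : A[X] := ∑ g, monomial (e g : ℕ) (a g)
  have hp (g : G) : p.coeff (e g) = a g := by
    simp only [p, finsetSum_coeff, coeff_monomial]
    rw [Finset.sum_eq_single g] <;> simp +contextual [Fin.val_inj]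
  have hmap : (MulSemiringAction.charpoly G p).map (mapRingHom χ) =
      (MulSemiringAction.charpoly G p).map (mapRingHom ψ) := by
    ext n m
    simp only [coeff_map, coe_mapRingHom]
    refine h _ fun g => ?_
    rw [← coeff_smul, MulSemiringAction.smul_coeff_charpoly]
  have hz := congr(($hmap).eval (mapRingHom ψ p))
  rw [eval_map_apply (mapRingHom ψ),
    MulSemiringAction.eval_charpoly, map_zero, MulSemiringAction.charpoly_eq, Polynomial.map_prod,
    eval_prod, Finset.prod_eq_zero_iff] at hz
  obtain ⟨g, -, hg⟩ := hz
  simp only [Polynomial.map_sub, map_X, map_C, eval_sub, eval_X, eval_C, sub_eq_zero] at hg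
  refine ha g ?_
  have := congr(($hg).coeff (e g))
  simpa [coeff_map, hp] using this

section Localization

variable {A B A' B' : Type*} [CommRing A] [CommRing B] [CommRing A'] [CommRing B'] [Algebra A A']
  [Algebra B B'] {π : B →+* A} (b : B) [IsLocalization.Away b B'] [IsLocalization.Away (π b) A']
  {f : B' →+* A'} (hf : ∀ c, f (algebraMap B B' c) = algebraMap A A' (π c))

include b hf

lemma injective_of_isLocalization_away (hπ : Function.Injective π) : Function.Injective f := by
  rw [injective_iff_map_eq_zero]
  intro t ht
  obtain ⟨n, c, hc⟩ := IsLocalization.Away.surj b t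
  have h0 : algebraMap A A' (π c) = 0 := by rw [← hf, ← hc, map_mul, ht, zero_mul]
  obtain ⟨⟨_, m, rfl⟩, hm⟩ := (IsLocalization.map_eq_zero_iff (Submonoid.powers (π b)) A' _).mp h0
  have hm' : b ^ m * c = 0 := hπ (by simpa using hm)
  have hu : IsUnit (algebraMap B B' b) := IsLocalization.Away.algebraMap_isUnit b
  have : algebraMap B B' c = 0 := by
    refine (hu.pow m).mul_right_eq_zero.mp ?_
    rw [← map_pow, ← map_mul, hm', map_zero]
  rw [this] at hc
  exact (hu.pow n).mul_left_eq_zero.mp (by simpa using hc)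

/-- Localization at an invariant element commutes with taking invariants. -/
lemma exists_eq_of_isLocalization_away {G : Type*} [Finite G] {ρ : G → A →+* A}
    {γ : G → A' →+* A'} (hπ : ∀ a, (∀ g, ρ g a = a) → ∃ c, π c = a)
    (hρ : ∀ g c, ρ g (π c) = π c) (hγ : ∀ g a, γ g (algebraMap A A' a) = algebraMap A A' (ρ g a))
    {s : A'} (hs : ∀ g, γ g s = s) : ∃ t, f t = s := by
  cases nonempty_fintype G
  obtain ⟨n, a, ha⟩ := IsLocalization.Away.surj (π b) s
  have h (g : G) : ∃ m, π b ^ m * ρ g a = π b ^ m * a := by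
    have : algebraMap A A' (ρ g a) = algebraMap A A' a := by
      rw [← hγ, ← ha, map_mul, map_pow, hγ, hρ, hs]
    obtain ⟨⟨_, m, rfl⟩, hm⟩ := (IsLocalization.eq_iff_exists (Submonoid.powers (π b)) A').mp this
    exact ⟨m, hm⟩
  choose m hm using h
  let N := ∑ g, m g
  obtain ⟨c, hc⟩ := hπ (π b ^ N * a) fun g => by
    have hg : N = (N - m g) + m g :=
      (Nat.sub_add_cancel
        (Finset.single_le_sum (fun _ _ => Nat.zero_le _) (Finset.mem_univ g))).symm
    rw [map_mul, map_pow, hρ, hg, pow_add, mul_assoc, hm, mul_assoc]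
  have hu : IsUnit (algebraMap B B' b) := IsLocalization.Away.algebraMap_isUnit b
  have hu' : IsUnit (algebraMap A A' (π b)) := IsLocalization.Away.algebraMap_isUnit _
  obtain ⟨v, hv⟩ := (hu.pow (N + n)).exists_right_inv
  refine ⟨algebraMap B B' c * v, (hu'.pow (N + n)).mul_left_inj.mp ?_⟩
  have hv' : algebraMap A A' (π b) ^ (N + n) * f v = 1 := by
    rw [← hf, ← map_pow, ← map_mul, hv, map_one]
  rw [map_mul, hf, mul_assoc, mul_comm (f v), hv', mul_one, hc, map_mul, map_pow, ← ha]
  ring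

end Localization

/-- The invariants of a finite group acting on an algebra of finite type over a Noetherian ring are
of finite type. -/
lemma finiteType_of_isInvariant {k A B G : Type*} [CommRing k] [IsNoetherianRing k] [CommRing A]
    [CommRing B] [Algebra k A] [Algebra k B] [Algebra B A] [IsScalarTower k B A] [Group G]
    [Finite G] [MulSemiringAction G A] [Algebra.IsInvariant B A G] [Algebra.FiniteType k A]
    (h : Function.Injective (algebraMap B A)) : Algebra.FiniteType k B := by
  have := Algebra.IsInvariant.isIntegral B A G
  have : Algebra.FiniteType B A := Algebra.FiniteType.of_restrictScalars_finiteType k B A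
  have : Module.Finite B A := Algebra.IsIntegral.finite
  exact ⟨fg_of_fg_of_fg k B A Algebra.FiniteType.out Module.Finite.fg_top h⟩

end Invariants

/-! ### Quotients of affine schemes by finite groups -/

section AffineQuotient

variable {G : Type} [Group G] [Finite G] {V Q : Scheme.{u}} [IsAffine V] [IsAffine Q]
  {act : G → (V ⟶ V)} {π : V ⟶ Q}

/-- An action on a scheme induces one on its ring of global sections. -/
@[reducible]
def globalSectionsAction (act : G → (V ⟶ V)) (h₁ : act 1 = 𝟙 V)
    (hmul : ∀ g h, act g ≫ act h = act (g * h)) : MulSemiringAction G Γ(V, ⊤) where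
  smul g a := (act g).appTop a
  one_smul a := by
    change (act 1).appTop a = a
    rw [h₁, Scheme.Hom.id_appTop]; rfl
  mul_smul g h a := by
    change (act (g * h)).appTop a = (act g).appTop ((act h).appTop a)
    rw [← hmul, Scheme.Hom.comp_appTop]; rfl
  smul_zero g := map_zero (act g).appTop.hom
  smul_add g := map_add (act g).appTop.hom
  smul_one g := map_one (act g).appTop.hom
  smul_mul g := map_mul (act g).appTop.hom

-- `π` is invariant, and identifies the global functions on `Q` with the invariant ones on `V`
variable (hinv : ∀ g, act g ≫ π = π) (hinj : Function.Injective π.appTop)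
  (hsurj : ∀ a, (∀ g, (act g).appTop a = a) → ∃ b, π.appTop b = a)

include hinj in
lemma injective_app_basicOpen (b : Γ(Q, ⊤)) : Function.Injective (π.app (Q.basicOpen b)) := by
  let _ := (V.presheaf.map (homOfLE le_top : π ⁻¹ᵁ Q.basicOpen b ⟶ ⊤).op).hom.toAlgebra
  have : IsLocalization.Away (π.appTop.hom b) Γ(V, π ⁻¹ᵁ Q.basicOpen b) :=
    (isAffineOpen_top V).isLocalization_of_eq_basicOpen _ (homOfLE le_top)
      (Scheme.preimage_basicOpen_top _ _)
  refine injective_of_isLocalization_away (f := (π.app (Q.basicOpen b)).hom) b (fun c => ?_) hinj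
  exact congr($(π.naturality (homOfLE le_top : Q.basicOpen b ⟶ ⊤).op) c)

omit [Group G] in
include hinv hsurj in
lemma exists_app_basicOpen_eq (b : Γ(Q, ⊤)) {s : Γ(V, π ⁻¹ᵁ Q.basicOpen b)}
    (hs : ∀ (g : G) (h : π ⁻¹ᵁ Q.basicOpen b ≤ act g ⁻¹ᵁ π ⁻¹ᵁ Q.basicOpen b),
      (act g).appLE (π ⁻¹ᵁ Q.basicOpen b) (π ⁻¹ᵁ Q.basicOpen b) h s = s) :
    ∃ t, π.app (Q.basicOpen b) t = s := by
  let _ := (V.presheaf.map (homOfLE le_top : π ⁻¹ᵁ Q.basicOpen b ⟶ ⊤).op).hom.toAlgebra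
  have : IsLocalization.Away (π.appTop.hom b) Γ(V, π ⁻¹ᵁ Q.basicOpen b) :=
    (isAffineOpen_top V).isLocalization_of_eq_basicOpen _ (homOfLE le_top)
      (Scheme.preimage_basicOpen_top _ _)
  have hle (g : G) : π ⁻¹ᵁ Q.basicOpen b ≤ act g ⁻¹ᵁ π ⁻¹ᵁ Q.basicOpen b := by
    rw [← Scheme.Hom.comp_preimage, hinv]
  refine exists_eq_of_isLocalization_away (f := (π.app (Q.basicOpen b)).hom) b (fun c => ?_)
    (ρ := fun g => (act g).appTop.hom) (γ := fun g => ((act g).appLE _ _ (hle g)).hom)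
    hsurj (fun g c => ?_) (fun g a => ?_) fun g => hs g (hle g)
  · exact congr($(π.naturality (homOfLE le_top : Q.basicOpen b ⟶ ⊤).op) c)
  · have := congr(($(hinv g)).appTop c)
    rwa [Scheme.Hom.comp_appTop] at this
  · have h₁ := Scheme.Hom.map_appLE (act g) (hle g) (homOfLE le_top : π ⁻¹ᵁ Q.basicOpen b ⟶ ⊤).op
    have h₂ := Scheme.Hom.appLE_map (act g) (U := ⊤) (V := act g ⁻¹ᵁ ⊤) le_rfl
      (homOfLE le_top : π ⁻¹ᵁ Q.basicOpen b ⟶ ⊤).op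
    rw [← h₂] at h₁
    rw [Scheme.Hom.appLE_eq_app] at h₁
    exact congr($h₁ a)

include hinj in
lemma injective_app (U : Q.Opens) : Function.Injective (π.app U) := by
  intro t t' h
  refine Q.sheaf.eq_of_locally_eq' (fun b : {b : Γ(Q, ⊤) // Q.basicOpen b ≤ U} => Q.basicOpen b.1) U
    (fun b => homOfLE b.2) ?_ t t' fun b => injective_app_basicOpen hinj b.1 ?_
  · intro x hx
    obtain ⟨_, ⟨b, rfl⟩, hxb, hb⟩ := TopologicalSpace.Opens.isBasis_iff_nbhd.mp
      (isBasis_basicOpen Q) hx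
    exact TopologicalSpace.Opens.mem_iSup.mpr ⟨⟨b, hb⟩, hxb⟩
  · have hn := π.naturality (homOfLE b.2).op
    refine congr($hn t).trans (Eq.trans ?_ congr($hn t').symm)
    exact congr(V.presheaf.map _ $h)

omit [Group G] in
include hinv hinj hsurj in
/-- The sections of `O_Q` are the invariant sections of `O_V`: this holds on the basic open sets,
and the unique preimages there glue. -/
lemma existsUnique_app_eq (U : Q.Opens) (s : Γ(V, π ⁻¹ᵁ U))
    (hs : ∀ (g : G) (h : π ⁻¹ᵁ U ≤ act g ⁻¹ᵁ π ⁻¹ᵁ U),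
      (act g).appLE (π ⁻¹ᵁ U) (π ⁻¹ᵁ U) h s = s) : ∃! t : Γ(Q, U), π.app U t = s := by
  let ι := {b : Γ(Q, ⊤) // Q.basicOpen b ≤ U}
  let s' (b : ι) : Γ(V, π ⁻¹ᵁ Q.basicOpen b.1) :=
    V.presheaf.map (homOfLE (π.preimage_mono b.2)).op s
  have hs' (b : ι) : ∃ t, π.app (Q.basicOpen b.1) t = s' b := by
    refine exists_app_basicOpen_eq hinv hsurj b.1 fun g h => ?_
    have hU : π ⁻¹ᵁ U ≤ act g ⁻¹ᵁ π ⁻¹ᵁ U := by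
      rw [← Scheme.Hom.comp_preimage, hinv]
    have h₁ := Scheme.Hom.map_appLE (act g) h (homOfLE (π.preimage_mono b.2)).op
    rw [← Scheme.Hom.appLE_map (act g) hU (homOfLE (π.preimage_mono b.2)).op] at h₁
    refine congr($h₁ s).trans ?_
    exact congr(V.presheaf.map _ $(hs g hU))
  choose t ht using hs'
  have hcover : U ≤ ⨆ b : ι, Q.basicOpen b.1 := by
    intro x hx
    obtain ⟨_, ⟨b, rfl⟩, hxb, hb⟩ := TopologicalSpace.Opens.isBasis_iff_nbhd.mp
      (isBasis_basicOpen Q) hx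
    exact TopologicalSpace.Opens.mem_iSup.mpr ⟨⟨b, hb⟩, hxb⟩
  have hr (b : ι) {W : Q.Opens} (i : W ≤ Q.basicOpen b.1) :
      π.app W (Q.presheaf.map (homOfLE i).op (t b)) =
        V.presheaf.map (homOfLE (π.preimage_mono (i.trans b.2))).op s := by
    refine congr($(π.naturality (homOfLE i).op) (t b)).trans ?_
    refine congr(V.presheaf.map _ $(ht b)).trans ?_
    exact congr($((V.presheaf.map_comp (homOfLE (π.preimage_mono b.2)).op
      (homOfLE (π.preimage_mono i)).op).symm) s)
  obtain ⟨w, hw, -⟩ := Q.sheaf.existsUnique_gluing' (fun b : ι => Q.basicOpen b.1) U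
    (fun b => homOfLE b.2) hcover t (fun b c => by
      exact injective_app hinj _ ((hr b inf_le_left).trans (hr c inf_le_right).symm))
  have hws : π.app U w = s := by
    refine V.sheaf.eq_of_locally_eq' (fun b : ι => π ⁻¹ᵁ Q.basicOpen b.1) (π ⁻¹ᵁ U)
      (fun b => homOfLE (π.preimage_mono b.2)) ?_ _ _ fun b => ?_
    · intro x hx
      obtain ⟨b, hb⟩ := TopologicalSpace.Opens.mem_iSup.mp (hcover hx)
      exact TopologicalSpace.Opens.mem_iSup.mpr ⟨b, hb⟩
    · refine Eq.trans congr($((π.naturality (homOfLE b.2).op).symm) w) ?_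
      exact congr(π.app _ $(hw b)).trans (ht b)
  exact ⟨w, hws, fun w' hw' => injective_app hinj U (hw'.trans hws.symm)⟩

include hinv hinj hsurj in
/-- Quotients of affine schemes by finite groups are given by the rings of invariants. -/
theorem isGeomQuotient_of_isAffine (h₁ : act 1 = 𝟙 V)
    (hmul : ∀ g h, act g ≫ act h = act (g * h)) : IsGeomQuotient act π := by
  let _ := globalSectionsAction act h₁ hmul
  let _ := π.appTop.hom.toAlgebra
  have : Algebra.IsInvariant Γ(Q, ⊤) Γ(V, ⊤) G := ⟨hsurj⟩
  have hint : IsIntegralHom π := by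
    exact IsIntegralHom.hasAffineProperty.iff_of_isAffine.mpr
      ⟨inferInstance, (Algebra.IsInvariant.isIntegral Γ(Q, ⊤) Γ(V, ⊤) G).isIntegral⟩
  have hdom : IsDominant π := isDominant_of_of_appTop_injective hinj
  have hcl : IsClosedMap π := π.isClosedMap
  have hsur : Function.Surjective π := by
    rw [← Set.range_eq_univ, ← hdom.denseRange.closure_range, hcl.isClosed_range.closure_eq]
  refine ⟨hinv, hcl.isQuotientMap π.continuous hsur, fun K _ _ x y h => ?_,
    existsUnique_app_eq hinv hinj hsurj⟩
  let χ (x : Spec (.of K) ⟶ V) : Γ(V, ⊤) →+* K :=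
    (x.appTop ≫ (Scheme.ΓSpecIso (.of K)).hom).hom
  obtain ⟨g, hg⟩ := exists_forall_eq_smul (G := G) (χ x) (χ y) fun a ha => by
    obtain ⟨b, rfl⟩ := hsurj a ha
    have := congr((Scheme.ΓSpecIso (.of K)).hom ($(h).appTop b))
    rwa [Scheme.Hom.comp_appTop, Scheme.Hom.comp_appTop] at this
  refine ⟨g, ext_of_isAffine ?_⟩
  rw [Scheme.Hom.comp_appTop, ← cancel_mono (Scheme.ΓSpecIso (.of K)).hom]
  ext a
  exact hg a

end AffineQuotient

/-- The quotient of an affine scheme of finite type over `k` by a finite group exists, and is of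
finite type. -/
lemma exists_isGeomQuotient_of_isAffine {k : Type u} [Field k] {V : Over (Spec (.of k))}
    [IsAffine V.left] [LocallyOfFiniteType V.hom] {G : Type} [Group G] [Finite G] (act : G → (V ⟶ V))
    (h₁ : act 1 = 𝟙 V) (hmul : ∀ g h, act g ≫ act h = act (g * h)) :
    ∃ (Q : FTScheme k) (π : V ⟶ Q.obj), IsGeomQuotient (fun g => (act g).left) π.left := by
  have h₁' : (act 1).left = 𝟙 V.left := by rw [h₁]; rfl
  have hmul' (g h : G) : (act g).left ≫ (act h).left = (act (g * h)).left := by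
    rw [← hmul]; rfl
  let A := Γ(V.left, ⊤)
  let _ : MulSemiringAction G A := globalSectionsAction (fun g => (act g).left) h₁' hmul'
  let α : CommRingCat.of k ⟶ A := (Scheme.ΓSpecIso (.of k)).inv ≫ V.hom.appTop
  let _ : Algebra k A := α.hom.toAlgebra
  have hα (g : G) : α ≫ (act g).left.appTop = α := by
    rw [Category.assoc, ← Scheme.Hom.comp_appTop, Over.w]
  have : SMulCommClass G k A := ⟨fun g c a => by
    change (act g).left.appTop.hom (α.hom c * a) = α.hom c * (act g).left.appTop.hom a
    rw [map_mul]
    congr 1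
    exact congr($(hα g) c)⟩
  have hft : Algebra.FiniteType k A := by
    have h := HasRingHomProperty.appTop (P := @LocallyOfFiniteType) V.hom inferInstance
    exact h.comp (RingHom.FiniteType.of_surjective _
      (Scheme.ΓSpecIso (.of k)).commRingCatIsoToRingEquiv.symm.surjective)
  let B := FixedPoints.subalgebra k A G
  have : Algebra.IsInvariant B A G := ⟨fun a ha => ⟨⟨a, ha⟩, rfl⟩⟩
  have hB : Algebra.FiniteType k B :=
    finiteType_of_isInvariant (A := A) (G := G) Subtype.val_injective
  let β : CommRingCat.of B ⟶ A := CommRingCat.ofHom B.val.toRingHom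
  let κ : CommRingCat.of k ⟶ CommRingCat.of B := CommRingCat.ofHom (algebraMap k B)
  have hκ : κ ≫ β = α := rfl
  have hβ (g : G) : β ≫ (act g).left.appTop = β := by
    ext b
    exact b.2 g
  let Q : FTScheme k := ⟨Over.mk (Spec.map κ),
    (HasRingHomProperty.Spec_iff (P := @LocallyOfFiniteType)).mpr
      (RingHom.finiteType_algebraMap.mpr hB), by dsimp; infer_instance⟩
  let π : V ⟶ Q.obj := Over.homMk (V.left.toSpecΓ ≫ Spec.map β) (by
    change (V.left.toSpecΓ ≫ Spec.map β) ≫ Spec.map κ = V.hom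
    rw [Category.assoc, ← Spec.map_comp, hκ, Spec.map_comp, ← Scheme.toSpecΓ_naturality_assoc,
      ← SpecMap_ΓSpecIso_hom, ← Spec.map_comp, Iso.inv_hom_id, Spec.map_id, Category.comp_id])
  have hπ : π.left.appTop = (Scheme.ΓSpecIso (.of B)).hom ≫ β := by
    change (V.left.toSpecΓ ≫ Spec.map β).appTop = _
    rw [Scheme.Hom.comp_appTop, Scheme.toSpecΓ_appTop, Scheme.ΓSpecIso_naturality]
  have : IsAffine Q.obj.left := inferInstanceAs (IsAffine (Spec _))
  refine ⟨Q, π, isGeomQuotient_of_isAffine (fun g => ?_) ?_ (fun a ha => ?_) h₁' hmul'⟩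
  · change (act g).left ≫ V.left.toSpecΓ ≫ Spec.map β = V.left.toSpecΓ ≫ Spec.map β
    rw [Scheme.toSpecΓ_naturality_assoc, ← Spec.map_comp, hβ]
  · rw [hπ]
    exact Subtype.val_injective.comp
      (Scheme.ΓSpecIso (.of B)).commRingCatIsoToRingEquiv.injective
  · rw [hπ]
    exact ⟨(Scheme.ΓSpecIso (.of B)).inv ⟨a, ha⟩,
      congr($((Scheme.ΓSpecIso (.of B)).inv_hom_id_assoc β) ⟨a, ha⟩)⟩

/-! ### Existence of stratified quotients -/

lemma dense_iInter_of_finite {ι S : Type*} [Finite ι] [TopologicalSpace S] {f : ι → Set S}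
    (ho : ∀ i, IsOpen (f i)) (hd : ∀ i, Dense (f i)) : Dense (⋂ i, f i) := by
  classical
  cases nonempty_fintype ι
  suffices ∀ s : Finset ι, Dense (⋂ i ∈ s, f i) by simpa using this Finset.univ
  intro s
  induction s using Finset.induction_on with
  | empty => simp
  | insert a s _ ih =>
    rw [Finset.set_biInter_insert]
    exact (hd a).inter_of_isOpen_left ih (ho a)

/-- Generically, a constructible set is an affine open set: there is a dense open set `U ∪ N`
whose intersection with `E` is the affine open set `U`.  It is chosen maximal, and is dense because
a disjoint union of affine open sets is affine. -/
lemma exists_isAffineOpen_union_dense {S : Scheme.{u}} [IsNoetherian S] {E : Set S}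
    (hE : Topology.IsConstructible E) : ∃ U N : S.Opens, IsAffineOpen U ∧ (U : Set S) ⊆ E ∧
      Disjoint (N : Set S) E ∧ Dense ((U : Set S) ∪ N) := by
  let P : Set S.Opens := {O | ∃ U N : S.Opens, IsAffineOpen U ∧ (U : Set S) ⊆ E ∧
      Disjoint (N : Set S) E ∧ O = U ⊔ N}
  obtain ⟨O, ⟨U, N, hU, hUE, hN, rfl⟩, hmax⟩ := WellFounded.has_min
    (wellFounded_gt (α := S.Opens)) P
    ⟨⊥, ⊥, ⊥, isAffineOpen_bot S, by simp, by simp, by simp⟩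
  refine ⟨U, N, hU, hUE, hN, ?_⟩
  by_contra hd
  have hne : (closure ((U : Set S) ∪ N))ᶜ.Nonempty := by
    rw [Set.nonempty_compl]
    exact fun h => hd (dense_iff_closure_eq.mpr h)
  obtain ⟨V, hV, ⟨v, hv⟩, hVc, h⟩ := exists_isOpen_subset_or_disjoint hE _
    isClosed_closure.isOpen_compl hne
  obtain ⟨_, ⟨V', hV', rfl⟩, hvV', hV'V⟩ :=
    S.isBasis_affineOpens.exists_subset_of_mem_open hv hV
  have hvO : v ∉ U ⊔ N := fun h => hVc hv (subset_closure h)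
  have hlt {O : S.Opens} (h₁ : U ⊔ N ≤ O) (h₂ : v ∈ O) : U ⊔ N < O :=
    lt_of_le_of_ne h₁ fun h => hvO (h ▸ h₂)
  rcases h with h | h
  · refine hmax ((U ⊔ V') ⊔ N) ⟨U ⊔ V', N, hU.sup_of_disjoint hV' ?_, ?_, hN, rfl⟩
      (hlt (sup_le_sup_right le_sup_left _) (.inl (.inr hvV')))
    · rw [← TopologicalSpace.Opens.coe_disjoint, Set.disjoint_right]
      exact fun x hx hxU => hVc (hV'V hx) (subset_closure (.inl hxU))
    · rw [TopologicalSpace.Opens.coe_sup]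
      exact Set.union_subset hUE (hV'V.trans h)
  · refine hmax (U ⊔ (N ⊔ V')) ⟨U, N ⊔ V', hU, hUE, ?_, rfl⟩
      (hlt (sup_le_sup_left le_sup_left _) (.inr (.inr hvV')))
    rw [TopologicalSpace.Opens.coe_sup]
    exact hN.union_left (h.mono_left hV'V)

section Existence

variable {k : Type u} [Field k] {X : FTScheme k} {n : ℕ}

/-- The set `S` underlies a stable locally closed subscheme of `Xⁿ` which has a quotient. -/
def IsStratum (X : FTScheme k) (n : ℕ) (S : Set (power X n).left) : Prop :=
  ∃ (T : Over (Spec (.of k))) (emb : T ⟶ power X n)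
    (act : Equiv.Perm (Fin n) → (T ⟶ T)) (Q : FTScheme k) (π : T ⟶ Q.obj),
    IsImmersion emb.left ∧ Set.range emb.left = S ∧
    (∀ σ, act σ ≫ emb = emb ≫ permute X n σ) ∧ IsGeomQuotient (fun σ => (act σ).left) π.left

lemma nonempty_stratifiedQuotient {E : Set (power X n).left} {F : Set (Set (power X n).left)}
    (hF : F.Finite) (hFs : ∀ S ∈ F, IsStratum X n S) (hd : F.PairwiseDisjoint id)
    (hE : ⋃₀ F = E) : Nonempty (StratifiedQuotient X n E) := by
  have := hF.to_subtype
  let e := (Finite.equivFin F).symm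
  choose T emb act Q π h₁ h₂ h₃ h₄ using fun i => hFs (e i).1 (e i).2
  refine ⟨⟨Nat.card F, T, emb, h₁, fun i j hij => ?_, ?_, act, h₃, Q, π, h₄⟩⟩
  · change Disjoint (Set.range _) (Set.range _)
    rw [h₂, h₂]
    exact hd (e i).2 (e j).2 fun h => hij (e.injective (Subtype.ext h))
  · simp only [h₂]
    rw [← hE, Set.sUnion_eq_iUnion]
    exact e.surjective.iUnion_comp fun S : F => S.1

lemma permute_one : permute X n 1 = 𝟙 _ :=
  power_hom_ext fun i => by rw [permute_coord, Category.id_comp]; rfl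

lemma permute_comp (σ τ : Equiv.Perm (Fin n)) :
    permute X n σ ≫ permute X n τ = permute X n (σ * τ) :=
  power_hom_ext fun i => by rw [Category.assoc, permute_coord, permute_coord, permute_coord]; rfl

/-- A stable subscheme inherits the action of the symmetric group. -/
lemma exists_action {T : Scheme.{u}} [IsReduced T] (i : T ⟶ (power X n).left) [IsImmersion i]
    (h : ∀ σ, Set.range (i ≫ (permute X n σ).left) ⊆ Set.range i) :
    ∃ ρ : Equiv.Perm (Fin n) → (T ⟶ T), (∀ σ, ρ σ ≫ i = i ≫ (permute X n σ).left) ∧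
      ρ 1 = 𝟙 T ∧ ∀ σ τ, ρ σ ≫ ρ τ = ρ (σ * τ) := by
  choose ρ hρ using fun σ => exists_lift_of_isImmersion (i ≫ (permute X n σ).left) i (h σ)
  refine ⟨ρ, hρ, ?_, fun σ τ => ?_⟩
  · rw [← cancel_mono i, hρ, permute_one]
    exact (Category.comp_id i).trans (Category.id_comp i).symm
  · rw [← cancel_mono i, Category.assoc, hρ, ← Category.assoc, hρ, Category.assoc,
      ← Over.comp_left, permute_comp, hρ]

/-- A stable affine subscheme is a stratum. -/
lemma isStratum_of_isAffine {T : Scheme.{u}} [IsReduced T] [IsAffine T]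
    (i : T ⟶ (power X n).left) [IsImmersion i]
    (h : ∀ σ, Set.range (i ≫ (permute X n σ).left) ⊆ Set.range i) :
    IsStratum X n (Set.range i) := by
  obtain ⟨ρ, hρ, h₁, hmul⟩ := exists_action i h
  let V : Over (Spec (.of k)) := Over.mk (i ≫ (power X n).hom)
  let emb : V ⟶ power X n := Over.homMk i rfl
  let act (σ : Equiv.Perm (Fin n)) : V ⟶ V := Over.homMk (ρ σ) (by
    change ρ σ ≫ i ≫ (power X n).hom = i ≫ (power X n).hom
    rw [← Category.assoc, hρ, Category.assoc, Over.w])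
  have : IsAffine V.left := ‹IsAffine T›
  have : LocallyOfFiniteType V.hom :=
    inferInstanceAs (LocallyOfFiniteType (i ≫ (power X n).hom))
  obtain ⟨Q, π, hπ⟩ := exists_isGeomQuotient_of_isAffine act (Over.OverMorphism.ext h₁)
    fun σ τ => Over.OverMorphism.ext (hmul σ τ)
  exact ⟨V, emb, act, Q, π, ‹IsImmersion i›, rfl, fun σ => Over.OverMorphism.ext (hρ σ), hπ⟩

/-- Noetherian induction: a stable constructible set is generically a stratum. -/
lemma exists_finite_strata [IsSeparated X.obj.hom] {E : Set (power X n).left}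
    (hE : Topology.IsConstructible E)
    (hs : ∀ σ, (permute X n σ).left ⁻¹' E = E)
    (Z : TopologicalSpace.Closeds (power X n).left) :
    (∀ σ, ∀ z ∈ Z, (permute X n σ).left z ∈ Z) →
    ∃ F : Set (Set (power X n).left), F.Finite ∧ (∀ S ∈ F, IsStratum X n S) ∧
      F.PairwiseDisjoint id ∧ ⋃₀ F = E ∩ Z := by
  induction Z using WellFoundedLT.induction with
  | ind Z ih =>
  intro hZ
  rcases (Z : Set (power X n).left).eq_empty_or_nonempty with hZ0 | ⟨z, hz⟩
  · exact ⟨∅, Set.finite_empty, by simp, by simp, by simp [hZ0]⟩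
  let i := redSubι (power X n).left Z
  have hi : Set.range i = Z := range_redSubι _ _
  have hinj : Function.Injective i := i.isClosedEmbedding.injective
  have : IsNoetherian (redSub (power X n).left Z) :=
    { toIsLocallyNoetherian := LocallyOfFiniteType.isLocallyNoetherian i
      toCompactSpace := i.isClosedEmbedding.compactSpace }
  have : (redSub (power X n).left Z).IsSeparated := by
    have h : IsSeparated (i ≫ (power X n).hom) := inferInstance
    exact IsSeparated.hasAffineProperty.iff_of_isAffine.mp h
  obtain ⟨ρ, hρ, h₁, hmul⟩ := exists_action i (by
    rintro σ _ ⟨x, rfl⟩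
    rw [hi, Scheme.Hom.comp_apply]
    exact hZ σ _ (hi.le ⟨x, rfl⟩))
  have hiso (σ) : IsIso (ρ σ) := ⟨ρ σ⁻¹, by rw [hmul, mul_inv_cancel, h₁],
    by rw [hmul, inv_mul_cancel, h₁]⟩
  have hρi (σ) (x) : i (ρ σ x) = (permute X n σ).left (i x) := by
    rw [← Scheme.Hom.comp_apply, hρ, Scheme.Hom.comp_apply]
  have hρρ (σ τ) (x) : ρ τ (ρ σ x) = ρ (σ * τ) x := by
    rw [← Scheme.Hom.comp_apply, hmul]
  have hEρ (σ) (x) : i (ρ σ x) ∈ E ↔ i x ∈ E := by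
    rw [hρi, ← Set.mem_preimage, hs]
  obtain ⟨U, N, hU, hUE, hN, hd⟩ := exists_isAffineOpen_union_dense
    (isConstructible_preimage i.continuous hE)
  -- the largest stable subsets of `U` and of `U ∪ N`
  let U' := ⨅ σ, ρ σ ⁻¹ᵁ U
  have hmemU' (x) : x ∈ U' ↔ ∀ σ, ρ σ x ∈ U := by
    rw [← SetLike.mem_coe, TopologicalSpace.Opens.coe_iInf]
    exact Set.mem_iInter
  have hU' : IsAffineOpen U' := IsAffineOpen.iInf fun σ => hU.preimage_of_isIso (ρ σ)
  let O : Set (redSub (power X n).left Z) := ⋂ σ, ρ σ ⁻¹' (U ∪ N)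
  have hO : IsOpen O := isOpen_iInter_of_finite fun σ =>
    (U.isOpen.union N.isOpen).preimage (ρ σ).continuous
  have hOd : Dense O := dense_iInter_of_finite
    (fun σ => (U.isOpen.union N.isOpen).preimage (ρ σ).continuous)
    fun σ => hd.preimage (ρ σ).isOpenEmbedding.isOpenMap
  have hOρ (σ) (x) : ρ σ x ∈ O → x ∈ O := by
    intro h
    refine Set.mem_iInter.mpr fun τ => ?_
    have := Set.mem_iInter.mp h (σ⁻¹ * τ)
    rwa [Set.mem_preimage, hρρ, mul_inv_cancel_left] at this
  have hOE : i ⁻¹' E ∩ O = U' := by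
    ext x
    rw [SetLike.mem_coe, hmemU']
    constructor
    · rintro ⟨hxE, hxO⟩ σ
      refine (Set.mem_iInter.mp hxO σ).resolve_right fun h => ?_
      exact Set.disjoint_left.mp hN h ((hEρ σ x).mpr hxE)
    · intro h
      refine ⟨(hEρ 1 x).mp (hUE (h 1)), Set.mem_iInter.mpr fun σ => .inl (h σ)⟩
  let Z' : TopologicalSpace.Closeds (power X n).left :=
    ⟨i '' Oᶜ, i.isClosedEmbedding.isClosedMap _ hO.isClosed_compl⟩
  have hZZ' : (Z : Set (power X n).left) = i '' O ∪ Z' := by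
    change _ = i '' O ∪ i '' Oᶜ
    rw [← Set.image_union, Set.union_compl_self, Set.image_univ, hi]
  have hdisj : Disjoint (i '' O) Z' := by
    rw [Set.disjoint_left]
    rintro _ ⟨x, hx, rfl⟩ ⟨y, hy, hyx⟩
    exact hy (hinj hyx ▸ hx)
  obtain ⟨F, hF, hFs, hFd, hFE⟩ := ih Z' (by
    obtain ⟨z', -⟩ := hi.ge hz
    obtain ⟨v, hv⟩ := hOd.nonempty_iff.mpr ⟨z'⟩
    refine lt_of_le_of_ne ?_ fun h0 => ?_
    · rw [← SetLike.coe_subset_coe, hZZ']; exact Set.subset_union_right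
    · exact Set.disjoint_left.mp hdisj ⟨v, hv, rfl⟩
        ((SetLike.ext_iff.mp h0 (i v)).mpr (hi.le ⟨v, rfl⟩))) (by
    rintro σ _ ⟨x, hx, rfl⟩
    exact ⟨ρ σ x, fun h => hx (hOρ σ x h), hρi σ x⟩)
  have hE' : E ∩ Z = i '' U' ∪ ⋃₀ F := by
    rw [hFE, hZZ', Set.inter_union_distrib_left, ← hOE, Set.image_preimage_inter]
  refine ⟨insert (i '' U') F, hF.insert _, ?_, ?_, ?_⟩
  · rintro S (rfl | hS)
    · have hr : Set.range (U'.ι ≫ i) = i '' U' := by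
        rw [Scheme.Hom.comp_base, TopCat.coe_comp, Set.range_comp, Scheme.Opens.range_ι]
      have : IsAffine U' := hU'
      rw [← hr]
      refine isStratum_of_isAffine _ fun σ => ?_
      rw [hr]
      rintro _ ⟨x, rfl⟩
      refine ⟨ρ σ (U'.ι x), (hmemU' _).mpr fun τ => ?_, ?_⟩
      · rw [hρρ]
        exact (hmemU' _).mp x.2 _
      · rw [hρi, Scheme.Hom.comp_apply, Scheme.Hom.comp_apply]
    · exact hFs S hS
  · refine hFd.insert fun S hS _ => ?_
    refine (hdisj.mono (Set.image_mono (hOE ▸ Set.inter_subset_right)) ?_)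
    exact (Set.subset_sUnion_of_mem hS).trans (hFE.le.trans Set.inter_subset_right)
  · rw [Set.sUnion_insert, hE']

/-- Stable constructible subsets of the powers of a separated scheme have stratified quotients. -/
theorem nonempty_stratifiedQuotient_of_isConstructible [IsSeparated X.obj.hom]
    {E : Set (power X n).left} (hE : Topology.IsConstructible E)
    (hs : ∀ σ, (permute X n σ).left ⁻¹' E = E) : Nonempty (StratifiedQuotient X n E) := by
  obtain ⟨F, hF, hFs, hFd, hFE⟩ := exists_finite_strata hE hs ⊤ fun _ _ _ => trivial
  exact nonempty_stratifiedQuotient hF hFs hFd (by simpa using hFE)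

end Existence

/-! ### Multiplicities -/

/-- The multiset of the multiplicities of the distinct members of a multiset. -/
def counts {α : Type*} (M : Multiset α) : Multiset ℕ := by
  classical exact M.dedup.map M.count

section Configurations

variable {k : Type u} [Field k] {X : FTScheme k} {n : ℕ}

/-- Whether two coordinates of a point of `Xⁿ` coincide may be tested on any geometric point over
it, as field extensions are epimorphisms of schemes. -/
lemma sameCoord_iff {K : Type u} [Field K] {s : Spec (.of K) ⟶ Spec (.of k)}
    (t : Over.mk s ⟶ power X n) (i j : Fin n) :
    SameCoord X n (t.left (IsLocalRing.closedPoint K)) i j ↔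
      t ≫ coord X n i = t ≫ coord X n j := by
  obtain ⟨f, hf⟩ : ∃ f : (power X n).left.residueField (t.left (IsLocalRing.closedPoint K)) ⟶ .of K,
      Spec.map f ≫ (power X n).left.fromSpecResidueField _ = t.left :=
    ⟨_, Scheme.descResidueField_stalkClosedPointTo_fromSpecResidueField K _ t.left⟩
  have : Epi (Spec.map f) := epi_SpecMap_of_field f.hom
  rw [SameCoord, ← cancel_epi (Spec.map f), ← Category.assoc, ← Category.assoc, hf]
  exact ⟨fun h => Over.OverMorphism.ext h, fun h => congr(Over.Hom.left $h)⟩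

/-- The multiplicities of a point of `Xⁿ` are those of the cycle of any geometric point over it. -/
lemma multiplicities_eq {K : Type u} [Field K] {s : Spec (.of K) ⟶ Spec (.of k)}
    (t : Over.mk s ⟶ power X n) :
    multiplicities X n (t.left (IsLocalRing.closedPoint K)) = counts (cycle (coord X n) t) := by
  classical
  let f : Fin n → (Over.mk s ⟶ X.obj) := fun i => t ≫ coord X n i
  let g : (Over.mk s ⟶ X.obj) → Finset (Fin n) := fun a => Finset.univ.filter fun j => a = f j
  have hg : Set.InjOn g (Finset.univ.image f : Finset _) := by
    intro a ha b _ hab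
    obtain ⟨i, -, rfl⟩ := Finset.mem_image.mp (Finset.mem_coe.mp ha)
    have : i ∈ g b := hab ▸ Finset.mem_filter.mpr ⟨Finset.mem_univ i, rfl⟩
    exact (Finset.mem_filter.mp this).2.symm
  have h₁ : (Finset.univ.image fun i : Fin n => Finset.univ.filter fun j : Fin n =>
      SameCoord X n (t.left (IsLocalRing.closedPoint K)) i j) = (Finset.univ.image f).image g := by
    rw [Finset.image_image]
    refine Finset.image_congr fun i _ => ?_
    ext j
    simp only [Finset.mem_filter, sameCoord_iff, Function.comp_apply, g, f]
  rw [multiplicities, h₁, Finset.image_val_of_injOn hg, Multiset.map_map, counts]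
  change Multiset.map _ (Finset.univ.val.map f).dedup = Multiset.map _ (Finset.univ.val.map f).dedup
  refine Multiset.map_congr rfl fun a _ => ?_
  rw [cycle, Multiset.count_map]
  rfl

variable (X n) in
/-- All cycles of degree `n`. -/
def fullFamily : CycleFamily X := fun _ _ _ _ => {M | M.card = n}

variable (X) in
/-- The cycles with multiplicities `lam`. -/
def countsFamily (lam : Multiset ℕ) : CycleFamily X := fun _ _ _ _ => {M | counts M = lam}

lemma card_eq_sum_counts {α : Type*} (M : Multiset α) : (counts M).sum = M.card := by
  classical
  conv_rhs => rw [← Multiset.toFinset_sum_count_eq]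
  rfl

lemma exists_cycle_eq {S : Over (Spec (.of k))} (M : Multiset (S ⟶ X.obj)) (h : M.card = n) :
    ∃ t : S ⟶ power X n, cycle (coord X n) t = M := by
  subst h
  induction M using Quotient.inductionOn with
  | h l =>
    refine ⟨Pi.lift fun i : Fin l.length => l.get i, ?_⟩
    have h (i : Fin l.length) :
        (Pi.lift fun i : Fin l.length => l.get i) ≫ coord X l.length i = l.get i := Pi.lift_π _ _
    change Finset.univ.val.map (fun i => _ ≫ coord X l.length i) = (l : Multiset (S ⟶ X.obj))
    refine (Multiset.map_congr rfl fun i _ => h i).trans ?_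
    rw [Fin.univ_val_map, List.ofFn_get]

lemma card_cycle {S : Over (Spec (.of k))} (t : S ⟶ power X n) :
    (cycle (coord X n) t).card = n := by
  simp [cycle]

lemma pointFamily_univ : pointFamily (Set.univ : Set (power X n).left) = fullFamily X n := by
  funext K _ _ s
  ext M
  refine ⟨?_, fun h => ?_⟩
  · rintro ⟨t, -, rfl⟩
    exact card_cycle t
  · obtain ⟨t, ht⟩ := exists_cycle_eq M h
    exact ⟨t, trivial, ht⟩

lemma pointFamily_confLocus (lam : Multiset ℕ) :
    pointFamily (confLocus X lam) = countsFamily X lam := by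
  funext K _ _ s
  ext M
  refine ⟨?_, fun h => ?_⟩
  · rintro ⟨t, ht, rfl⟩
    exact (multiplicities_eq t).symm.trans ht
  · obtain ⟨t, rfl⟩ := exists_cycle_eq (n := lam.sum) M (by rw [← card_eq_sum_counts, h])
    exact ⟨t, (multiplicities_eq t).trans h, rfl⟩

lemma preimage_permute_confLocus (lam : Multiset ℕ) (σ : Equiv.Perm (Fin lam.sum)) :
    (permute X lam.sum σ).left ⁻¹' confLocus X lam = confLocus X lam := by
  ext x
  obtain ⟨K, _, _, s, t, rfl⟩ := exists_geometric_point x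
  have h : multiplicities X lam.sum
        ((permute X lam.sum σ).left (t.left (IsLocalRing.closedPoint K))) =
      multiplicities X lam.sum (t.left (IsLocalRing.closedPoint K)) := by
    refine (multiplicities_eq (t ≫ permute X lam.sum σ)).trans ?_
    rw [multiplicities_eq, (cycle_coord_eq_iff _ t).mpr ⟨σ, rfl⟩]
  rw [Set.mem_preimage, confLocus, Set.mem_ofPred_eq, Set.mem_ofPred_eq, h]

/-- Coincidence of two coordinates is a closed condition on a separated scheme. -/
lemma isClosed_sameCoord [IsSeparated X.obj.hom] (i j : Fin n) :
    IsClosed {x | SameCoord X n x i j} := by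
  have h : {x | SameCoord X n x i j} =
      Set.range (equalizer.ι (coord X n i) (coord X n j)).left := by
    ext x
    constructor
    · intro hx
      obtain ⟨K, _, _, s, t, rfl⟩ := exists_geometric_point x
      have ht := (sameCoord_iff t i j).mp hx
      exact ⟨(equalizer.lift t ht).left (IsLocalRing.closedPoint K),
        congr(Over.Hom.left $(equalizer.lift_ι t ht) (IsLocalRing.closedPoint K))⟩
    · rintro ⟨y, rfl⟩
      obtain ⟨K, _, _, s, t, rfl⟩ := exists_geometric_point y
      refine (sameCoord_iff (t ≫ equalizer.ι _ _) i j).mpr ?_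
      rw [Category.assoc, equalizer.condition, Category.assoc]
  rw [h]
  exact (equalizer.ι (coord X n i) (coord X n j)).left.isClosedEmbedding.isClosed_range

lemma isConstructible_confLocus [IsSeparated X.obj.hom] (lam : Multiset ℕ) :
    Topology.IsConstructible (confLocus X lam) := by
  classical
  -- `multiplicities` depends on the relation `SameCoord` only
  let m (r : Fin lam.sum → Fin lam.sum → Prop) : Multiset ℕ :=
    (Finset.univ.image fun i => Finset.univ.filter fun j => r i j).val.map Finset.card
  have hm (x : (power X lam.sum).left) :
      multiplicities X lam.sum x = m (SameCoord X lam.sum x) := rfl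
  have h : confLocus X lam = ⋃ r : {r // m r = lam}, ⋂ i, ⋂ j,
      {x | SameCoord X lam.sum x i j ↔ r.1 i j} := by
    ext x
    simp only [Set.mem_iUnion, Set.mem_iInter, Set.mem_ofPred_eq]
    constructor
    · intro hx
      exact ⟨⟨SameCoord X lam.sum x, (hm x).symm.trans hx⟩, fun i j => Iff.rfl⟩
    · rintro ⟨⟨r, hr⟩, hx⟩
      obtain rfl : SameCoord X lam.sum x = r := by
        funext i j
        exact propext (hx i j)
      exact (hm x).trans hr
  rw [h]
  refine .iUnion fun r => .iInter fun i => .iInter fun j => ?_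
  have hc := isConstructible_of_isClosed (isClosed_sameCoord (X := X) i j)
  by_cases hr : r.1 i j
  · simpa [hr] using hc
  · simp only [hr, iff_false]
    exact hc.compl

end Configurations

/-! ### The measure of a family of cycles -/

section Measure

variable {k : Type u} [Field k] {X : FTScheme k} {R : Type v} [CommRing R] {φ : K0Var k →+* R}
  {n : ℕ}

/-- The set `E` of cycles of degree `n` is parametrised by a finite type scheme of measure `r`.  For
the measures `φ` of the theorem, `r` is unique (`HasMeasure.unique`). -/
def HasMeasure (φ : K0Var k →+* R) (n : ℕ) (E : CycleFamily X) (r : R) : Prop :=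
  ∃ Q, Nonempty (CycleQuotient (Fin n) E Q) ∧ φ (cls Q) = r

lemma HasMeasure.unique (hφ : CharZero k ∨ InvariantUnderUnivHomeo φ) {m : ℕ} {E : CycleFamily X}
    {r r' : R} (h : HasMeasure φ n E r) (h' : HasMeasure φ m E r') : r = r' := by
  obtain ⟨Q, ⟨P⟩, rfl⟩ := h
  obtain ⟨Q', ⟨P'⟩, rfl⟩ := h'
  exact P.map_cls_eq hφ P'

lemma HasMeasure.sum {κ : Type} [Fintype κ] {E : κ → CycleFamily X} {r : κ → R}
    (h : ∀ j, HasMeasure φ n (E j) (r j)) (E' : CycleFamily X)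
    (hE : ∀ (K : Type u) [Field K] [IsAlgClosed K] (s : Spec (.of K) ⟶ Spec (.of k))
      (M : Multiset (Over.mk s ⟶ X.obj)), M ∈ E' K s ↔ ∃ j, M ∈ E j K s)
    (hd : ∀ (K : Type u) [Field K] [IsAlgClosed K] (s : Spec (.of K) ⟶ Spec (.of k))
      (M : Multiset (Over.mk s ⟶ X.obj)) (i j : κ), M ∈ E i K s → M ∈ E j K s → i = j) :
    HasMeasure φ n E' (∑ j, r j) := by
  choose Q P hQ using h
  refine ⟨FTScheme.sum Q, ⟨.sum (fun j => (P j).some) E' hE hd⟩, ?_⟩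
  rw [cls_sum, map_sum]
  exact Finset.sum_congr rfl fun j _ => hQ j

/-- The measure of `{M + a N}` is the product of the measures of the sets of the `M` and the `N`. -/
lemma HasMeasure.addSMul {E E' : CycleFamily X} {m N : ℕ} {r r' : R} (h : HasMeasure φ n E r)
    (h' : HasMeasure φ m E' r') (a : ℕ) (hN : n + a * m = N)
    (hE : ∀ (K : Type u) [Field K] [IsAlgClosed K] (s : Spec (.of K) ⟶ Spec (.of k)),
      ∀ M ∈ E K s, ∀ N ∈ E' K s, ∀ M' ∈ E K s, ∀ N' ∈ E' K s,
        M + a • N = M' + a • N' → M = M' ∧ N = N') :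
    HasMeasure φ N (E.addSMul E' a) (r * r') := by
  subst hN
  obtain ⟨Q, ⟨P⟩, rfl⟩ := h
  obtain ⟨Q', ⟨P'⟩, rfl⟩ := h'
  refine ⟨Q.prod Q', ⟨(P.prod P' a hE).reindex ?_⟩, by rw [cls_prod_eq, map_mul]⟩
  exact (finSumFinEquiv.symm.trans (Equiv.sumCongr (.refl _) finProdFinEquiv.symm))

lemma HasMeasure.cast {m : ℕ} (h : n = m) {E : CycleFamily X} {r : R} (hE : HasMeasure φ n E r) :
    HasMeasure φ m E r := h ▸ hE

lemma hasMeasure_of_isImageClass {E : Set (power X n).left} {c : K0Var k}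
    (h : IsImageClass X n E c) : HasMeasure φ n (pointFamily E) (φ c) := by
  obtain ⟨s, rfl⟩ := h
  exact ⟨FTScheme.sum s.Q, s.nonempty_cycleQuotient, by rw [cls_sum]⟩

variable [IsSeparated X.obj.hom]

variable (X n) in
lemma exists_isImageClass_univ : ∃ c, IsImageClass X n Set.univ c := by
  obtain ⟨s⟩ := nonempty_stratifiedQuotient_of_isConstructible (X := X) (n := n) .univ
    fun _ => Set.preimage_univ
  exact ⟨_, s, rfl⟩

variable (X) in
lemma exists_isImageClass_confLocus (lam : Multiset ℕ) :
    ∃ c, IsImageClass X lam.sum (confLocus X lam) c := by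
  obtain ⟨s⟩ := nonempty_stratifiedQuotient_of_isConstructible (isConstructible_confLocus lam)
    (preimage_permute_confLocus (X := X) lam)
  exact ⟨_, s, rfl⟩

variable (X n) in
lemma hasMeasure_symClass : HasMeasure φ n (fullFamily X n) (φ (symClass X n)) := by
  rw [← pointFamily_univ]
  exact hasMeasure_of_isImageClass (Classical.epsilon_spec (exists_isImageClass_univ X n))

variable (X) in
lemma hasMeasure_wClass (lam : Multiset ℕ) :
    HasMeasure φ lam.sum (countsFamily X lam) (φ (wClass X lam)) := by
  rw [← pointFamily_confLocus]
  exact hasMeasure_of_isImageClass (Classical.epsilon_spec (exists_isImageClass_confLocus X lam))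

omit [IsSeparated X.obj.hom] in
variable (X) in
/-- There is only one cycle of degree zero, and it is parametrised by `Spec k`. -/
lemma hasMeasure_fullFamily_zero : HasMeasure φ 0 (fullFamily X 0) 1 := by
  let P : FTScheme k := ⟨Over.mk (𝟙 _), by dsimp; infer_instance, by dsimp; infer_instance⟩
  have : IsIso P.obj.hom := inferInstanceAs (IsIso (𝟙 _))
  have hP {S : Over (Spec (.of k))} (t t' : S ⟶ P.obj) : t = t' := Over.mkIdTerminal.hom_ext t t'
  refine ⟨P, ⟨⟨P, fun i => i.elim0, 𝟙 _, fun K _ _ s q => ⟨q, hP _ _⟩, fun K _ _ s t => rfl,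
    fun K _ _ s M hM => ⟨Over.mkIdTerminal.from _, ?_⟩, fun K _ _ s t t' => ?_⟩⟩,
    by rw [cls_point, map_one]⟩
  · rw [Multiset.card_eq_zero.mp hM]; rfl
  · exact iff_of_true (hP _ _) rfl

end Measure

/-! ### Combinatorics of multiplicities and of partitions -/

section Multisets

variable {α : Type*} {M : Multiset α}

open Classical in
lemma mem_counts {c : ℕ} : c ∈ counts M ↔ ∃ x ∈ M, M.count x = c := by
  simp [counts]

lemma pos_of_mem_counts {c : ℕ} (h : c ∈ counts M) : 0 < c := by
  classical
  obtain ⟨x, hx, rfl⟩ := mem_counts.mp h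
  exact Multiset.count_pos.mpr hx

open Classical in
lemma forall_counts_lt_iff {a : ℕ} (ha : 0 < a) :
    (∀ c ∈ counts M, c < a) ↔ ∀ x, M.count x < a := by
  refine ⟨fun h x => ?_, fun h c hc => ?_⟩
  · by_cases hx : x ∈ M
    · exact h _ (mem_counts.mpr ⟨x, hx, rfl⟩)
    · rwa [Multiset.count_eq_zero_of_notMem hx]
  · obtain ⟨x, -, rfl⟩ := mem_counts.mp hc
    exact h x

/-- The partition of the degree of a multiset given by the multiplicities. -/
def countsPartition {n : ℕ} (M : Multiset α) (h : M.card = n) : Nat.Partition n where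
  parts := counts M
  parts_pos := pos_of_mem_counts
  parts_sum := (card_eq_sum_counts M).trans h

open Classical in
/-- Division with remainder by `a` of all multiplicities. -/
lemma exists_eq_add_smul {a : ℕ} (ha : 0 < a) (M : Multiset α) :
    ∃ M₀ M₁ : Multiset α, (∀ x, M₀.count x < a) ∧ M = M₀ + a • M₁ := by
  let M₁ : Multiset α := Finsupp.toMultiset (M.toFinsupp.mapRange (· / a) (Nat.zero_div a))
  let M₀ : Multiset α := Finsupp.toMultiset (M.toFinsupp.mapRange (· % a) (Nat.zero_mod a))
  have h₁ (x) : M₁.count x = M.count x / a := by simp [M₁, Finsupp.count_toMultiset]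
  have h₀ (x) : M₀.count x = M.count x % a := by simp [M₀, Finsupp.count_toMultiset]
  refine ⟨M₀, M₁, fun x => h₀ x ▸ Nat.mod_lt _ ha, ?_⟩
  ext x
  rw [Multiset.count_add, Multiset.count_nsmul, h₀, h₁, Nat.mod_add_div]

open Classical in
/-- Uniqueness of division with remainder by `a` of all multiplicities. -/
lemma add_smul_inj {a : ℕ} (ha : 0 < a) {M N M' N' : Multiset α} (hM : ∀ x, M.count x < a)
    (hM' : ∀ x, M'.count x < a) (h : M + a • N = M' + a • N') : M = M' ∧ N = N' := by
  have key (x) : M.count x = M'.count x ∧ N.count x = N'.count x := by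
    have := congr(Multiset.count x $h)
    rw [Multiset.count_add, Multiset.count_nsmul, Multiset.count_add, Multiset.count_nsmul] at this
    have h₁ := congr($this % a)
    have h₂ := congr($this / a)
    rw [Nat.add_mul_mod_self_left, Nat.add_mul_mod_self_left, Nat.mod_eq_of_lt (hM x),
      Nat.mod_eq_of_lt (hM' x)] at h₁
    rw [Nat.add_mul_div_left _ _ ha, Nat.add_mul_div_left _ _ ha, Nat.div_eq_of_lt (hM x),
      Nat.div_eq_of_lt (hM' x), zero_add, zero_add] at h₂
    exact ⟨h₁, h₂⟩
  exact ⟨Multiset.ext.mpr fun x => (key x).1, Multiset.ext.mpr fun x => (key x).2⟩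

lemma counts_eq_replicate_iff {n : ℕ} :
    counts M = Multiset.replicate n 1 ↔ M.card = n ∧ ∀ c ∈ counts M, c < 2 := by
  rw [Multiset.eq_replicate, ← card_eq_sum_counts M]
  have h : (∀ c ∈ counts M, c < 2) ↔ ∀ c ∈ counts M, c = 1 :=
    forall₂_congr fun c hc => by have := pos_of_mem_counts hc; omega
  rw [h]
  refine and_congr_left fun h => ?_
  have hs : (counts M).sum = (counts M).card := by
    conv_lhs => rw [Multiset.eq_replicate_card.mpr h]
    simp
  rw [hs]

end Multisets

section Refinement

/-- Merging parts does not decrease the largest part. -/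
lemma Refines.exists_le {a : ℕ} {lam mu : Multiset ℕ} (h : Refines lam mu)
    (hl : ∃ i ∈ lam, a ≤ i) : ∃ i ∈ mu, a ≤ i := by
  induction h with
  | refl => exact hl
  | tail _ h ih =>
    obtain ⟨x, y, s, rfl, rfl⟩ := h
    obtain ⟨i, hi, hai⟩ := ih
    rcases Multiset.mem_cons.mp hi with rfl | hi
    · exact ⟨_, Multiset.mem_cons_self _ _, hai.trans (Nat.le_add_right _ _)⟩
    rcases Multiset.mem_cons.mp hi with rfl | hi
    · exact ⟨_, Multiset.mem_cons_self _ _, hai.trans (Nat.le_add_left _ _)⟩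
    · exact ⟨i, Multiset.mem_cons_of_mem hi, hai⟩

/-- Ones may be merged, one by one, into a given part. -/
lemma refines_replicate_add_cons (a c : ℕ) (s : Multiset ℕ) :
    Refines (Multiset.replicate c 1 + a ::ₘ s) ((a + c) ::ₘ s) := by
  induction c generalizing a with
  | zero => simpa using! Relation.ReflTransGen.refl
  | succ c ih =>
    refine Relation.ReflTransGen.head (b := Multiset.replicate c 1 + (a + 1) ::ₘ s)
      ⟨a, 1, Multiset.replicate c 1 + s, ?_, ?_⟩ ?_
    · rw [Multiset.replicate_succ, Multiset.add_cons, Multiset.cons_add]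
    · rw [Multiset.add_cons]
    · have := ih (a + 1)
      rwa [show a + 1 + c = a + (c + 1) by omega] at this

/-- Ones may be merged into prescribed positive parts. -/
lemma refines_replicate_add (s t : Multiset ℕ) (hs : ∀ i ∈ s, 0 < i) :
    Refines (Multiset.replicate s.sum 1 + t) (s + t) := by
  induction s using Multiset.induction_on generalizing t with
  | empty => simpa using! Relation.ReflTransGen.refl
  | cons b s ih =>
    have hb := hs b (Multiset.mem_cons_self _ _)
    have h₁ := ih (Multiset.replicate b 1 + t) fun i hi => hs i (Multiset.mem_cons_of_mem hi)
    have h₂ := refines_replicate_add_cons 1 (b - 1) (s + t)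
    rw [Nat.add_sub_cancel' hb] at h₂
    have e : s + (Multiset.replicate b 1 + t) = Multiset.replicate (b - 1) 1 + 1 ::ₘ (s + t) := by
      rw [Multiset.add_cons, ← Multiset.cons_add, ← Multiset.replicate_succ,
        Nat.sub_add_cancel hb, add_left_comm]
    rw [e] at h₁
    rw [Multiset.sum_cons, add_comm b, Multiset.replicate_add, add_assoc, Multiset.cons_add]
    exact h₁.trans h₂

/-- The partitions coarser than `1ʲ a` are those with a part at least `a`. -/
lemma refines_replicate_one_iff {j a : ℕ} {mu : Multiset ℕ} (hmu : ∀ i ∈ mu, 0 < i)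
    (hsum : mu.sum = j + a) :
    Refines (Multiset.replicate j 1 + {a}) mu ↔ ∃ i ∈ mu, a ≤ i := by
  refine ⟨fun h => h.exists_le ⟨a, by simp, le_rfl⟩, ?_⟩
  rintro ⟨b, hb, hab⟩
  obtain ⟨s, rfl⟩ := Multiset.exists_cons_of_mem hb
  have h₁ := refines_replicate_add_cons a (b - a) s
  have h₂ := refines_replicate_add s (Multiset.replicate (b - a) 1 + {a})
    fun i hi => hmu i (Multiset.mem_cons_of_mem hi)
  rw [Multiset.sum_cons] at hsum
  rw [Nat.add_sub_cancel' hab] at h₁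
  rw [← add_assoc, ← Multiset.replicate_add, show s.sum + (b - a) = j by omega, add_left_comm,
    add_comm s, Multiset.singleton_add] at h₂
  exact h₂.trans h₁

end Refinement

/-! ### Identities between the classes -/

section Identities

variable {k : Type u} [Field k] {X : FTScheme k} {R : Type v} [CommRing R] {φ : K0Var k →+* R}

variable (X) in
/-- The cycles of degree `n` whose partition of multiplicities satisfies `P`. -/
def partitionFamily (n : ℕ) (P : Multiset ℕ → Prop) : CycleFamily X := fun _ _ _ _ =>
  {M | M.card = n ∧ P (counts M)}

variable [IsSeparated X.obj.hom]

open Classical in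
variable (X) in
lemma hasMeasure_partitionFamily (n : ℕ) (P : Multiset ℕ → Prop) :
    HasMeasure φ n (partitionFamily X n P)
      (φ (∑ mu : Nat.Partition n with P mu.parts, wClass X mu.parts)) := by
  rw [map_sum, Finset.sum_subtype (p := fun mu : Nat.Partition n => P mu.parts) _ (by simp)]
  refine HasMeasure.sum (E := fun mu => countsFamily X mu.1.parts)
    (fun mu => (hasMeasure_wClass X mu.1.parts).cast mu.1.parts_sum) _
    (fun K _ _ s M => ?_) fun K _ _ s M mu nu hmu hnu => ?_
  · constructor
    · rintro ⟨hM, hP⟩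
      exact ⟨⟨countsPartition M hM, hP⟩, rfl⟩
    · rintro ⟨mu, hmu⟩
      have hmu' : counts M = mu.1.parts := hmu
      refine ⟨?_, hmu' ▸ mu.2⟩
      rw [← card_eq_sum_counts, hmu', mu.1.parts_sum]
  · exact Subtype.ext (Nat.Partition.ext ((show counts M = _ from hmu).symm.trans hnu))

variable (X) in
lemma hasMeasure_wLtClass (a n : ℕ) :
    HasMeasure φ n (partitionFamily X n fun mu => ∀ i ∈ mu, i < a) (φ (wLtClass X a n 0)) := by
  have h := hasMeasure_partitionFamily X (φ := φ) n fun mu => ∀ i ∈ mu, i < a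
  simp only [wLtClass, add_zero]
  convert h

/-- A cycle is uniquely `M + a N`, where the multiplicities in `M` are less than `a`. -/
lemma map_symClass_eq_sum (hφ : CharZero k ∨ InvariantUnderUnivHomeo φ) {a : ℕ} (ha : 0 < a)
    (n : ℕ) : φ (symClass X n) = ∑ p ∈ Finset.HasAntidiagonal.antidiagonal n,
      φ (wLtClass X a p.1 0) * if a ∣ p.2 then φ (symClass X (p.2 / a)) else 0 := by
  classical
  simp only [mul_ite, mul_zero]
  let _ : Fintype {p : ℕ × ℕ // p.1 + p.2 = n ∧ a ∣ p.2} :=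
    Fintype.subtype ((Finset.HasAntidiagonal.antidiagonal n).filter fun p => a ∣ p.2) (by simp)
  rw [← Finset.sum_filter, Finset.sum_subtype
    (p := fun p : ℕ × ℕ => p.1 + p.2 = n ∧ a ∣ p.2) _ (by simp)]
  let E (p : ℕ × ℕ) : CycleFamily X := CycleFamily.addSMul
    (partitionFamily X p.1 fun mu => ∀ i ∈ mu, i < a) (fullFamily X (p.2 / a)) a
  have hE (p : {p : ℕ × ℕ // p.1 + p.2 = n ∧ a ∣ p.2}) : HasMeasure φ n (E p.1)
      (φ (wLtClass X a p.1.1 0) * φ (symClass X (p.1.2 / a))) := by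
    refine (hasMeasure_wLtClass X a p.1.1).addSMul (hasMeasure_symClass X (p.1.2 / a)) a ?_ ?_
    · rw [Nat.mul_div_cancel' p.2.2, p.2.1]
    · intro K _ _ s M hM N _ M' hM' N' _ h
      exact add_smul_inj ha ((forall_counts_lt_iff ha).mp hM.2)
        ((forall_counts_lt_iff ha).mp hM'.2) h
  refine (hasMeasure_symClass X n).unique hφ (HasMeasure.sum hE _ (fun K _ _ s M => ?_) ?_)
  · constructor
    · intro hM
      obtain ⟨M₀, M₁, h, rfl⟩ := exists_eq_add_smul ha M
      have hcard : M₀.card + a * M₁.card = n := by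
        rw [← Multiset.card_nsmul, ← Multiset.card_add]; exact hM
      exact ⟨⟨(M₀.card, a * M₁.card), hcard, dvd_mul_right _ _⟩, M₀,
        ⟨rfl, (forall_counts_lt_iff ha).mpr h⟩, M₁, (Nat.mul_div_cancel_left _ ha).symm, rfl⟩
    · rintro ⟨p, M₀, ⟨hM₀, -⟩, M₁, hM₁, rfl⟩
      change Multiset.card _ = n
      rw [Multiset.card_add, Multiset.card_nsmul, hM₀, show M₁.card = _ from hM₁,
        Nat.mul_div_cancel' p.2.2, p.2.1]
  · rintro K _ _ s _ p q ⟨M, hM, N, hN, rfl⟩ ⟨M', hM', N', hN', h⟩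
    obtain ⟨rfl, rfl⟩ := add_smul_inj ha ((forall_counts_lt_iff ha).mp hM.2)
      ((forall_counts_lt_iff ha).mp hM'.2) h
    have h₁ : p.1.1 = q.1.1 := hM.1.symm.trans hM'.1
    refine Subtype.ext (Prod.ext h₁ ?_)
    have := p.2.1.trans q.2.1.symm
    omega

/-- A cycle of degree `j + a` either has all its multiplicities less than `a`, or its partition of
multiplicities is coarser than `1ʲ a`. -/
lemma map_wbarClass_eq (hφ : CharZero k ∨ InvariantUnderUnivHomeo φ) (a j : ℕ) :
    φ (symClass X (j + a)) = φ (wLtClass X a (j + a) 0) +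
      φ (wbarClass X (Multiset.replicate j 1 + {a})) := by
  have hsum : (Multiset.replicate j 1 + {a}).sum = j + a := by simp
  have h : HasMeasure φ (j + a)
      (partitionFamily X (j + a) fun mu => ¬ ∀ i ∈ mu, i < a)
      (φ (wbarClass X (Multiset.replicate j 1 + {a}))) := by
    have h' := (hasMeasure_partitionFamily X (φ := φ) (Multiset.replicate j 1 + {a}).sum
      fun mu => ¬ ∀ i ∈ mu, i < a).cast hsum
    have hf : partitionFamily X (Multiset.replicate j 1 + {a}).sum (fun mu => ¬ ∀ i ∈ mu, i < a) =
        partitionFamily X (j + a) fun mu => ¬ ∀ i ∈ mu, i < a := by rw [hsum]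
    rw [hf] at h'
    convert h' using 2
    refine Finset.sum_congr (Finset.ext fun mu => ?_) fun _ _ => rfl
    simp only [Finset.mem_filter, Finset.mem_univ, true_and]
    rw [refines_replicate_one_iff (fun i => mu.parts_pos) (mu.parts_sum.trans hsum)]
    push Not
    rfl
  refine (hasMeasure_symClass X (j + a)).unique (m := j + a) hφ ?_
  have h₂ := HasMeasure.sum (φ := φ) (κ := Bool) (n := j + a)
    (E := fun b => bif b then partitionFamily X (j + a) fun mu => ∀ i ∈ mu, i < a
      else partitionFamily X (j + a) fun mu => ¬ ∀ i ∈ mu, i < a)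
    (r := fun b => bif b then φ (wLtClass X a (j + a) 0)
      else φ (wbarClass X (Multiset.replicate j 1 + {a})))
    (by rintro (_ | _); exacts [h, hasMeasure_wLtClass X a (j + a)])
    (fullFamily X (j + a)) (fun K _ _ s M => ?_) fun K _ _ s M b c hb hc => ?_
  · simpa using h₂
  · rw [Bool.exists_bool]
    change _ ↔ (_ ∧ _) ∨ (_ ∧ _)
    rw [← and_or_left]
    exact (and_iff_left (em' _)).symm
  · rcases b with _ | _ <;> rcases c with _ | _
    exacts [rfl, (hb.2 hc.2).elim, (hc.2 hb.2).elim, rfl]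

/-- The parts of a partition of `n < a` are less than `a`. -/
lemma map_wLtClass_of_lt (hφ : CharZero k ∨ InvariantUnderUnivHomeo φ) {a n : ℕ} (h : n < a) :
    φ (wLtClass X a n 0) = φ (symClass X n) := by
  have h₁ := hasMeasure_wLtClass X (φ := φ) a n
  have : partitionFamily X n (fun mu => ∀ i ∈ mu, i < a) = fullFamily X n := by
    funext K _ _ s
    ext M
    refine and_iff_left_of_imp fun hM i hi => lt_of_le_of_lt ?_ h
    rw [← show M.card = n from hM, ← card_eq_sum_counts]
    exact Multiset.single_le_sum (fun _ _ => Nat.zero_le _) _ hi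
  rw [this] at h₁
  exact h₁.unique hφ (hasMeasure_symClass X n)

/-- All multiplicities are one if and only if they are less than two. -/
lemma map_wClass_replicate (hφ : CharZero k ∨ InvariantUnderUnivHomeo φ) (n : ℕ) :
    φ (wClass X (Multiset.replicate n 1)) = φ (wLtClass X 2 n 0) := by
  have : countsFamily X (Multiset.replicate n 1) =
      partitionFamily X n fun mu => ∀ i ∈ mu, i < 2 := by
    funext K _ _ s
    ext M
    exact counts_eq_replicate_iff
  have h := hasMeasure_wClass X (φ := φ) (Multiset.replicate n 1)
  rw [this] at h
  exact h.unique hφ (hasMeasure_wLtClass X 2 n)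

lemma map_symClass_zero (hφ : CharZero k ∨ InvariantUnderUnivHomeo φ) :
    φ (symClass X 0) = 1 :=
  (hasMeasure_symClass X 0).unique hφ (hasMeasure_fullFamily_zero X)

end Identities

/-! ### Generating series -/

section Series

variable {k : Type u} [Field k] {X : FTScheme k} [IsSeparated X.obj.hom] {R : Type v} [CommRing R]
  {φ : K0Var k →+* R} (hφ : CharZero k ∨ InvariantUnderUnivHomeo φ)

include hφ

lemma isUnit_expand_zetaSeries {a : ℕ} (ha : a ≠ 0) :
    IsUnit (((zetaSeries X).map φ).expand a ha) := by
  rw [PowerSeries.isUnit_iff_constantCoeff, PowerSeries.constantCoeff_expand,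
    ← PowerSeries.coeff_zero_eq_constantCoeff_apply, PowerSeries.coeff_map, zetaSeries,
    PowerSeries.coeff_mk, map_symClass_zero (X := X) hφ]
  exact isUnit_one

lemma KLt_mul_expand {a : ℕ} (ha : a ≠ 0) :
    (KLt X a 0).map φ * ((zetaSeries X).map φ).expand a ha = (zetaSeries X).map φ := by
  ext n
  rw [PowerSeries.coeff_mul]
  simp only [PowerSeries.coeff_expand, PowerSeries.coeff_map, KLt, zetaSeries, PowerSeries.coeff_mk]
  exact (map_symClass_eq_sum hφ (Nat.pos_of_ne_zero ha) n).symm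

lemma X_pow_mul_KOneBar (a : ℕ) :
    PowerSeries.X ^ a * (KOneBar X {a}).map φ = (zetaSeries X).map φ - (KLt X a 0).map φ := by
  ext n
  rw [PowerSeries.coeff_X_pow_mul', map_sub]
  simp only [PowerSeries.coeff_map, KLt, KOneBar, zetaSeries, PowerSeries.coeff_mk]
  split_ifs with h
  · obtain ⟨j, rfl⟩ := Nat.exists_eq_add_of_le' h
    rw [Nat.add_sub_cancel, map_wbarClass_eq hφ a j, add_sub_cancel_left]
  · rw [map_wLtClass_of_lt hφ (not_le.mp h), sub_self]

lemma KOne_eq_KLt : (KOne X 0).map φ = (KLt X 2 0).map φ := by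
  ext n
  simp only [PowerSeries.coeff_map, KOne, KLt, PowerSeries.coeff_mk, add_zero]
  exact map_wClass_replicate hφ n

end Series

end MotivicConf

end

theorem proposition5p5 {k : Type u} [Field k] {R : Type v} [CommRing R]
    (φ : MotivicConf.K0Var k →+* R)
    (hφ : CharZero k ∨ MotivicConf.InvariantUnderUnivHomeo φ)
    (X : MotivicConf.FTScheme k) (hX : X.IsVariety) :
    -- the classes of the symmetric powers and of the configuration spaces are well defined
    (∀ n, (∃ c, MotivicConf.IsImageClass X n Set.univ c) ∧
      ∀ c, MotivicConf.IsImageClass X n Set.univ c → φ c = φ (MotivicConf.symClass X n)) ∧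
    (∀ lam : Multiset ℕ,
      (∃ c, MotivicConf.IsImageClass X lam.sum (MotivicConf.confLocus X lam) c) ∧
      ∀ c, MotivicConf.IsImageClass X lam.sum (MotivicConf.confLocus X lam) c →
        φ c = φ (MotivicConf.wClass X lam)) ∧
    -- the formulas
    (∀ (a : ℕ) (ha : 1 < a),
      IsUnit (((MotivicConf.zetaSeries X).map φ).expand a (Nat.ne_zero_of_lt ha)) ∧
      (MotivicConf.KLt X a 0).map φ =
        (MotivicConf.zetaSeries X).map φ *
          Ring.inverse (((MotivicConf.zetaSeries X).map φ).expand a (Nat.ne_zero_of_lt ha)) ∧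
      PowerSeries.X ^ a * (MotivicConf.KOneBar X {a}).map φ =
        (MotivicConf.zetaSeries X).map φ *
          (1 - Ring.inverse
            (((MotivicConf.zetaSeries X).map φ).expand a (Nat.ne_zero_of_lt ha)))) ∧
    (MotivicConf.KOne X 0).map φ =
      (MotivicConf.zetaSeries X).map φ *
        Ring.inverse (((MotivicConf.zetaSeries X).map φ).expand 2 two_ne_zero) := by
  have := hX.separated
  have hK (a : ℕ) (ha : a ≠ 0) : (MotivicConf.KLt X a 0).map φ =
      (MotivicConf.zetaSeries X).map φ *
        Ring.inverse (((MotivicConf.zetaSeries X).map φ).expand a ha) :=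
    (Ring.eq_mul_inverse_iff_mul_eq _ _ _ (MotivicConf.isUnit_expand_zetaSeries hφ ha)).mpr
      (MotivicConf.KLt_mul_expand hφ ha)
  refine ⟨fun n => ⟨MotivicConf.exists_isImageClass_univ X n, fun c hc => ?_⟩,
    fun lam => ⟨MotivicConf.exists_isImageClass_confLocus X lam, fun c hc => ?_⟩,
    fun a ha => ⟨MotivicConf.isUnit_expand_zetaSeries hφ _, hK a _, ?_⟩, ?_⟩
  · have h := MotivicConf.hasMeasure_of_isImageClass (φ := φ) hc
    rw [MotivicConf.pointFamily_univ] at h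
    exact h.unique hφ (MotivicConf.hasMeasure_symClass X n)
  · have h := MotivicConf.hasMeasure_of_isImageClass (φ := φ) hc
    rw [MotivicConf.pointFamily_confLocus] at h
    exact h.unique hφ (MotivicConf.hasMeasure_wClass X lam)
  · rw [MotivicConf.X_pow_mul_KOneBar hφ a, hK a (Nat.ne_zero_of_lt ha), mul_sub, mul_one]
  · rw [MotivicConf.KOne_eq_KLt hφ, hK 2 two_ne_zero]
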